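/- Locally compact spaces are Hausdorff. A locally compact groupoid $\mathcal G$ is a groupoid with a locally compact (Hausdorff) topology such that the structure maps are continuous and the range map $r$ is open; $\mathcal G^{(0)}$ is its unit space, $\mathcal G^x=r^{-1}(x)$. A left $\mathcal G$-space is a locally compact space $Y$ with a continuous surjection $p:Y\to\mathcal G^{(0)}$ (the momentum, not assumed open) and a continuous action $(\gamma,y)\mapsto\gamma y$, defined when $s(\gamma)=p(y)$, with $p(\gamma y)=r(\gamma)$, $p(y)y=y$, $(\gamma_2\gamma_1)y=\gamma_2(\gamma_1y)$; right spaces are defined similarly. The semi-direct product $Y\rtimes\mathcal G$ is the locally compact groupoid $\{(y,\gamma):p(y)=r(\gamma)\}$ with unit space $Y$, range $y$, source $\gamma^{-1}y$ and product $(y,\gamma)(\gamma^{-1}y,\gamma_1)=(y,\gamma\gamma_1)$. $\mathcal G$ is amenable if there is a net $(m_i)$ of families $m_i=(m_i^x)_{x\in\mathcal G^{(0)}}$ of Radon probability measures $m_i^x$ on $\mathcal G^x$ such that $x\mapsto\int f\,dm_i^x$ is continuous for all $i$ and all $f\in C_c(\mathcal G)$, and $\|\gamma m_i^{s(\gamma)}-m_i^{r(\gamma)}\|_1\to0$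 uniformly on compact subsets of $\mathcal G$. A $\mathcal G$-space $Y$ is amenable if $Y\rtimes\mathcal G$ is amenable. $\mathcal G$ is amenable at infinity if there is an amenable $\mathcal G$-space $(Y,p)$ with $p$ proper, and strongly amenable at infinity if moreover $(Y,p)$ can be chosen such that $p$ has a continuous section. A $\mathcal G$-$\mathcal H$-equivalence is a locally compact space $Z$ that is a left $\mathcal G$-space with open momentum $q_{\mathcal G}$ and a right $\mathcal H$-space with open momentum $q_{\mathcal H}$, such that both actions are free and proper, the two actions commute, $q_{\mathcal G}$ induces a homeomorphism $Z/\mathcal H\to\mathcal G^{(0)}$ and $q_{\mathcal H}$ induces a homeomorphism $\mathcal G\backslash Z\to\mathcal H^{(0)}$. $\mathcal G$ and $\mathcal H$ are equivalent if such a $Z$ exists. A Haar system on $\mathcal G$ is a family $(\lambda^x)_{x\in\mathcal G^{(0)}}$ of Radon measures, $\lambda^x$ having support $\mathcal G^x$, such that $x\mapsto\int f\,d\lambda^x$ is continuous for $f\in C_c(\mathcal G)$ and $\int f(\gamma\gamma_1)\,d\lambda^{s(\gamma)}(\gamma_1)=\int f(\gamma_1)\,d\lambda^{r(\gamma)}(\gamma_1)$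 for all $\gamma\in\mathcal G$, $f\in C_c(\mathcal G)$. Theorem. Let $\mathcal G$ and $\mathcal H$ be locally compact groupoids. (1) If $\mathcal G$ and $\mathcal H$ are equivalent and $\mathcal H$ is amenable at infinity, then $\mathcal G$ is amenable at infinity. (2) Let $Z$ be a $\mathcal G$-$\mathcal H$-equivalence such that $q_{\mathcal G}:Z\to\mathcal G^{(0)}$ has a continuous section. Assume that $\mathcal G$ has a Haar system or that $\mathcal G$ and $\mathcal H$ are both second countable. If $\mathcal H$ is strongly amenable at infinity, then $\mathcal G$ is strongly amenable at infinity. -/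

import Mathlib

open Set Filter Topology MeasureTheory
open scoped CompactlySupported

universe u

/-- A locally compact groupoid: a groupoid with arrow space `Arrow` and unit space `Obj`,
with locally compact Hausdorff topology on the arrows, continuous structure maps and open
range map. Here `e` is the inclusion of the units; since `e` and `r` are continuous and
`r (e x) = x`, it is a homeomorphism onto its image, so `Obj` carries the topology induced
by `Arrow`. -/
structure LCGroupoid : Type (u + 1) where
  Obj : Type u
  Arrow : Type u
  [topObj : TopologicalSpace Obj]
  [topArrow : TopologicalSpace Arrow]
  [t2Arrow : T2Space Arrow]
  [lcArrow : LocallyCompactSpace Arrow]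
  r : Arrow → Obj
  s : Arrow → Obj
  e : Obj → Arrow
  mul : (g h : Arrow) → s g = r h → Arrow
  inv : Arrow → Arrow
  r_e : ∀ x, r (e x) = x
  s_e : ∀ x, s (e x) = x
  r_mul : ∀ g h (w : s g = r h), r (mul g h w) = r g
  s_mul : ∀ g h (w : s g = r h), s (mul g h w) = s h
  r_inv : ∀ g, r (inv g) = s g
  s_inv : ∀ g, s (inv g) = r g
  mul_assoc : ∀ g h k (w : s g = r h) (w' : s h = r k),
    mul (mul g h w) k ((s_mul g h w).trans w') = mul g (mul h k w') (w.trans (r_mul h k w').symm)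
  e_mul : ∀ g, mul (e (r g)) g (s_e (r g)) = g
  mul_e : ∀ g, mul g (e (s g)) (r_e (s g)).symm = g
  mul_inv : ∀ g, mul g (inv g) (r_inv g).symm = e (r g)
  inv_mul : ∀ g, mul (inv g) g (s_inv g) = e (s g)
  continuous_r : Continuous r
  continuous_s : Continuous s
  continuous_e : Continuous e
  continuous_mul : Continuous fun q : {q : Arrow × Arrow // s q.1 = r q.2} => mul q.1.1 q.1.2 q.2
  continuous_inv : Continuous inv
  isOpenMap_r : IsOpenMap r

attribute [instance] LCGroupoid.topObj LCGroupoid.topArrow LCGroupoid.t2Arrow LCGroupoid.lcArrow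

namespace LCGroupoid

/-- The unit space is Hausdorff. -/
theorem t2Obj (G : LCGroupoid.{u}) : T2Space G.Obj :=
  T2Space.of_injective_continuous (Function.LeftInverse.injective G.r_e) G.continuous_e

/-! ### Amenability -/

/-- The fibre `G^x = r⁻¹(x)`, with the subspace topology and its Borel sets. -/
def Fiber (G : LCGroupoid.{u}) (x : G.Obj) : Type u := {g : G.Arrow // G.r g = x}

instance (G : LCGroupoid.{u}) (x : G.Obj) : TopologicalSpace (G.Fiber x) :=
  inferInstanceAs (TopologicalSpace {g : G.Arrow // G.r g = x})

instance (G : LCGroupoid.{u}) (x : G.Obj) : MeasurableSpace (G.Fiber x) := borel _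

instance (G : LCGroupoid.{u}) (x : G.Obj) : BorelSpace (G.Fiber x) := ⟨rfl⟩

/-- Left translation by `γ`, from `G^{s(γ)}` to `G^{r(γ)}`. -/
def translate (G : LCGroupoid.{u}) (γ : G.Arrow) (g : G.Fiber (G.s γ)) : G.Fiber (G.r γ) :=
  ⟨G.mul γ g.1 g.2.symm, G.r_mul _ _ _⟩

end LCGroupoid

/-- The total variation norm `‖μ - ν‖₁` of the difference of two finite measures. -/
noncomputable def l1Dist {α : Type u} [MeasurableSpace α] (μ ν : Measure α)
    [IsFiniteMeasure μ] [IsFiniteMeasure ν] : ℝ :=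
  ((μ.toSignedMeasure - ν.toSignedMeasure).totalVariation Set.univ).toReal

namespace LCGroupoid

/-- A family of Radon probability measures `m^x` on the fibres `G^x` which is continuous:
`x ↦ ∫ f dm^x` is continuous for every `f ∈ C_c(G)`. -/
def IsContinuousMean (G : LCGroupoid.{u}) (m : (x : G.Obj) → ProbabilityMeasure (G.Fiber x)) :
    Prop :=
  (∀ x, (m x : Measure (G.Fiber x)).Regular) ∧
    ∀ f : C_c(G.Arrow, ℝ), Continuous fun x => ∫ g, f g.1 ∂(m x : Measure (G.Fiber x))

/-- `G` is amenable: it has an approximate invariant continuous mean, that is a net of continuous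
means with `‖γ m_i^{s(γ)} - m_i^{r(γ)}‖₁ → 0` uniformly on compact subsets of `G`. -/
def IsAmenable (G : LCGroupoid.{u}) : Prop :=
  ∃ (I : Type u) (_ : Preorder I) (_ : IsDirectedOrder I) (_ : Nonempty I)
    (m : I → (x : G.Obj) → ProbabilityMeasure (G.Fiber x)),
    (∀ i, G.IsContinuousMean (m i)) ∧
    ∀ K : Set G.Arrow, IsCompact K →
      TendstoUniformlyOn
        (fun i γ => l1Dist ((m i (G.s γ) : Measure (G.Fiber (G.s γ))).map (G.translate γ))
          (m i (G.r γ) : Measure (G.Fiber (G.r γ))))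
        (fun _ => 0) atTop K

/-- `G` has a Haar system: Radon measures `λ^x` with full support on the fibres `G^x`,
continuous and left invariant. -/
def HasHaarSystem (G : LCGroupoid.{u}) : Prop :=
  ∃ lam : (x : G.Obj) → Measure (G.Fiber x),
    (∀ x, (lam x).Regular ∧ (lam x).IsOpenPosMeasure) ∧
    (∀ f : C_c(G.Arrow, ℝ), Continuous fun x => ∫ g, f g.1 ∂(lam x)) ∧
    ∀ (γ : G.Arrow) (f : C_c(G.Arrow, ℝ)),
      ∫ g, f (G.translate γ g).1 ∂(lam (G.s γ)) = ∫ g, f g.1 ∂(lam (G.r γ))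

/-! ### Actions -/

/-- The structure of a left `G`-space on `Y`: a continuous surjective momentum map
`p : Y → G⁽⁰⁾` (not assumed to be open) and a continuous action. -/
structure LeftAction (G : LCGroupoid.{u}) (Y : Type u) [TopologicalSpace Y] where
  p : Y → G.Obj
  continuous_p : Continuous p
  surjective_p : Function.Surjective p
  act : (g : G.Arrow) → (y : Y) → G.s g = p y → Y
  p_act : ∀ g y (w : G.s g = p y), p (act g y w) = G.r g
  e_act : ∀ y, act (G.e (p y)) y (G.s_e (p y)) = y
  mul_act : ∀ g₂ g₁ y (w : G.s g₁ = p y) (w' : G.s g₂ = G.r g₁),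
    act (G.mul g₂ g₁ w') y ((G.s_mul _ _ _).trans w) =
      act g₂ (act g₁ y w) (w'.trans (p_act g₁ y w).symm)
  continuous_act : Continuous fun q : {q : G.Arrow × Y // G.s q.1 = p q.2} => act q.1.1 q.1.2 q.2

/-- The structure of a right `G`-space on `Y`. -/
structure RightAction (G : LCGroupoid.{u}) (Y : Type u) [TopologicalSpace Y] where
  p : Y → G.Obj
  continuous_p : Continuous p
  surjective_p : Function.Surjective p
  act : (y : Y) → (g : G.Arrow) → p y = G.r g → Y
  p_act : ∀ y g (w : p y = G.r g), p (act y g w) = G.s g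
  act_e : ∀ y, act y (G.e (p y)) (G.r_e (p y)).symm = y
  act_mul : ∀ y g₁ g₂ (w : p y = G.r g₁) (w' : G.s g₁ = G.r g₂),
    act y (G.mul g₁ g₂ w') (w.trans (G.r_mul _ _ _).symm) =
      act (act y g₁ w) g₂ ((p_act y g₁ w).trans w')
  continuous_act : Continuous fun q : {q : Y × G.Arrow // p q.1 = G.r q.2} => act q.1.1 q.1.2 q.2

namespace LeftAction

variable {G : LCGroupoid.{u}} {Y : Type u} [TopologicalSpace Y]

theorem act_congr (a : G.LeftAction Y) {g g' : G.Arrow} {y y' : Y} (hg : g = g') (hy : y = y')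
    (w : G.s g = a.p y) (w' : G.s g' = a.p y') : a.act g y w = a.act g' y' w' := by
  subst hg; subst hy; rfl

end LeftAction

theorem mul_congr (G : LCGroupoid.{u}) {g g' h h' : G.Arrow} (hg : g = g') (hh : h = h')
    (w : G.s g = G.r h) (w' : G.s g' = G.r h') : G.mul g h w = G.mul g' h' w' := by
  subst hg; subst hh; rfl

theorem inv_unique (G : LCGroupoid.{u}) {g h : G.Arrow} (w : G.s g = G.r h)
    (hgh : G.mul g h w = G.e (G.r g)) : h = G.inv g := by
  have h1 := G.mul_assoc (G.inv g) g h (G.s_inv g) w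
  rw [G.mul_congr (G.inv_mul g) rfl _ ((G.s_e _).trans w),
    G.mul_congr (congrArg G.e w) rfl _ (G.s_e _), G.e_mul,
    G.mul_congr rfl (hgh.trans (congrArg G.e (G.s_inv g).symm)) _ (G.r_e _).symm, G.mul_e] at h1
  exact h1

theorem inv_e (G : LCGroupoid.{u}) (x : G.Obj) : G.inv (G.e x) = G.e x := by
  symm
  have w : G.s (G.e x) = G.r (G.e x) := by rw [G.s_e, G.r_e]
  refine G.inv_unique w ?_
  rw [G.mul_congr (congrArg G.e (G.r_e x).symm) rfl w (G.s_e _), G.e_mul, G.r_e]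

theorem inv_mul_rev (G : LCGroupoid.{u}) (g h : G.Arrow) (w : G.s g = G.r h) :
    G.inv (G.mul g h w) =
      G.mul (G.inv h) (G.inv g) ((G.s_inv h).trans (w.symm.trans (G.r_inv g).symm)) := by
  symm
  refine G.inv_unique ?_ ?_
  · rw [G.s_mul, G.r_mul, G.r_inv]
  · have w1 : G.s h = G.r (G.inv h) := (G.r_inv h).symm
    have w2 : G.s (G.inv h) = G.r (G.inv g) :=
      (G.s_inv h).trans (w.symm.trans (G.r_inv g).symm)
    rw [G.mul_assoc g h _ w (w1.trans (G.r_mul _ _ w2).symm),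
      G.mul_congr rfl (G.mul_assoc h (G.inv h) (G.inv g) w1 w2).symm _
        (by rw [G.r_mul, G.r_mul]; exact w),
      G.mul_congr rfl (G.mul_congr ((G.mul_inv h).trans
        (congrArg G.e (w.symm.trans (G.r_inv g).symm))) rfl _ (G.s_e _)) _
        (by rw [G.r_mul, G.r_e, G.r_inv]),
      G.mul_congr rfl (G.e_mul (G.inv g)) _ (G.r_inv g).symm, G.mul_inv, G.r_mul]

namespace LeftAction

variable {G : LCGroupoid.{u}} {Y : Type u} [TopologicalSpace Y]

theorem inv_w (a : G.LeftAction Y) (q : {q : Y × G.Arrow // a.p q.1 = G.r q.2}) :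
    G.s (G.inv q.1.2) = a.p q.1.1 := (G.s_inv _).trans q.2.symm

theorem comp_w (a : G.LeftAction Y) (q q' : {q : Y × G.Arrow // a.p q.1 = G.r q.2})
    (w : a.act (G.inv q.1.2) q.1.1 (a.inv_w q) = q'.1.1) : G.s q.1.2 = G.r q'.1.2 :=
  (G.r_inv _).symm.trans ((a.p_act _ _ (a.inv_w q)).symm.trans ((congrArg a.p w).trans q'.2))

/-- The semi-direct product groupoid `Y ⋊ G`: its unit space is `Y`, its arrows are the pairs
`(y, γ)` with `p y = r γ`; the range of `(y, γ)` is `y`, its source is `γ⁻¹ y`, and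
`(y, γ) (γ⁻¹ y, γ₁) = (y, γ γ₁)`, `(y, γ)⁻¹ = (γ⁻¹ y, γ⁻¹)`. -/
def semidirect [T2Space Y] [LocallyCompactSpace Y] (a : G.LeftAction Y) : LCGroupoid.{u} where
  Obj := Y
  Arrow := {q : Y × G.Arrow // a.p q.1 = G.r q.2}
  lcArrow := by
    have := G.t2Obj
    have hc : IsClosed {q : Y × G.Arrow | a.p q.1 = G.r q.2} :=
      isClosed_eq (a.continuous_p.comp continuous_fst) (G.continuous_r.comp continuous_snd)
    exact hc.isClosedEmbedding_subtypeVal.locallyCompactSpace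
  r q := q.1.1
  s q := a.act (G.inv q.1.2) q.1.1 (a.inv_w q)
  e y := ⟨(y, G.e (a.p y)), (G.r_e _).symm⟩
  mul q q' w := ⟨(q.1.1, G.mul q.1.2 q'.1.2 (a.comp_w q q' w)), q.2.trans (G.r_mul _ _ _).symm⟩
  inv q := ⟨(a.act (G.inv q.1.2) q.1.1 (a.inv_w q), G.inv q.1.2), a.p_act _ _ _⟩
  r_e _ := rfl
  s_e y := (a.act_congr (G.inv_e _) rfl _ (G.s_e _)).trans (a.e_act y)
  r_mul _ _ _ := rfl
  s_mul q q' w := by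
    have w1 : G.s (G.inv q'.1.2) = a.p (a.act (G.inv q.1.2) q.1.1 (a.inv_w q)) :=
      (a.inv_w q').trans (congrArg a.p w).symm
    refine (a.act_congr (G.inv_mul_rev _ _ _) rfl _ ?_).trans
      ((a.mul_act _ _ _ (a.inv_w q) (w1.trans (a.p_act _ _ _))).trans
        (a.act_congr rfl w _ _))
    rw [G.s_mul]; exact a.inv_w q
  r_inv _ := rfl
  s_inv q := by
    have w0 : G.s (G.inv (G.inv q.1.2)) = G.r (G.inv q.1.2) := G.s_inv _
    refine (a.mul_act _ _ _ (a.inv_w q) w0).symm.trans ?_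
    refine (a.act_congr ((G.inv_mul _).trans (congrArg G.e (a.inv_w q))) rfl _
      (G.s_e _)).trans (a.e_act _)
  mul_assoc q q' q'' w w' := Subtype.ext (Prod.ext rfl (G.mul_assoc _ _ _ _ _))
  e_mul q := Subtype.ext (Prod.ext rfl
    ((G.mul_congr (congrArg G.e q.2) rfl _ (G.s_e _)).trans (G.e_mul _)))
  mul_e q := Subtype.ext (Prod.ext rfl
    ((G.mul_congr rfl (congrArg G.e ((a.p_act _ _ _).trans (G.r_inv _))) _
      (G.r_e _).symm).trans (G.mul_e _)))
  mul_inv q := Subtype.ext (Prod.ext rfl ((G.mul_inv _).trans (congrArg G.e q.2.symm)))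
  inv_mul q := Subtype.ext (Prod.ext rfl ((G.inv_mul _).trans
    (congrArg G.e ((a.p_act _ _ _).trans (G.r_inv _)).symm)))
  continuous_r := continuous_fst.comp continuous_subtype_val
  continuous_s := a.continuous_act.comp
    (f := fun q : {q : Y × G.Arrow // a.p q.1 = G.r q.2} =>
      (⟨(G.inv q.1.2, q.1.1), a.inv_w q⟩ : {q : G.Arrow × Y // G.s q.1 = a.p q.2}))
    (Continuous.subtype_mk ((G.continuous_inv.comp
      (continuous_snd.comp continuous_subtype_val)).prodMk
      (continuous_fst.comp continuous_subtype_val)) _)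
  continuous_e := Continuous.subtype_mk
    (continuous_id.prodMk (G.continuous_e.comp a.continuous_p)) _
  continuous_mul := by
    refine Continuous.subtype_mk (Continuous.prodMk ?_ ?_) _
    · exact continuous_fst.comp
        (continuous_subtype_val.comp (continuous_fst.comp continuous_subtype_val))
    · refine G.continuous_mul.comp (Continuous.subtype_mk (Continuous.prodMk ?_ ?_)
        (fun x => a.comp_w x.1.1 x.1.2 x.2))
      · exact continuous_snd.comp
          (continuous_subtype_val.comp (continuous_fst.comp continuous_subtype_val))
      · exact continuous_snd.comp
          (continuous_subtype_val.comp (continuous_snd.comp continuous_subtype_val))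
  continuous_inv := by
    have h1 : Continuous fun q : {q : Y × G.Arrow // a.p q.1 = G.r q.2} => G.inv q.1.2 :=
      G.continuous_inv.comp (continuous_snd.comp continuous_subtype_val)
    refine Continuous.subtype_mk (Continuous.prodMk ?_ h1) _
    exact a.continuous_act.comp
      (f := fun q : {q : Y × G.Arrow // a.p q.1 = G.r q.2} =>
        (⟨(G.inv q.1.2, q.1.1), a.inv_w q⟩ : {q : G.Arrow × Y // G.s q.1 = a.p q.2}))
      (Continuous.subtype_mk (h1.prodMk (continuous_fst.comp continuous_subtype_val)) _)
  isOpenMap_r := by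
    intro O hO
    obtain ⟨O', hO', rfl⟩ := isOpen_induced_iff.mp hO
    rw [isOpen_iff_mem_nhds]
    rintro _ ⟨q, hq, rfl⟩
    obtain ⟨U, V, hU, hV, hqU, hqV, hUV⟩ := isOpen_prod_iff.mp hO' q.1.1 q.1.2 hq
    have hn : U ∩ a.p ⁻¹' (G.r '' V) ∈ 𝓝 q.1.1 :=
      (hU.inter ((G.isOpenMap_r V hV).preimage a.continuous_p)).mem_nhds
        ⟨hqU, q.1.2, hqV, q.2.symm⟩
    refine Filter.mem_of_superset hn ?_
    rintro y ⟨hy, g, hg, hgy⟩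
    exact ⟨⟨(y, g), hgy.symm⟩, hUV (Set.mk_mem_prod hy hg), rfl⟩

/-- The action is amenable if the semi-direct product groupoid is amenable. -/
def IsAmenable [T2Space Y] [LocallyCompactSpace Y] (a : G.LeftAction Y) : Prop :=
  a.semidirect.IsAmenable

/-- `Y` is a principal left `G`-space: the action is free and proper. -/
def IsPrincipal (a : G.LeftAction Y) : Prop :=
  (∀ g y (w : G.s g = a.p y), a.act g y w = y → g ∈ Set.range G.e) ∧
    IsProperMap fun q : {q : G.Arrow × Y // G.s q.1 = a.p q.2} => (a.act q.1.1 q.1.2 q.2, q.1.2)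

/-- `y` and `y'` are in the same orbit. -/
def Rel (a : G.LeftAction Y) (y y' : Y) : Prop := ∃ g, ∃ w : G.s g = a.p y, y' = a.act g y w

end LeftAction

namespace RightAction

variable {G : LCGroupoid.{u}} {Y : Type u} [TopologicalSpace Y]

/-- `Y` is a principal right `G`-space: the action is free and proper. -/
def IsPrincipal (a : G.RightAction Y) : Prop :=
  (∀ y g (w : a.p y = G.r g), a.act y g w = y → g ∈ Set.range G.e) ∧
    IsProperMap fun q : {q : Y × G.Arrow // a.p q.1 = G.r q.2} => (q.1.1, a.act q.1.1 q.1.2 q.2)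

/-- `y` and `y'` are in the same orbit. -/
def Rel (a : G.RightAction Y) (y y' : Y) : Prop := ∃ g, ∃ w : a.p y = G.r g, y' = a.act y g w

end RightAction

/-! ### Amenability at infinity -/

/-- `G` is amenable at infinity: there is an amenable `G`-space whose momentum map is proper. -/
def AmenableAtInfinity (G : LCGroupoid.{u}) : Prop :=
  ∃ (Y : Type u) (_ : TopologicalSpace Y) (_ : T2Space Y) (_ : LocallyCompactSpace Y)
    (a : G.LeftAction Y), IsProperMap a.p ∧ a.IsAmenable

/-- `G` is strongly amenable at infinity: there is an amenable `G`-space whose momentum map is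
proper and has a continuous section. -/
def StronglyAmenableAtInfinity (G : LCGroupoid.{u}) : Prop :=
  ∃ (Y : Type u) (_ : TopologicalSpace Y) (_ : T2Space Y) (_ : LocallyCompactSpace Y)
    (a : G.LeftAction Y), IsProperMap a.p ∧ a.IsAmenable ∧
      ∃ σ : G.Obj → Y, Continuous σ ∧ ∀ x, a.p (σ x) = x

/-! ### Equivalence of groupoids -/

/-- The structure of a `G`-`H`-equivalence on the (locally compact Hausdorff) space `Z`. The fields
`momentum_left`, `momentum_right`, `commute` say that the two actions commute. -/
structure MoritaEquivalence (G H : LCGroupoid.{u}) (Z : Type u) [TopologicalSpace Z] where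
  left : G.LeftAction Z
  right : H.RightAction Z
  principal_left : left.IsPrincipal
  isOpenMap_left : IsOpenMap left.p
  principal_right : right.IsPrincipal
  isOpenMap_right : IsOpenMap right.p
  momentum_left : ∀ z h (w : right.p z = H.r h), left.p (right.act z h w) = left.p z
  momentum_right : ∀ g z (w : G.s g = left.p z), right.p (left.act g z w) = right.p z
  commute : ∀ g z h (w : G.s g = left.p z) (w' : right.p z = H.r h),
    right.act (left.act g z w) h ((momentum_right g z w).trans w') =
      left.act g (right.act z h w') (w.trans (momentum_left z h w').symm)
  homeo_left : IsHomeomorph (Quot.lift left.p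
    (fun z z' (hz : right.Rel z z') => by
      obtain ⟨h, w, rfl⟩ := hz; exact (momentum_left z h w).symm) : Quot right.Rel → G.Obj)
  homeo_right : IsHomeomorph (Quot.lift right.p
    (fun z z' (hz : left.Rel z z') => by
      obtain ⟨g, w, rfl⟩ := hz; exact (momentum_right g z w).symm) : Quot left.Rel → H.Obj)

/-- `G` and `H` are equivalent. -/
def Equivalent (G H : LCGroupoid.{u}) : Prop :=
  ∃ (Z : Type u) (_ : TopologicalSpace Z) (_ : T2Space Z) (_ : LocallyCompactSpace Z),
    Nonempty (MoritaEquivalence G H Z)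

end LCGroupoid

/-! # Amenability at infinity under equivalence of groupoids

An equivalence is used in the form of a `Bispace`: the right action of `H` is turned into a left
action, so that the notion is symmetric, and properness of the free actions is replaced by
continuity of the division maps. The fibres of `Z → G⁽⁰⁾` are the `H`-orbits and the fibres of
`Z → H⁽⁰⁾` are the `G`-orbits.

Both parts rest on one transfer result, `isAmenable_of_kernels`. Let `Y` be an amenable `H`-space,
`Y'` an `H`-space over `Y`, and `X` a `G`-space. A mean on the fibre of `X ⋊ G` over `ξ`, that is,
on the arrows of `G` with range `p ξ`, is composed from three pieces:

* a probability measure on the fibre product `Z *_{H⁽⁰⁾} Y'` over `p ξ`, carried by one `H`-orbit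
  which depends equivariantly on `ξ` (`HasOrbitKernels`);
* the almost invariant mean of `Y ⋊ H`, which averages along that orbit;
* a probability measure on the `G`-orbit of each point `z` of `Z`, identified with the fibre of `G`
  over the momentum of `z` by the division map (`HasFiberKernels`).

The middle step makes the result almost independent of the choice of a point of the `H`-orbit, and
the other steps commute with `G`, so the mean is almost invariant. No invariance is required of the
measures in the first and last steps; they only have to be continuous, with a common compact
carrier for the points of a given compact set. After cutting off the mean of `Y ⋊ H`, all integrals
are over compact sets, and the mass which is lost is put on the units
(`exists_isContinuousMean_of_operator`).

For the first part, `X` has to be proper over `G⁽⁰⁾`, and `HasOrbitKernels` has to be produced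
without Haar systems or countability assumptions. A point of `X` over `x` is, for each compact
`C ⊆ H⁽⁰⁾`, a positive functional carried by the part over `C` of one `H`-orbit in the fibre of
`Z *_{H⁽⁰⁾} Y'` over `x`, which is bounded above and below at fixed scales, like the counting
measure of a Delone set (`IsDelone`). Counting measures of maximal separated sets show that such
functionals exist (`exists_isDelone`); the conditions are closed and bound the functionals
pointwise, so that their space is proper over `G⁽⁰⁾` by Tychonoff's theorem (`isCompact_isDelone`).
Normalising a cut-off functional gives the required probability measure, and the lower bound keeps
the normalisation away from zero (`exists_isKernel_isDelone`). The same construction with `G` and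
`H` exchanged gives a proper `H`-space `B` over which fibre kernels exist, and `Y' = Y ×_{H⁽⁰⁾} B`
satisfies both requirements.

For the second part, a section `σ` of `Z → G⁽⁰⁾` defines a continuous cocycle from `G` to `H`,
through which `G` acts on the pullback of `Y` along `σ` (`sectionAction`). A section of `Y → H⁽⁰⁾`
pulls back as well. The Dirac measures at the points `(σ x, y)` are orbit kernels. Fibre kernels
come from integration over `G`-orbits when `G` has a Haar system
(`hasFiberKernels_of_hasHaarSystem`). In the second countable case, `Z` is metrizable, and they are
limits of finitely supported measures obtained by refining covers of a compact set and distributing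
the weights (`exists_isKernel_of_metrizable`). -/

/-! ### Extension of functions and integrals against families of measures -/

section Extension

variable {B : Type*} [TopologicalSpace B] [T2Space B] [LocallyCompactSpace B]

/-- Tietze's theorem for compact subsets of a locally compact Hausdorff space, which need not be
normal: extend to the one-point compactification. -/
theorem IsCompact.exists_continuousMap_eqOn {C : Set B} (hC : IsCompact C) {f : B → ℝ}
    (hf : ContinuousOn f C) : ∃ F : C(B, ℝ), EqOn F f C := by
  have : CompactSpace C := isCompact_iff_compactSpace.mp hC
  have he : IsClosedEmbedding (fun c : C => ((c : B) : OnePoint B)) :=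
    Continuous.isClosedEmbedding (OnePoint.continuous_coe.comp continuous_subtype_val)
      (OnePoint.coe_injective.comp Subtype.val_injective)
  obtain ⟨F, hF⟩ := ContinuousMap.exists_extension he
    (⟨C.domRestrict f, continuousOn_iff_continuous_domRestrict.mp hf⟩ : C(C, ℝ))
  refine ⟨⟨fun b => F (b : OnePoint B), F.continuous.comp OnePoint.continuous_coe⟩, ?_⟩
  intro b hb
  exact congrFun (congrArg DFunLike.coe hF) (⟨b, hb⟩ : C)

theorem IsCompact.exists_cutoff {K : Set B} (hK : IsCompact K) {U : Set B} (hU : IsOpen U)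
    (hKU : K ⊆ U) :
    ∃ χ : C_c(B, ℝ), (∀ b ∈ K, χ b = 1) ∧ (∀ b, b ∉ U → χ b = 0) ∧ (∀ b, 0 ≤ χ b) ∧
      ∀ b, χ b ≤ 1 := by
  obtain ⟨f, h1, h0, hc, h01⟩ := exists_continuous_one_zero_of_isCompact hK hU.isClosed_compl
    (disjoint_compl_right_iff_subset.mpr hKU)
  exact ⟨⟨f, hc⟩, fun b hb => h1 hb, fun b hb => h0 hb, fun b => (h01 b).1, fun b => (h01 b).2⟩

theorem IsClosed.exists_compactlySupported_eqOn {T : Set B} (hT : IsClosed T) {f : B → ℝ}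
    (hf : ContinuousOn f T) {K : Set B} (hK : IsCompact K) (hfK : ∀ b ∈ T, f b ≠ 0 → b ∈ K) :
    ∃ F : C_c(B, ℝ), EqOn F f T := by
  obtain ⟨K', hK', hKK'⟩ := exists_compact_superset hK
  obtain ⟨χ, h1, h0, -, -⟩ := hK.exists_cutoff isOpen_interior hKK'
  obtain ⟨F, hF⟩ := (hK'.inter_left hT).exists_continuousMap_eqOn (hf.mono inter_subset_left)
  refine ⟨⟨χ.toContinuousMap * F, χ.hasCompactSupport.mul_right⟩, ?_⟩
  intro b hb
  change χ b * F b = f b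
  by_cases hbK : b ∈ K
  · rw [h1 b hbK, one_mul]
    exact hF ⟨hb, interior_subset (hKK' hbK)⟩
  · have h : f b = 0 := by
      by_contra h
      exact hbK (hfK b hb h)
    rw [h]
    by_cases hb' : b ∈ interior K'
    · rw [hF ⟨hb, interior_subset hb'⟩, h, mul_zero]
    · rw [h0 b hb', zero_mul]

end Extension

section Integrals

variable {B : Type*} [TopologicalSpace B] [MeasurableSpace B] [BorelSpace B]

theorem ContinuousOn.integrable_of_ae_mem [T2Space B] {μ : Measure B} [IsFiniteMeasureOnCompacts μ]
    {T : Set B} (hT : IsClosed T) (hμ : ∀ᵐ b ∂μ, b ∈ T) {f : B → ℝ} (hf : ContinuousOn f T)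
    {K : Set B} (hK : IsCompact K) (hfK : ∀ b ∈ T, f b ≠ 0 → b ∈ K) : Integrable f μ := by
  have h1 : IntegrableOn f (T ∩ K) μ :=
    (hf.mono inter_subset_left).integrableOn_compact (hK.inter_left hT)
  have h2 : f =ᵐ[μ] (T ∩ K).indicator f := by
    filter_upwards [hμ] with b hb
    by_cases hbK : b ∈ K
    · rw [indicator_of_mem (show b ∈ T ∩ K from ⟨hb, hbK⟩)]
    · rw [indicator_of_notMem (fun h => hbK h.2)]
      by_contra h
      exact hbK (hfK b hb h)
  exact ((integrable_indicator_iff (hT.measurableSet.inter hK.measurableSet)).mpr h1).congr h2.symm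

/-- Continuity of a parametrised integral. The measures `μ a` are carried by the slices of a closed
relation `D`, and the integrand is only assumed to be defined and continuous along `D`. -/
theorem continuous_integral_of_closed_relation [T2Space B] [LocallyCompactSpace B]
    {A P : Type*} [TopologicalSpace A] [TopologicalSpace P]
    {D : A → B → Prop} (hD : IsClosed {q : A × B | D q.1 q.2}) {μ : A → Measure B}
    (hfin : ∀ a, IsFiniteMeasureOnCompacts (μ a)) (hsupp : ∀ a, ∀ᵐ b ∂(μ a), D a b)
    (hcont : ∀ f : C_c(B, ℝ), Continuous fun a => ∫ b, f b ∂(μ a))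
    {u : P → A} (hu : Continuous u) {F : P → B → ℝ}
    (hF : ContinuousOn (fun q : P × B => F q.1 q.2) {q | D (u q.1) q.2})
    (hloc : ∀ p₀, ∃ K, IsCompact K ∧ ∀ᶠ p in 𝓝 p₀, ∀ b, D (u p) b → F p b ≠ 0 → b ∈ K) :
    Continuous fun p => ∫ b, F p b ∂(μ (u p)) := by
  have hDP : IsClosed {q : P × B | D (u q.1) q.2} :=
    hD.preimage ((hu.comp continuous_fst).prodMk continuous_snd)
  have hT : ∀ p, IsClosed {b | D (u p) b} := fun p =>
    hDP.preimage (continuous_const.prodMk continuous_id)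
  have hFp : ∀ p, ContinuousOn (F p) {b | D (u p) b} := fun p =>
    hF.comp (continuous_const.prodMk continuous_id).continuousOn (fun b hb => hb)
  rw [continuous_iff_continuousAt]
  intro p₀
  obtain ⟨K, hK, hKF⟩ := hloc p₀
  obtain ⟨f₀, hf₀⟩ := (hT p₀).exists_compactlySupported_eqOn (hFp p₀) hK hKF.self_of_nhds
  have hK' : IsCompact (K ∪ tsupport f₀) := hK.union f₀.hasCompactSupport
  obtain ⟨χ, hχ1, -, hχ0, hχle⟩ := hK'.exists_cutoff isOpen_univ (subset_univ _)
  have hχc : Continuous fun p => ∫ b, χ b ∂(μ (u p)) := (hcont χ).comp hu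
  have hfc : Continuous fun p => ∫ b, f₀ b ∂(μ (u p)) := (hcont f₀).comp hu
  set C : ℝ := ∫ b, χ b ∂(μ (u p₀)) + 1 with hCdef
  have hC : 0 < C := add_pos_of_nonneg_of_pos (integral_nonneg hχ0) one_pos
  have hCe : ∀ᶠ p in 𝓝 p₀, ∫ b, χ b ∂(μ (u p)) < C :=
    hχc.continuousAt.eventually (gt_mem_nhds (lt_add_one _))
  have hint0 : ∫ b, F p₀ b ∂(μ (u p₀)) = ∫ b, f₀ b ∂(μ (u p₀)) :=
    integral_congr_ae ((hsupp (u p₀)).mono fun b hb => (hf₀ hb).symm)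
  rw [Metric.continuousAt_iff']
  intro ε hε
  have hδ : 0 < ε / 2 / C := by positivity
  have hnear : ∀ᶠ p in 𝓝 p₀, ∀ b ∈ K ∪ tsupport f₀, D (u p) b → |F p b - f₀ b| < ε / 2 / C := by
    refine hK'.eventually_forall_of_forall_eventually fun b hb => ?_
    by_cases hDb : D (u p₀) b
    · have h1 : ContinuousWithinAt (fun q : P × B => |F q.1 q.2 - f₀ q.2|)
          {q | D (u q.1) q.2} (p₀, b) :=
        ((hF (p₀, b) hDb).sub (f₀.continuous.comp continuous_snd).continuousWithinAt).abs
      have h2 : |F p₀ b - f₀ b| < ε / 2 / C := by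
        rw [hf₀ hDb]; simpa using hδ
      have h3 := h1.eventually (gt_mem_nhds h2)
      rw [eventually_nhdsWithin_iff] at h3
      exact h3
    · filter_upwards [hDP.isOpen_compl.mem_nhds (show (p₀, b) ∈ _ from hDb)] with q hq hq'
      exact absurd hq' hq
  have hf₀e : ∀ᶠ p in 𝓝 p₀, |∫ b, f₀ b ∂(μ (u p)) - ∫ b, f₀ b ∂(μ (u p₀))| < ε / 2 :=
    (Metric.continuousAt_iff'.mp hfc.continuousAt (ε / 2) (half_pos hε))
  filter_upwards [hKF, hCe, hnear, hf₀e] with p h1 h2 h3 h4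
  have := hfin (u p)
  have hiF : Integrable (F p) (μ (u p)) := (hFp p).integrable_of_ae_mem (hT p) (hsupp _) hK h1
  have hif : Integrable f₀ (μ (u p)) :=
    f₀.continuous.integrable_of_hasCompactSupport f₀.hasCompactSupport
  have hiχ : Integrable χ (μ (u p)) :=
    χ.continuous.integrable_of_hasCompactSupport χ.hasCompactSupport
  have h5 : |∫ b, F p b ∂(μ (u p)) - ∫ b, f₀ b ∂(μ (u p))| ≤ ε / 2 / C * ∫ b, χ b ∂(μ (u p)) := by
    rw [← integral_sub hiF hif, ← integral_const_mul]
    refine (abs_integral_le_integral_abs).trans (integral_mono_ae (hiF.sub hif).abs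
      (hiχ.const_mul _) ?_)
    filter_upwards [hsupp (u p)] with b hb
    by_cases hbK : b ∈ K ∪ tsupport f₀
    · simpa [hχ1 b hbK] using (h3 b hbK hb).le
    · have e1 : F p b = 0 := by
        by_contra h
        exact hbK (Or.inl (h1 b hb h))
      have e2 : f₀ b = 0 := image_eq_zero_of_notMem_tsupport fun h => hbK (Or.inr h)
      simpa [e1, e2] using mul_nonneg hδ.le (hχ0 b)
  have h6 : ε / 2 / C * ∫ b, χ b ∂(μ (u p)) ≤ ε / 2 := by
    calc ε / 2 / C * ∫ b, χ b ∂(μ (u p)) ≤ ε / 2 / C * C := by gcongr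
      _ = ε / 2 := div_mul_cancel₀ _ hC.ne'
  rw [Real.dist_eq, hint0]
  calc |∫ b, F p b ∂(μ (u p)) - ∫ b, f₀ b ∂(μ (u p₀))|
      ≤ |∫ b, F p b ∂(μ (u p)) - ∫ b, f₀ b ∂(μ (u p))|
        + |∫ b, f₀ b ∂(μ (u p)) - ∫ b, f₀ b ∂(μ (u p₀))| := abs_sub_le _ _ _
    _ < ε := by linarith

/-- A linear functional on `C_c(B)` which is positive on a compact set `S` is integration against a
finite Radon measure carried by `S`. -/
theorem exists_regular_measure_of_functional [T2Space B] [LocallyCompactSpace B]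
    (Λ : C_c(B, ℝ) →ₗ[ℝ] ℝ) {S : Set B} (hS : IsCompact S)
    (hΛ : ∀ F : C_c(B, ℝ), (∀ b ∈ S, 0 ≤ F b) → 0 ≤ Λ F) :
    ∃ μ : Measure B, μ.Regular ∧ IsFiniteMeasure μ ∧ (∀ᵐ b ∂μ, b ∈ S) ∧
      ∀ F : C_c(B, ℝ), ∫ b, F b ∂μ = Λ F := by
  let Λ' : C_c(B, ℝ) →ₚ[ℝ] ℝ := PositiveLinearMap.mk₀ Λ fun F hF => hΛ F fun b _ => hF b
  have hint : ∀ F : C_c(B, ℝ), ∫ b, F b ∂(RealRMK.rieszMeasure Λ') = Λ F :=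
    RealRMK.integral_rieszMeasure Λ'
  set μ := RealRMK.rieszMeasure Λ' with hμ
  have hreg : μ.Regular := inferInstance
  have hμS : μ Sᶜ = 0 := by
    rw [hS.isClosed.isOpen_compl.measure_eq_iSup_isCompact]
    simp only [ENNReal.iSup_eq_zero]
    intro K hKS hK
    obtain ⟨χ, h1, h0, hnn, -⟩ := hK.exists_cutoff hS.isClosed.isOpen_compl hKS
    have hz : Λ χ = 0 := by
      have hχ0 : ∀ b ∈ S, χ b = 0 := fun b hb => h0 b (fun h => h hb)
      refine le_antisymm ?_ (hΛ χ fun b _ => hnn b)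
      have := hΛ (-χ) fun b hb => by simp [hχ0 b hb]
      rwa [map_neg, Left.nonneg_neg_iff] at this
    have h2 := RealRMK.rieszMeasure_le_of_eq_one Λ' hnn hK h1
    rw [show Λ' χ = Λ χ from rfl, hz, ENNReal.ofReal_zero] at h2
    exact le_antisymm h2 zero_le
  refine ⟨μ, hreg, ⟨?_⟩, hμS, hint⟩
  calc μ univ ≤ μ S + μ Sᶜ := by
        rw [← union_compl_self S]; exact measure_union_le _ _
    _ < ⊤ := by rw [hμS, add_zero]; exact hS.measure_lt_top

end Integrals

/-! ### The total variation distance -/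

section TotalVariation

variable {α : Type u} [MeasurableSpace α] (μ ν : Measure α) [IsFiniteMeasure μ] [IsFiniteMeasure ν]

theorem l1Dist_nonneg : 0 ≤ l1Dist μ ν := ENNReal.toReal_nonneg

theorem l1Dist_le_of_forall_measurableSet {ε : ℝ}
    (h : ∀ i, MeasurableSet i → |μ.real i - ν.real i| ≤ ε) : l1Dist μ ν ≤ 2 * ε := by
  set s := μ.toSignedMeasure - ν.toSignedMeasure with hs
  obtain ⟨i, hi, _, _, hpos, hneg⟩ := s.toJordanDecomposition_spec
  have hsi : ∀ j, MeasurableSet j → s j = μ.real j - ν.real j := fun j hj => by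
    rw [hs, _root_.sub_apply, Measure.toSignedMeasure_apply_measurable hj,
      Measure.toSignedMeasure_apply_measurable hj]
  have e1 : s.toJordanDecomposition.posPart.real univ = s i := by
    rw [measureReal_def, hpos, SignedMeasure.toMeasureOfZeroLE_apply _ _ hi MeasurableSet.univ]
    simp
  have e2 : s.toJordanDecomposition.negPart.real univ = - s iᶜ := by
    rw [measureReal_def, hneg,
      SignedMeasure.toMeasureOfLEZero_apply _ _ hi.compl MeasurableSet.univ]
    simp
  have e3 : l1Dist μ ν = s i - s iᶜ := by
    rw [l1Dist, ← hs, SignedMeasure.totalVariation, Measure.add_apply,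
      ENNReal.toReal_add (measure_ne_top _ _) (measure_ne_top _ _), ← measureReal_def,
      ← measureReal_def, e1, e2, sub_eq_add_neg]
  rw [e3, hsi i hi, hsi _ hi.compl]
  have a1 := abs_le.mp (h i hi)
  have a2 := abs_le.mp (h _ hi.compl)
  linarith [a1.2, a2.1]

theorem abs_integral_sub_integral_le_l1Dist {f : α → ℝ} (hf : StronglyMeasurable f) {c : ℝ}
    (hc : ∀ x, |f x| ≤ c) : |∫ x, f x ∂μ - ∫ x, f x ∂ν| ≤ c * l1Dist μ ν := by
  set s := μ.toSignedMeasure - ν.toSignedMeasure with hs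
  set P := s.toJordanDecomposition.posPart
  set N := s.toJordanDecomposition.negPart
  have hPN : P.toSignedMeasure - N.toSignedMeasure = s := s.toSignedMeasure_toJordanDecomposition
  have key : μ + N = ν + P := by
    rw [← Measure.toSignedMeasure_eq_toSignedMeasure_iff]
    rw [Measure.toSignedMeasure_add, Measure.toSignedMeasure_add]
    rw [← sub_eq_sub_iff_add_eq_add.mp (hPN.trans hs), add_comm]
  have hi : ∀ (κ : Measure α) [IsFiniteMeasure κ], Integrable f κ := fun κ _ =>
    Integrable.of_bound hf.aestronglyMeasurable c (ae_of_all _ fun x => hc x)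
  have h1 : ∫ x, f x ∂μ + ∫ x, f x ∂N = ∫ x, f x ∂ν + ∫ x, f x ∂P := by
    rw [← integral_add_measure (hi μ) (hi N), ← integral_add_measure (hi ν) (hi P), key]
  have hb : ∀ (κ : Measure α) [IsFiniteMeasure κ], |∫ x, f x ∂κ| ≤ c * κ.real univ := by
    intro κ _
    have := norm_integral_le_of_norm_le_const (μ := κ) (f := f) (ae_of_all _ hc)
    rwa [Real.norm_eq_abs] at this
  have e3 : l1Dist μ ν = P.real univ + N.real univ := by
    rw [l1Dist, ← hs, SignedMeasure.totalVariation, Measure.add_apply,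
      ENNReal.toReal_add (measure_ne_top _ _) (measure_ne_top _ _)]
    rfl
  rw [e3, mul_add, show ∫ x, f x ∂μ - ∫ x, f x ∂ν = ∫ x, f x ∂P - ∫ x, f x ∂N by linarith]
  exact (abs_sub _ _).trans (add_le_add (hb P) (hb N))

/-- For Radon measures the total variation distance can be tested on `C_c`. -/
theorem l1Dist_le_of_forall_compactlySupported [TopologicalSpace α] [BorelSpace α] [T2Space α]
    [LocallyCompactSpace α] [μ.Regular] [ν.Regular] {ε : ℝ}
    (h : ∀ f : C_c(α, ℝ), (∀ x, 0 ≤ f x) → (∀ x, f x ≤ 1) →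
      |∫ x, f x ∂μ - ∫ x, f x ∂ν| ≤ ε) : l1Dist μ ν ≤ 2 * ε := by
  refine l1Dist_le_of_forall_measurableSet μ ν fun i hi => ?_
  refine le_of_forall_pos_le_add fun δ hδ => ?_
  have hδ' : ENNReal.ofReal (δ / 2) ≠ 0 := by simpa using hδ
  obtain ⟨K₁, hK₁i, hK₁, h₁⟩ := hi.exists_isCompact_sdiff_lt (measure_ne_top μ i) hδ'
  obtain ⟨K₂, hK₂i, hK₂, h₂⟩ := hi.exists_isCompact_sdiff_lt (measure_ne_top ν i) hδ'
  obtain ⟨U₁, hU₁i, hU₁, -, g₁⟩ := hi.exists_isOpen_sdiff_lt (measure_ne_top μ i) hδ'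
  obtain ⟨U₂, hU₂i, hU₂, -, g₂⟩ := hi.exists_isOpen_sdiff_lt (measure_ne_top ν i) hδ'
  obtain ⟨χ, c1, c0, cnn, cle⟩ := (hK₁.union hK₂).exists_cutoff (hU₁.inter hU₂)
    (union_subset (hK₁i.trans (subset_inter hU₁i hU₂i)) (hK₂i.trans (subset_inter hU₁i hU₂i)))
  have main : ∀ (κ : Measure α) [IsFiniteMeasure κ] (K U : Set α), K ⊆ K₁ ∪ K₂ → U₁ ∩ U₂ ⊆ U →
      IsCompact K → IsOpen U → K ⊆ i → i ⊆ U → κ (i \ K) < ENNReal.ofReal (δ / 2) →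
      κ (U \ i) < ENNReal.ofReal (δ / 2) → |κ.real i - ∫ x, χ x ∂κ| ≤ δ / 2 := by
    intro κ _ K U hK hU hKc hUo hKi hiU h1 h2
    have hχi : Integrable χ κ :=
      χ.continuous.integrable_of_hasCompactSupport χ.hasCompactSupport
    have a1 : κ.real K ≤ ∫ x, χ x ∂κ := by
      rw [← integral_indicator_one hKc.measurableSet]
      refine integral_mono ((integrable_const 1).indicator hKc.measurableSet) hχi fun x => ?_
      by_cases hx : x ∈ K
      · simp [hx, c1 x (hK hx)]
      · simpa [hx] using cnn x
    have a2 : ∫ x, χ x ∂κ ≤ κ.real U := by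
      rw [← integral_indicator_one hUo.measurableSet]
      refine integral_mono hχi ((integrable_const 1).indicator hUo.measurableSet) fun x => ?_
      by_cases hx : x ∈ U
      · simpa [hx] using cle x
      · simp [hx, c0 x (fun h => hx (hU h))]
    have b1 : κ.real i ≤ κ.real K + δ / 2 := by
      have : κ.real (i \ K) ≤ δ / 2 := ENNReal.toReal_le_of_le_ofReal (half_pos hδ).le h1.le
      rw [measureReal_sdiff hKi hKc.measurableSet] at this
      linarith
    have b2 : κ.real U ≤ κ.real i + δ / 2 := by
      have : κ.real (U \ i) ≤ δ / 2 := ENNReal.toReal_le_of_le_ofReal (half_pos hδ).le h2.le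
      rw [measureReal_sdiff hiU hi] at this
      linarith
    rw [abs_le]
    constructor <;> linarith
  have m1 := main μ K₁ U₁ subset_union_left inter_subset_left hK₁ hU₁ hK₁i hU₁i h₁ g₁
  have m2 := main ν K₂ U₂ subset_union_right inter_subset_right hK₂ hU₂ hK₂i hU₂i h₂ g₂
  have m3 := h χ cnn cle
  rw [abs_le] at *
  constructor <;> linarith [m1.1, m1.2, m2.1, m2.2, m3.1, m3.2]

end TotalVariation

/-! ### Groupoids and actions with total operations -/

namespace LCGroupoid

instance (G : LCGroupoid.{u}) : T2Space G.Obj := G.t2Obj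

instance (G : LCGroupoid.{u}) : LocallyCompactSpace G.Obj :=
  (IsClosedEmbedding.of_continuous_injective_isClosedMap G.continuous_e
    (Function.LeftInverse.injective G.r_e)
    (Function.LeftInverse.isClosedEmbedding G.r_e G.continuous_r G.continuous_e).isClosedMap
    ).locallyCompactSpace

variable {G H : LCGroupoid.{u}}

theorem inv_inv (g : G.Arrow) : G.inv (G.inv g) = g :=
  (G.inv_unique (G.s_inv g) ((G.inv_mul g).trans (congrArg G.e (G.r_inv g).symm))).symm

open Classical in
/-- The product of two arrows, with the junk value `g` when they are not composable. -/
noncomputable def mulT (G : LCGroupoid.{u}) (g h : G.Arrow) : G.Arrow :=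
  if w : G.s g = G.r h then G.mul g h w else g

theorem mulT_eq {g h : G.Arrow} (w : G.s g = G.r h) : G.mulT g h = G.mul g h w := dif_pos w

theorem r_mulT {g h : G.Arrow} (w : G.s g = G.r h) : G.r (G.mulT g h) = G.r g := by
  rw [mulT_eq w, G.r_mul]

theorem s_mulT {g h : G.Arrow} (w : G.s g = G.r h) : G.s (G.mulT g h) = G.s h := by
  rw [mulT_eq w, G.s_mul]

theorem mulT_assoc {g h k : G.Arrow} (w : G.s g = G.r h) (w' : G.s h = G.r k) :
    G.mulT (G.mulT g h) k = G.mulT g (G.mulT h k) := by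
  rw [mulT_eq ((s_mulT w).trans w'), mulT_eq (w.trans (r_mulT w').symm)]
  exact (G.mul_congr (mulT_eq w) rfl _ ((G.s_mul _ _ w).trans w')).trans
    ((G.mul_assoc g h k w w').trans (G.mul_congr rfl (mulT_eq w').symm _ _))

theorem mulT_inv_cancel_left {g h : G.Arrow} (w : G.s g = G.r h) :
    G.mulT (G.inv g) (G.mulT g h) = h := by
  have w1 : G.s (G.inv g) = G.r g := G.s_inv g
  rw [← mulT_assoc w1 w, mulT_eq w1, mulT_eq ((G.s_mul _ _ w1).trans w)]
  exact (G.mul_congr ((G.inv_mul g).trans (congrArg G.e w)) rfl _ (G.s_e _)).trans (G.e_mul h)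

theorem mulT_cancel_left_inv {g h : G.Arrow} (w : G.r g = G.r h) :
    G.mulT g (G.mulT (G.inv g) h) = h := by
  have := mulT_inv_cancel_left (g := G.inv g) (h := h) ((G.s_inv g).trans w)
  rwa [inv_inv] at this

theorem continuousOn_mulT :
    ContinuousOn (fun q : G.Arrow × G.Arrow => G.mulT q.1 q.2) {q | G.s q.1 = G.r q.2} := by
  rw [continuousOn_iff_continuous_domRestrict]
  exact G.continuous_mul.congr fun q => (mulT_eq q.2).symm

namespace LeftAction

variable {Y : Type u} [TopologicalSpace Y]

open Classical in
/-- The total extension of the action, with the junk value `g y = y` when `s g ≠ p y`. -/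
noncomputable def actT (a : G.LeftAction Y) (g : G.Arrow) (y : Y) : Y :=
  if w : G.s g = a.p y then a.act g y w else y

variable (a : G.LeftAction Y)

theorem actT_eq {g : G.Arrow} {y : Y} (w : G.s g = a.p y) : a.actT g y = a.act g y w := dif_pos w

theorem p_actT {g : G.Arrow} {y : Y} (w : G.s g = a.p y) : a.p (a.actT g y) = G.r g := by
  rw [a.actT_eq w, a.p_act]

theorem e_actT (y : Y) : a.actT (G.e (a.p y)) y = y := by
  rw [a.actT_eq (G.s_e _), a.e_act]

theorem mul_actT {g₂ g₁ : G.Arrow} {y : Y} (w : G.s g₁ = a.p y) (w' : G.s g₂ = G.r g₁) :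
    a.actT (G.mulT g₂ g₁) y = a.actT g₂ (a.actT g₁ y) := by
  rw [a.actT_eq ((s_mulT w').trans w), a.actT_eq (w'.trans (a.p_actT w).symm)]
  exact (a.act_congr (mulT_eq w') rfl _ ((G.s_mul _ _ _).trans w)).trans
    ((a.mul_act g₂ g₁ y w w').trans (a.act_congr rfl (a.actT_eq w).symm _ _))

theorem inv_actT_actT {g : G.Arrow} {y : Y} (w : G.s g = a.p y) :
    a.actT (G.inv g) (a.actT g y) = y := by
  have w1 : G.s (G.inv g) = G.r g := G.s_inv g
  rw [← a.mul_actT w w1, mulT_eq w1]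
  have : G.mul (G.inv g) g w1 = G.e (a.p y) := (G.inv_mul g).trans (congrArg G.e w)
  rw [this, e_actT]

theorem actT_inv_actT {g : G.Arrow} {y : Y} (w : G.r g = a.p y) :
    a.actT g (a.actT (G.inv g) y) = y := by
  have := a.inv_actT_actT (g := G.inv g) (y := y) ((G.s_inv g).trans w)
  rwa [inv_inv] at this

theorem continuousOn_actT :
    ContinuousOn (fun q : G.Arrow × Y => a.actT q.1 q.2) {q | G.s q.1 = a.p q.2} := by
  rw [continuousOn_iff_continuous_domRestrict]
  exact a.continuous_act.congr fun q => (a.actT_eq q.2).symm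

/-- Build an action from total operations which behave well where the action is defined. -/
noncomputable def ofTotal (p : Y → G.Obj) (hp : Continuous p) (hs : Function.Surjective p)
    (act : G.Arrow → Y → Y) (p_act : ∀ g y, G.s g = p y → p (act g y) = G.r g)
    (e_act : ∀ y, act (G.e (p y)) y = y)
    (mul_act : ∀ g₂ g₁ y, G.s g₁ = p y → G.s g₂ = G.r g₁ →
      act (G.mulT g₂ g₁) y = act g₂ (act g₁ y))
    (cont : ContinuousOn (fun q : G.Arrow × Y => act q.1 q.2) {q | G.s q.1 = p q.2}) :
    G.LeftAction Y where
  p := p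
  continuous_p := hp
  surjective_p := hs
  act g y _ := act g y
  p_act := p_act
  e_act := e_act
  mul_act g₂ g₁ y w w' := by rw [← mulT_eq w', mul_act g₂ g₁ y w w']
  continuous_act := continuousOn_iff_continuous_domRestrict.mp cont

theorem isClosed_composable : IsClosed {q : G.Arrow × Y | G.s q.1 = a.p q.2} :=
  isClosed_eq (G.continuous_s.comp continuous_fst) (a.continuous_p.comp continuous_snd)

theorem isCompact_image_actT {N : Set G.Arrow} (hN : IsCompact N) {S : Set Y} (hS : IsCompact S) :
    IsCompact {y | ∃ g ∈ N, ∃ z ∈ S, G.s g = a.p z ∧ a.actT g z = y} := by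
  have h := ((hN.prod hS).inter_left a.isClosed_composable).image_of_continuousOn
    (a.continuousOn_actT.mono inter_subset_left)
  convert h using 1
  ext y
  constructor
  · rintro ⟨g, hg, z, hz, w, rfl⟩
    exact ⟨(g, z), ⟨w, hg, hz⟩, rfl⟩
  · rintro ⟨⟨g, z⟩, ⟨w, hg, hz⟩, rfl⟩
    exact ⟨g, hg, z, hz, w, rfl⟩

end LeftAction

/-! ### Commuting principal actions -/

/-- Two commuting left actions of `G` and `H` on a space `Z`, with open momentum maps, such that
each action is free and its orbits are the fibres of the momentum map of the other one, with a
continuous division map. This is a `G`-`H`-equivalence in which the right action of `H` has been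
turned into a left action; the notion is symmetric in `G` and `H`.

The division maps `da` and `db` are total, but only meaningful on pairs in the same orbit. -/
structure Bispace (G H : LCGroupoid.{u}) (Z : Type u) [TopologicalSpace Z] where
  a : G.LeftAction Z
  b : H.LeftAction Z
  isOpenMap_a : IsOpenMap a.p
  isOpenMap_b : IsOpenMap b.p
  b_p_act : ∀ g z, G.s g = a.p z → b.p (a.actT g z) = b.p z
  a_p_act : ∀ h z, H.s h = b.p z → a.p (b.actT h z) = a.p z
  comm : ∀ g h z, G.s g = a.p z → H.s h = b.p z →
    a.actT g (b.actT h z) = b.actT h (a.actT g z)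
  da : Z → Z → G.Arrow
  s_da : ∀ z z', b.p z = b.p z' → G.s (da z z') = a.p z'
  da_act : ∀ z z', b.p z = b.p z' → a.actT (da z z') z' = z
  a_inj : ∀ g g' z, G.s g = a.p z → G.s g' = a.p z → a.actT g z = a.actT g' z → g = g'
  continuousOn_da : ContinuousOn (fun q : Z × Z => da q.1 q.2) {q | b.p q.1 = b.p q.2}
  db : Z → Z → H.Arrow
  s_db : ∀ z z', a.p z = a.p z' → H.s (db z z') = b.p z'
  db_act : ∀ z z', a.p z = a.p z' → b.actT (db z z') z' = z
  b_inj : ∀ h h' z, H.s h = b.p z → H.s h' = b.p z → b.actT h z = b.actT h' z → h = h'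
  continuousOn_db : ContinuousOn (fun q : Z × Z => db q.1 q.2) {q | a.p q.1 = a.p q.2}

namespace Bispace

variable {Z : Type u} [TopologicalSpace Z]

/-- Exchange the roles of the two groupoids. -/
def swap (E : Bispace G H Z) : Bispace H G Z where
  a := E.b
  b := E.a
  isOpenMap_a := E.isOpenMap_b
  isOpenMap_b := E.isOpenMap_a
  b_p_act := E.a_p_act
  a_p_act := E.b_p_act
  comm h g z wh wg := (E.comm g h z wg wh).symm
  da := E.db
  s_da := E.s_db
  da_act := E.db_act
  a_inj := E.b_inj
  continuousOn_da := E.continuousOn_db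
  db := E.da
  s_db := E.s_da
  db_act := E.da_act
  b_inj := E.a_inj
  continuousOn_db := E.continuousOn_da

variable (E : Bispace G H Z)

theorem r_da {z z' : Z} (w : E.b.p z = E.b.p z') : G.r (E.da z z') = E.a.p z := by
  rw [← E.a.p_actT (E.s_da z z' w), E.da_act z z' w]

theorem r_db {z z' : Z} (w : E.a.p z = E.a.p z') : H.r (E.db z z') = E.b.p z :=
  E.swap.r_da w

theorem da_eq {g : G.Arrow} {z z' : Z} (w : G.s g = E.a.p z') (h : E.a.actT g z' = z) :
    E.da z z' = g := by
  have w' : E.b.p z = E.b.p z' := by rw [← h, E.b_p_act g z' w]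
  exact E.a_inj _ _ z' (E.s_da z z' w') w ((E.da_act z z' w').trans h.symm)

theorem db_eq {h : H.Arrow} {z z' : Z} (w : H.s h = E.b.p z') (e : E.b.actT h z' = z) :
    E.db z z' = h :=
  E.swap.da_eq w e

theorem db_self (z : Z) : E.db z z = H.e (E.b.p z) :=
  E.db_eq (H.s_e _) (E.b.e_actT z)

theorem da_act_left {g : G.Arrow} {z z' : Z} (w : E.b.p z = E.b.p z') (hg : G.s g = E.a.p z) :
    E.da (E.a.actT g z) z' = G.mulT g (E.da z z') := by
  have w1 : G.s g = G.r (E.da z z') := hg.trans (E.r_da w).symm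
  refine E.da_eq ((s_mulT w1).trans (E.s_da z z' w)) ?_
  rw [E.a.mul_actT (E.s_da z z' w) w1, E.da_act z z' w]

theorem db_act_act {g : G.Arrow} {z z' : Z} (w : E.a.p z = E.a.p z') (hg : G.s g = E.a.p z) :
    E.db (E.a.actT g z) (E.a.actT g z') = E.db z z' := by
  have hg' := hg.trans w
  refine E.db_eq ((E.s_db z z' w).trans (E.b_p_act g z' hg').symm) ?_
  rw [← E.comm g _ z' hg' (E.s_db z z' w), E.db_act z z' w]

/-! ### The fibre product of the bispace with an `H`-space -/

variable {Y : Type u} [TopologicalSpace Y]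

/-- The fibre product `Z *_{H⁽⁰⁾} Y`. -/
def Pull (c : H.LeftAction Y) : Type u := {q : Z × Y // E.b.p q.1 = c.p q.2}

variable (c : H.LeftAction Y)

instance : TopologicalSpace (E.Pull c) :=
  inferInstanceAs (TopologicalSpace {q : Z × Y // E.b.p q.1 = c.p q.2})

instance [T2Space Z] [T2Space Y] : T2Space (E.Pull c) :=
  inferInstanceAs (T2Space {q : Z × Y // E.b.p q.1 = c.p q.2})

theorem isClosed_pull : IsClosed {q : Z × Y | E.b.p q.1 = c.p q.2} :=
  isClosed_eq (E.b.continuous_p.comp continuous_fst) (c.continuous_p.comp continuous_snd)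

instance [LocallyCompactSpace Z] [LocallyCompactSpace Y] : LocallyCompactSpace (E.Pull c) :=
  (E.isClosed_pull c).isClosedEmbedding_subtypeVal.locallyCompactSpace

instance : MeasurableSpace (E.Pull c) := borel _

instance : BorelSpace (E.Pull c) := ⟨rfl⟩

namespace Pull

variable {E c}

/-- The first component of a point of the fibre product. -/
def z (w : E.Pull c) : Z := w.1.1

/-- The second component of a point of the fibre product. -/
def y (w : E.Pull c) : Y := w.1.2

/-- A point of the fibre product, from its components. -/
def mk (z : Z) (y : Y) (h : E.b.p z = c.p y) : E.Pull c := ⟨(z, y), h⟩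

@[simp] theorem y_mk {z : Z} {y : Y} (h : E.b.p z = c.p y) : (mk z y h).y = y := rfl

theorem p_eq (w : E.Pull c) : E.b.p w.z = c.p w.y := w.2

@[ext] theorem ext {w w' : E.Pull c} (h : w.z = w'.z) (h' : w.y = w'.y) : w = w' :=
  Subtype.ext (Prod.ext h h')

theorem continuous_z : Continuous (z : E.Pull c → Z) :=
  continuous_fst.comp continuous_subtype_val

theorem continuous_y : Continuous (y : E.Pull c → Y) :=
  continuous_snd.comp continuous_subtype_val

theorem continuousOn_mk {T : Type*} [TopologicalSpace T] {s : Set T} {f : T → E.Pull c}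
    (hz : ContinuousOn (fun t => (f t).z) s) (hy : ContinuousOn (fun t => (f t).y) s) :
    ContinuousOn f s :=
  (IsInducing.subtypeVal.continuousOn_iff).mpr (hz.prodMk hy)

end Pull

open Classical in
/-- `G` acts on the fibre product through the first component. -/
noncomputable def pullG : G.LeftAction (E.Pull c) :=
  LeftAction.ofTotal (fun w => E.a.p w.z) (E.a.continuous_p.comp Pull.continuous_z)
    (fun x => by
      obtain ⟨z, hz⟩ := E.a.surjective_p x
      obtain ⟨y, hy⟩ := c.surjective_p (E.b.p z)
      exact ⟨Pull.mk z y hy.symm, hz⟩)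
    (fun g w => if h : G.s g = E.a.p w.z then
      Pull.mk (E.a.actT g w.z) w.y ((E.b_p_act g _ h).trans w.p_eq) else w)
    (fun g w h => by rw [dif_pos h]; exact E.a.p_actT h)
    (fun w => by
      rw [dif_pos (G.s_e _)]
      exact Pull.ext (E.a.e_actT _) rfl)
    (fun g₂ g₁ w h h' => by
      rw [dif_pos ((s_mulT h').trans h), dif_pos h]
      refine Eq.trans ?_ (dif_pos (h'.trans (E.a.p_actT h).symm)).symm
      exact Pull.ext (E.a.mul_actT h h') rfl)
    (by
      refine Pull.continuousOn_mk ?_ ?_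
      · refine (E.a.continuousOn_actT.comp (f := fun q : G.Arrow × E.Pull c => (q.1, q.2.z))
          (continuous_fst.prodMk (Pull.continuous_z.comp continuous_snd)).continuousOn
          (fun q hq => hq)).congr ?_
        intro q hq
        beta_reduce
        rw [dif_pos (show G.s q.1 = E.a.p q.2.z from hq)]
        rfl
      · refine (Pull.continuous_y.comp continuous_snd).continuousOn.congr ?_
        intro q hq
        beta_reduce
        rw [dif_pos (show G.s q.1 = E.a.p q.2.z from hq)]
        rfl)

open Classical in
/-- `H` acts diagonally on the fibre product. -/
noncomputable def pullH : H.LeftAction (E.Pull c) :=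
  LeftAction.ofTotal (fun w => c.p w.y) (c.continuous_p.comp Pull.continuous_y)
    (fun x => by
      obtain ⟨z, hz⟩ := E.b.surjective_p x
      obtain ⟨y, hy⟩ := c.surjective_p x
      exact ⟨Pull.mk z y (hz.trans hy.symm), hy⟩)
    (fun g w => if h : H.s g = c.p w.y then
      Pull.mk (E.b.actT g w.z) (c.actT g w.y)
        ((E.b.p_actT (h.trans w.p_eq.symm)).trans (c.p_actT h).symm) else w)
    (fun g w h => by rw [dif_pos h]; exact c.p_actT h)
    (fun w => by
      rw [dif_pos (H.s_e _)]
      exact Pull.ext ((congrArg (fun v => E.b.actT (H.e v) w.z) w.p_eq.symm).trans (E.b.e_actT _))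
        (c.e_actT _))
    (fun g₂ g₁ w h h' => by
      rw [dif_pos ((s_mulT h').trans h), dif_pos h]
      refine Eq.trans ?_ (dif_pos (h'.trans (c.p_actT h).symm)).symm
      exact Pull.ext (E.b.mul_actT (h.trans w.p_eq.symm) h') (c.mul_actT h h'))
    (by
      refine Pull.continuousOn_mk ?_ ?_
      · refine (E.b.continuousOn_actT.comp (f := fun q : H.Arrow × E.Pull c => (q.1, q.2.z))
          (continuous_fst.prodMk (Pull.continuous_z.comp continuous_snd)).continuousOn
          (fun q hq => Eq.trans hq q.2.p_eq.symm)).congr ?_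
        intro q hq
        beta_reduce
        rw [dif_pos (show H.s q.1 = c.p q.2.y from hq)]
        rfl
      · refine (c.continuousOn_actT.comp (f := fun q : H.Arrow × E.Pull c => (q.1, q.2.y))
          (continuous_fst.prodMk (Pull.continuous_y.comp continuous_snd)).continuousOn
          (fun q hq => hq)).congr ?_
        intro q hq
        beta_reduce
        rw [dif_pos (show H.s q.1 = c.p q.2.y from hq)]
        rfl)

variable {E c}

theorem pullG_actT {g : G.Arrow} {w : E.Pull c} (h : G.s g = E.a.p w.z) :
    (E.pullG c).actT g w = Pull.mk (E.a.actT g w.z) w.y ((E.b_p_act g _ h).trans w.p_eq) :=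
  ((E.pullG c).actT_eq h).trans (dif_pos h)

theorem pullG_z {g : G.Arrow} {w : E.Pull c} (h : G.s g = E.a.p w.z) :
    ((E.pullG c).actT g w).z = E.a.actT g w.z :=
  congrArg Pull.z (pullG_actT h)

theorem pullG_y {g : G.Arrow} {w : E.Pull c} (h : G.s g = E.a.p w.z) :
    ((E.pullG c).actT g w).y = w.y := by
  rw [pullG_actT h, Pull.y_mk]

theorem pullH_z {h : H.Arrow} {w : E.Pull c} (e : H.s h = c.p w.y) :
    ((E.pullH c).actT h w).z = E.b.actT h w.z :=
  congrArg Pull.z (((E.pullH c).actT_eq e).trans (dif_pos e))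

theorem pullH_y {h : H.Arrow} {w : E.Pull c} (e : H.s h = c.p w.y) :
    ((E.pullH c).actT h w).y = c.actT h w.y :=
  congrArg Pull.y (((E.pullH c).actT_eq e).trans (dif_pos e))

variable (E c)

/-- Two points of the fibre product are in the same `H`-orbit. -/
def Orb (w w' : E.Pull c) : Prop :=
  E.a.p w.z = E.a.p w'.z ∧ (E.pullH c).actT (E.db w.z w'.z) w' = w

variable {E c}

theorem orb_of_act {h : H.Arrow} {w : E.Pull c} (e : H.s h = c.p w.y) :
    E.Orb c ((E.pullH c).actT h w) w := by
  have e' := e.trans w.p_eq.symm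
  refine ⟨by rw [pullH_z e, E.a_p_act h _ e'], ?_⟩
  rw [pullH_z e, E.db_eq e' rfl]

theorem Orb.s_db {w w' : E.Pull c} (h : E.Orb c w w') : H.s (E.db w.z w'.z) = c.p w'.y :=
  (E.s_db _ _ h.1).trans w'.p_eq

theorem Orb.refl (w : E.Pull c) : E.Orb c w w := by
  refine ⟨rfl, ?_⟩
  rw [E.db_self, w.p_eq]
  exact (E.pullH c).e_actT w

theorem Orb.symm {w w' : E.Pull c} (h : E.Orb c w w') : E.Orb c w' w := by
  have h1 := orb_of_act (w := w) (h := H.inv (E.db w.z w'.z))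
    ((H.s_inv _).trans ((E.r_db h.1).trans w.p_eq))
  have e : (E.pullH c).actT (H.inv (E.db w.z w'.z)) w = w' := by
    conv_lhs => rw [← congrArg ((E.pullH c).actT (H.inv (E.db w.z w'.z))) h.2]
    exact (E.pullH c).inv_actT_actT h.s_db
  rwa [e] at h1

theorem Orb.trans {w₁ w₂ w₃ : E.Pull c} (h : E.Orb c w₁ w₂) (h' : E.Orb c w₂ w₃) :
    E.Orb c w₁ w₃ := by
  have e : H.s (E.db w₁.z w₂.z) = H.r (E.db w₂.z w₃.z) :=
    (E.s_db _ _ h.1).trans (E.r_db h'.1).symm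
  have h1 := orb_of_act (w := w₃) (h := H.mulT (E.db w₁.z w₂.z) (E.db w₂.z w₃.z))
    ((s_mulT e).trans h'.s_db)
  rwa [(E.pullH c).mul_actT h'.s_db e, h'.2, h.2] at h1

/-- The orbit relation is invariant under the action of `G`. -/
theorem Orb.act {w w' : E.Pull c} (h : E.Orb c w w') {g : G.Arrow} (hg : G.s g = E.a.p w.z) :
    E.Orb c ((E.pullG c).actT g w) ((E.pullG c).actT g w') := by
  have hg' := hg.trans h.1
  have e : H.s (E.db w.z w'.z) = c.p ((E.pullG c).actT g w').y := by
    rw [pullG_y hg', h.s_db]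
  have h1 := orb_of_act e
  convert h1 using 1
  ext
  · rw [pullG_z hg, pullH_z e, pullG_z hg', ← E.comm g _ _ hg' (E.s_db _ _ h.1), E.db_act _ _ h.1]
  · rw [pullG_y hg, pullH_y e, pullG_y hg', ← pullH_y h.s_db, h.2]

theorem isClosed_orb [T2Space Z] [T2Space Y] :
    IsClosed {q : E.Pull c × E.Pull c | E.Orb c q.1 q.2} := by
  have h1 : IsClosed {q : E.Pull c × E.Pull c | E.a.p q.1.z = E.a.p q.2.z} :=
    isClosed_eq (E.a.continuous_p.comp (Pull.continuous_z.comp continuous_fst))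
      (E.a.continuous_p.comp (Pull.continuous_z.comp continuous_snd))
  have h2 : ContinuousOn (fun q : E.Pull c × E.Pull c =>
      ((E.pullH c).actT (E.db q.1.z q.2.z) q.2, q.1))
      {q : E.Pull c × E.Pull c | E.a.p q.1.z = E.a.p q.2.z} := by
    refine ContinuousOn.prodMk ?_ continuous_fst.continuousOn
    refine (E.pullH c).continuousOn_actT.comp
      (f := fun q : E.Pull c × E.Pull c => (E.db q.1.z q.2.z, q.2)) ?_ ?_
    · refine ContinuousOn.prodMk ?_ continuous_snd.continuousOn
      exact E.continuousOn_db.comp (f := fun q : E.Pull c × E.Pull c => (q.1.z, q.2.z))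
        ((Pull.continuous_z.comp continuous_fst).prodMk
          (Pull.continuous_z.comp continuous_snd)).continuousOn (fun q hq => hq)
    · intro q hq
      exact (E.s_db _ _ hq).trans q.2.p_eq
  have := h2.preimage_isClosed_of_isClosed h1 isClosed_diagonal
  exact this

end Bispace

/-! ### From an equivalence to a bispace -/

namespace RightAction

variable {Y : Type u} [TopologicalSpace Y]

theorem act_congr (a : G.RightAction Y) {g g' : G.Arrow} {y y' : Y} (hy : y = y') (hg : g = g')
    (w : a.p y = G.r g) (w' : a.p y' = G.r g') : a.act y g w = a.act y' g' w' := by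
  subst hg; subst hy; rfl

/-- The left action `g y = y g⁻¹` attached to a right action. -/
def toLeft (a : G.RightAction Y) : G.LeftAction Y where
  p := a.p
  continuous_p := a.continuous_p
  surjective_p := a.surjective_p
  act g y w := a.act y (G.inv g) (w.symm.trans (G.r_inv g).symm)
  p_act g y w := (a.p_act _ _ _).trans (G.s_inv g)
  e_act y := (a.act_congr rfl (G.inv_e _) _ (G.r_e _).symm).trans (a.act_e y)
  mul_act g₂ g₁ y w w' := by
    have w1 : G.s (G.inv g₁) = G.r (G.inv g₂) :=
      (G.s_inv g₁).trans (w'.symm.trans (G.r_inv g₂).symm)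
    have w2 : a.p y = G.r (G.inv g₁) := w.symm.trans (G.r_inv g₁).symm
    exact (a.act_congr rfl (G.inv_mul_rev _ _ w') _ (w2.trans (G.r_mul _ _ w1).symm)).trans
      (a.act_mul y _ _ w2 w1)
  continuous_act := a.continuous_act.comp
    (f := fun q : {q : G.Arrow × Y // G.s q.1 = a.p q.2} =>
      (⟨(q.1.2, G.inv q.1.1), q.2.symm.trans (G.r_inv _).symm⟩ :
        {q : Y × G.Arrow // a.p q.1 = G.r q.2}))
    (Continuous.subtype_mk ((continuous_snd.comp continuous_subtype_val).prodMk
      (G.continuous_inv.comp (continuous_fst.comp continuous_subtype_val))) _)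

end RightAction

namespace LeftAction

variable {Y : Type u} [TopologicalSpace Y] (a : G.LeftAction Y)

theorem rel_iff {y y' : Y} : a.Rel y y' ↔ ∃ g, G.s g = a.p y ∧ y' = a.actT g y := by
  constructor
  · rintro ⟨g, w, h⟩; exact ⟨g, w, by rw [h, a.actT_eq w]⟩
  · rintro ⟨g, w, h⟩; exact ⟨g, w, by rw [h, a.actT_eq w]⟩

theorem rel_equivalence : Equivalence a.Rel where
  refl y := a.rel_iff.mpr ⟨G.e (a.p y), G.s_e _, (a.e_actT y).symm⟩
  symm := by
    intro y y' h
    obtain ⟨g, w, rfl⟩ := a.rel_iff.mp h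
    exact a.rel_iff.mpr ⟨G.inv g, (G.s_inv g).trans (a.p_actT w).symm, (a.inv_actT_actT w).symm⟩
  trans := by
    intro y₁ y₂ y₃ h h'
    obtain ⟨g, w, rfl⟩ := a.rel_iff.mp h
    obtain ⟨g', w', rfl⟩ := a.rel_iff.mp h'
    have e : G.s g' = G.r g := w'.trans (a.p_actT w)
    exact a.rel_iff.mpr ⟨G.mulT g' g, (s_mulT e).trans w, (a.mul_actT w e).symm⟩

/-- In a free action an arrow is determined by its effect on one point. -/
theorem actT_injective (hfree : ∀ g y (w : G.s g = a.p y), a.act g y w = y → g ∈ Set.range G.e)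
    {g g' : G.Arrow} {y : Y} (w : G.s g = a.p y) (w' : G.s g' = a.p y)
    (h : a.actT g y = a.actT g' y) : g = g' := by
  have hr : G.r g = G.r g' := by rw [← a.p_actT w, h, a.p_actT w']
  have e1 : G.s (G.inv g) = G.r g' := (G.s_inv g).trans hr
  have h1 : a.actT (G.mulT (G.inv g) g') y = y := by
    rw [a.mul_actT w' e1, ← h, a.inv_actT_actT w]
  have w2 : G.s (G.mulT (G.inv g) g') = a.p y := (s_mulT e1).trans w'
  rw [a.actT_eq w2] at h1
  obtain ⟨x, hx⟩ := hfree _ _ w2 h1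
  have hx' : x = G.s g := by
    rw [← G.r_e x, hx, r_mulT e1, G.r_inv]
  have h2 := mulT_cancel_left_inv hr
  rw [← hx, hx', mulT_eq (G.r_e _).symm, G.mul_e] at h2
  exact h2

end LeftAction

theorem Quot.lift_injective_rel {Y X : Type u} {R : Y → Y → Prop} (hR : Equivalence R) {f : Y → X}
    {hf : ∀ y y', R y y' → f y = f y'} (hi : Function.Injective (Quot.lift f hf)) {y y' : Y}
    (h : f y = f y') : R y y' := by
  have h1 : Quot.mk R y = Quot.mk R y' := hi h
  exact hR.eqvGen_iff.mp (Quot.eqvGen_exact h1)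

namespace MoritaEquivalence

variable {Z : Type u} [TopologicalSpace Z] (E : MoritaEquivalence G H Z)

theorem exists_left_act {z z' : Z} (h : E.right.p z = E.right.p z') :
    ∃ g, G.s g = E.left.p z' ∧ E.left.actT g z' = z := by
  obtain ⟨g, w, e⟩ := E.left.rel_iff.mp
    (Quot.lift_injective_rel E.left.rel_equivalence E.homeo_right.injective h.symm)
  exact ⟨g, w, e.symm⟩

theorem right_rel_iff {z z' : Z} :
    E.right.Rel z z' ↔ E.right.toLeft.Rel z z' := by
  constructor
  · rintro ⟨h, w, rfl⟩
    exact ⟨H.inv h, (H.s_inv h).trans w.symm,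
      E.right.act_congr rfl (LCGroupoid.inv_inv h).symm _ _⟩
  · rintro ⟨h, w, rfl⟩
    exact ⟨H.inv h, w.symm.trans (H.r_inv h).symm, rfl⟩

theorem exists_right_act {z z' : Z} (h : E.left.p z = E.left.p z') :
    ∃ k, H.s k = E.right.toLeft.p z' ∧ E.right.toLeft.actT k z' = z := by
  have hR : Equivalence E.right.Rel := by
    have := E.right.toLeft.rel_equivalence
    rwa [← show E.right.Rel = E.right.toLeft.Rel from
      funext fun z => funext fun z' => propext E.right_rel_iff] at this
  obtain ⟨g, w, e⟩ := E.right.toLeft.rel_iff.mp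
    (E.right_rel_iff.mp (Quot.lift_injective_rel hR E.homeo_left.injective h.symm))
  exact ⟨g, w, e.symm⟩

theorem right_free : ∀ g y (w : H.s g = E.right.toLeft.p y), E.right.toLeft.act g y w = y →
    g ∈ Set.range H.e := by
  intro g y w h
  obtain ⟨x, hx⟩ := E.principal_right.1 y (H.inv g) _ h
  exact ⟨x, by rw [← LCGroupoid.inv_inv g, ← hx, H.inv_e]⟩

open Classical in
/-- The bispace of an equivalence. -/
noncomputable def toBispace [T2Space Z] : Bispace G H Z where
  a := E.left
  b := E.right.toLeft
  isOpenMap_a := E.isOpenMap_left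
  isOpenMap_b := E.isOpenMap_right
  b_p_act g z w := by rw [E.left.actT_eq w]; exact E.momentum_right g z w
  a_p_act h z w := by rw [E.right.toLeft.actT_eq w]; exact E.momentum_left z _ _
  comm g h z wg wh := by
    have wh' : H.s h = E.right.toLeft.p (E.left.act g z wg) :=
      wh.trans (E.momentum_right _ _ _).symm
    have wg' : G.s g = E.left.p (E.right.toLeft.act h z wh) := wg.trans (E.momentum_left _ _ _).symm
    rw [E.left.actT_eq wg, E.right.toLeft.actT_eq wh, E.left.actT_eq wg',
      E.right.toLeft.actT_eq wh']
    exact (E.commute _ _ _ _ _).symm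
  da z z' := if h : E.right.p z = E.right.p z' then (E.exists_left_act h).choose
    else G.e (E.left.p z)
  s_da z z' h := by
    rw [dif_pos (show E.right.p z = E.right.p z' from h)]
    exact (E.exists_left_act h).choose_spec.1
  da_act z z' h := by
    rw [dif_pos (show E.right.p z = E.right.p z' from h)]
    exact (E.exists_left_act h).choose_spec.2
  a_inj g g' z := E.left.actT_injective E.principal_left.1
  continuousOn_da := by
    rw [continuousOn_iff_continuous_domRestrict]
    have hinj : Function.Injective fun q : {q : G.Arrow × Z // G.s q.1 = E.left.p q.2} =>
        (E.left.act q.1.1 q.1.2 q.2, q.1.2) := by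
      rintro ⟨⟨g, z⟩, w⟩ ⟨⟨g', z'⟩, w'⟩ h
      obtain ⟨h1, rfl⟩ := Prod.ext_iff.mp h
      refine Subtype.ext (Prod.ext (E.left.actT_injective E.principal_left.1 w w' ?_) rfl)
      rw [E.left.actT_eq w, E.left.actT_eq w']
      exact h1
    have hemb := IsClosedEmbedding.of_continuous_injective_isClosedMap E.principal_left.2.continuous
      hinj E.principal_left.2.isClosedMap
    have hs : ∀ q : {q : Z × Z | E.right.p q.1 = E.right.p q.2},
        G.s (E.exists_left_act q.2).choose = E.left.p q.1.2 :=
      fun q => (E.exists_left_act q.2).choose_spec.1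
    have hψ : Continuous fun q : {q : Z × Z | E.right.p q.1 = E.right.p q.2} =>
        (⟨((E.exists_left_act q.2).choose, q.1.2), hs q⟩ :
          {q : G.Arrow × Z // G.s q.1 = E.left.p q.2}) := by
      rw [hemb.isInducing.continuous_iff]
      refine continuous_subtype_val.congr fun q => ?_
      refine Prod.ext ?_ rfl
      change q.1.1 = E.left.act _ _ (hs q)
      rw [← E.left.actT_eq (hs q)]
      exact (E.exists_left_act q.2).choose_spec.2.symm
    refine (continuous_fst.comp (continuous_subtype_val.comp hψ)).congr fun q => ?_
    change _ = dite _ _ _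
    rw [dif_pos (show E.right.p q.1.1 = E.right.p q.1.2 from q.2)]
    rfl
  db z z' := if h : E.left.p z = E.left.p z' then (E.exists_right_act h).choose
    else H.e (E.right.p z)
  s_db z z' h := by
    rw [dif_pos h]
    exact (E.exists_right_act h).choose_spec.1
  db_act z z' h := by
    rw [dif_pos h]
    exact (E.exists_right_act h).choose_spec.2
  b_inj g g' z := E.right.toLeft.actT_injective E.right_free
  continuousOn_db := by
    rw [continuousOn_iff_continuous_domRestrict]
    have hinj : Function.Injective fun q : {q : Z × H.Arrow // E.right.p q.1 = H.r q.2} =>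
        (q.1.1, E.right.act q.1.1 q.1.2 q.2) := by
      rintro ⟨⟨z, g⟩, w⟩ ⟨⟨z', g'⟩, w'⟩ h
      obtain ⟨h0, h1⟩ := Prod.ext_iff.mp h
      obtain rfl : z = z' := h0
      have v : H.s (H.inv g) = E.right.toLeft.p z := (H.s_inv g).trans w.symm
      have v' : H.s (H.inv g') = E.right.toLeft.p z := (H.s_inv g').trans w'.symm
      have : H.inv g = H.inv g' := by
        refine E.right.toLeft.actT_injective E.right_free v v' ?_
        rw [E.right.toLeft.actT_eq v, E.right.toLeft.actT_eq v']
        exact (E.right.act_congr rfl (LCGroupoid.inv_inv g) _ w).trans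
          (h1.trans (E.right.act_congr rfl (LCGroupoid.inv_inv g').symm _ _))
      refine Subtype.ext (Prod.ext rfl ?_)
      change g = g'
      rw [← LCGroupoid.inv_inv g, this, LCGroupoid.inv_inv]
    have hemb := IsClosedEmbedding.of_continuous_injective_isClosedMap
      E.principal_right.2.continuous hinj E.principal_right.2.isClosedMap
    have hs : ∀ q : {q : Z × Z | E.left.p q.1 = E.left.p q.2},
        H.s (E.exists_right_act q.2).choose = E.right.p q.1.2 :=
      fun q => (E.exists_right_act q.2).choose_spec.1
    have hψ : Continuous fun q : {q : Z × Z | E.left.p q.1 = E.left.p q.2} =>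
        (⟨(q.1.2, H.inv (E.exists_right_act q.2).choose), (hs q).symm.trans (H.r_inv _).symm⟩ :
          {q : Z × H.Arrow // E.right.p q.1 = H.r q.2}) := by
      rw [hemb.isInducing.continuous_iff]
      refine (continuous_swap.comp continuous_subtype_val).congr fun q => ?_
      refine Prod.ext rfl ?_
      change q.1.1 = E.right.toLeft.act (E.exists_right_act q.2).choose q.1.2 (hs q)
      rw [← E.right.toLeft.actT_eq (hs q)]
      exact (E.exists_right_act q.2).choose_spec.2.symm
    refine (H.continuous_inv.comp (continuous_snd.comp
      (continuous_subtype_val.comp hψ))).congr fun q => ?_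
    change _ = dite _ _ _
    rw [dif_pos (show E.left.p q.1.1 = E.left.p q.1.2 from q.2)]
    exact LCGroupoid.inv_inv _

end MoritaEquivalence

end LCGroupoid

/-! ### Compactly supported kernels -/

/-- A continuous family `μ` of measures of mass at most one on `B`, indexed by `A`, where all the
measures are carried by one compact set `S`, and `μ a` is carried by the slice `D a` of a closed
relation. -/
structure IsKernel {A B : Type*} [TopologicalSpace A] [TopologicalSpace B] [MeasurableSpace B]
    (D : A → Set B) (S : Set B) (μ : A → Measure B) : Prop where
  isCompact : IsCompact S
  isClosed : IsClosed {q : A × B | q.2 ∈ D q.1}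
  mem : ∀ a, ∀ᵐ b ∂(μ a), b ∈ S ∧ b ∈ D a
  mass : ∀ a, μ a univ ≤ 1
  cont : ∀ f : C_c(B, ℝ), Continuous fun a => ∫ b, f b ∂(μ a)

namespace IsKernel

variable {A B : Type*} [TopologicalSpace A] [TopologicalSpace B] [MeasurableSpace B]
  {D : A → Set B} {S : Set B} {μ : A → Measure B}

theorem isFiniteMeasure (h : IsKernel D S μ) (a : A) : IsFiniteMeasure (μ a) :=
  ⟨(h.mass a).trans_lt ENNReal.one_lt_top⟩

theorem isClosed_slice (h : IsKernel D S μ) (a : A) : IsClosed (D a) :=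
  h.isClosed.preimage (continuous_const.prodMk continuous_id : Continuous fun b => (a, b))

theorem real_univ_le (h : IsKernel D S μ) (a : A) : (μ a).real univ ≤ 1 :=
  ENNReal.toReal_le_of_le_ofReal zero_le_one (by simpa using h.mass a)

theorem abs_integral_le (h : IsKernel D S μ) (a : A) {f : B → ℝ} {C : ℝ} (hC : 0 ≤ C)
    (hf : ∀ b ∈ S, b ∈ D a → |f b| ≤ C) : |∫ b, f b ∂(μ a)| ≤ C := by
  have := h.isFiniteMeasure a
  have h1 : ‖∫ b, f b ∂(μ a)‖ ≤ C * (μ a).real univ :=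
    norm_integral_le_of_norm_le_const ((h.mem a).mono fun b hb => hf b hb.1 hb.2)
  rw [Real.norm_eq_abs] at h1
  exact h1.trans (mul_le_of_le_one_right hC (h.real_univ_le a))

theorem integrable [T2Space B] [BorelSpace B] (h : IsKernel D S μ) (a : A) {f : B → ℝ}
    (hf : ContinuousOn f (D a)) : Integrable f (μ a) := by
  have := h.isFiniteMeasure a
  have hT : IsClosed (S ∩ D a) := h.isCompact.isClosed.inter (h.isClosed_slice a)
  exact (hf.mono inter_subset_right).integrable_of_ae_mem hT (h.mem a) h.isCompact
    (fun b hb _ => hb.1)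

theorem continuous_integral [T2Space B] [LocallyCompactSpace B] [BorelSpace B]
    (h : IsKernel D S μ) {P : Type*} [TopologicalSpace P] {u : P → A} (hu : Continuous u)
    {F : P → B → ℝ} (hF : ContinuousOn (fun q : P × B => F q.1 q.2) {q | q.2 ∈ D (u q.1)}) :
    Continuous fun p => ∫ b, F p b ∂(μ (u p)) := by
  refine continuous_integral_of_closed_relation (D := fun a b => b ∈ S ∧ b ∈ D a) ?_
    (fun a => by have := h.isFiniteMeasure a; infer_instance) h.mem h.cont hu
    (hF.mono fun q hq => hq.2)
    (fun p₀ => ⟨S, h.isCompact, Eventually.of_forall fun p b hb _ => hb.1⟩)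
  exact (h.isCompact.isClosed.preimage continuous_snd).inter h.isClosed

/-- Kernels can be given by positive linear functionals. -/
theorem exists_of_functional [T2Space B] [LocallyCompactSpace B] [BorelSpace B]
    (hS : IsCompact S) (hD : IsClosed {q : A × B | q.2 ∈ D q.1}) (Λ : A → C_c(B, ℝ) →ₗ[ℝ] ℝ)
    (hpos : ∀ a (F : C_c(B, ℝ)), (∀ b ∈ S, b ∈ D a → 0 ≤ F b) → 0 ≤ Λ a F)
    (hmass : ∀ a (F : C_c(B, ℝ)), (∀ b ∈ S, F b = 1) → Λ a F ≤ 1)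
    (hcont : ∀ F, Continuous fun a => Λ a F) :
    ∃ μ : A → Measure B, IsKernel D S μ ∧ (∀ a F, ∫ b, F b ∂(μ a) = Λ a F) ∧
      (∀ a, (∀ F : C_c(B, ℝ), (∀ b ∈ S, F b = 1) → Λ a F = 1) → μ a univ = 1) ∧
      ∀ a, (μ a).Regular := by
  have hDa : ∀ a, IsClosed (D a) := fun a =>
    hD.preimage (continuous_const.prodMk continuous_id : Continuous fun b => (a, b))
  choose μ hreg hfin hmem hint using fun a =>
    exists_regular_measure_of_functional (Λ a) (hS.inter_right (hDa a))
      (fun F hF => hpos a F fun b hb hb' => hF b ⟨hb, hb'⟩)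
  obtain ⟨χ, hχ1, -, -, -⟩ := hS.exists_cutoff isOpen_univ (subset_univ _)
  have huniv : ∀ a, (μ a).real univ = Λ a χ := fun a => by
    have h1 : ∫ b, χ b ∂(μ a) = ∫ b, (1 : ℝ) ∂(μ a) :=
      integral_congr_ae ((hmem a).mono fun b hb => hχ1 b hb.1)
    rw [← hint, h1, integral_const, smul_eq_mul, mul_one]
  have h2 : ∀ a, μ a univ = ENNReal.ofReal (Λ a χ) := fun a => by
    rw [← huniv a, measureReal_def, ENNReal.ofReal_toReal (measure_ne_top _ _)]
  refine ⟨μ, ⟨hS, hD, hmem, fun a => ?_, fun f => ?_⟩, hint, fun a ha => ?_, hreg⟩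
  · rw [h2 a]
    exact ENNReal.ofReal_le_one.mpr (hmass a χ hχ1)
  · simp only [hint]
    exact hcont f
  · rw [h2 a, ha χ hχ1, ENNReal.ofReal_one]

end IsKernel

theorem abs_integral_sub_le_of_isProbabilityMeasure {α : Type*} [MeasurableSpace α] {μ : Measure α}
    (hμ : μ univ = 1) {f : α → ℝ} (hf : AEStronglyMeasurable f μ) {a δ : ℝ}
    (h : ∀ᵐ x ∂μ, |f x - a| ≤ δ) : |∫ x, f x ∂μ - a| ≤ δ := by
  have : IsProbabilityMeasure μ := ⟨hμ⟩
  have hi : Integrable (fun x => f x - a) μ :=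
    Integrable.of_bound (hf.sub aestronglyMeasurable_const) δ h
  have hi' : Integrable f μ := by
    refine (hi.add (integrable_const a)).congr (ae_of_all _ fun x => ?_)
    simp
  have h1 : ∫ x, f x ∂μ - a = ∫ x, (f x - a) ∂μ := by
    rw [integral_sub hi' (integrable_const a)]
    simp
  rw [h1]
  have h2 := norm_integral_le_of_norm_le_const (μ := μ) (f := fun x => f x - a) h
  simpa using h2

namespace LCGroupoid

/-! ### Fibres, means, and the criterion for amenability -/

variable (K : LCGroupoid.{u})

theorem isClosedEmbedding_fiber (x : K.Obj) :
    IsClosedEmbedding (fun g : K.Fiber x => (g.1 : K.Arrow)) :=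
  (isClosed_eq K.continuous_r continuous_const :
    IsClosed {g | K.r g = x}).isClosedEmbedding_subtypeVal

instance (x : K.Obj) : T2Space (K.Fiber x) :=
  inferInstanceAs (T2Space {g : K.Arrow // K.r g = x})

instance (x : K.Obj) : LocallyCompactSpace (K.Fiber x) :=
  (K.isClosedEmbedding_fiber x).locallyCompactSpace

/-- The restriction of a function in `C_c(K)` to a fibre. -/
def restrictFiber (f : C_c(K.Arrow, ℝ)) (x : K.Obj) : C_c(K.Fiber x, ℝ) :=
  ⟨⟨fun g => f g.1, f.continuous.comp (K.isClosedEmbedding_fiber x).continuous⟩,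
    f.hasCompactSupport.comp_isClosedEmbedding (K.isClosedEmbedding_fiber x)⟩

variable {K}

/-- Parametrised integrals against a continuous system of measures on the fibres are continuous. -/
theorem continuous_integral_fiber {μ : (x : K.Obj) → Measure (K.Fiber x)}
    (hfin : ∀ x, IsFiniteMeasureOnCompacts (μ x))
    (hcont : ∀ f : C_c(K.Arrow, ℝ), Continuous fun x => ∫ g, f g.1 ∂(μ x))
    {P : Type*} [TopologicalSpace P] {u : P → K.Obj} (hu : Continuous u) {F : P → K.Arrow → ℝ}
    (hF : ContinuousOn (fun q : P × K.Arrow => F q.1 q.2) {q | K.r q.2 = u q.1})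
    (hloc : ∀ p₀, ∃ C, IsCompact C ∧ ∀ᶠ p in 𝓝 p₀, ∀ g, K.r g = u p → F p g ≠ 0 → g ∈ C) :
    Continuous fun p => ∫ g, F p g.1 ∂(μ (u p)) := by
  let : MeasurableSpace K.Arrow := borel _
  have : BorelSpace K.Arrow := ⟨rfl⟩
  have hme : ∀ x, MeasurableEmbedding (fun g : K.Fiber x => (g.1 : K.Arrow)) := fun x =>
    (K.isClosedEmbedding_fiber x).measurableEmbedding
  have hint : ∀ x (f : K.Arrow → ℝ),
      ∫ g, f g ∂((μ x).map fun g : K.Fiber x => g.1) = ∫ g, f g.1 ∂(μ x) :=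
    fun x f => (hme x).integral_map f
  have h := continuous_integral_of_closed_relation (D := fun x g => K.r g = x)
    (μ := fun x => (μ x).map fun g : K.Fiber x => g.1)
    (isClosed_eq (K.continuous_r.comp continuous_snd) continuous_fst)
    (fun x => ⟨fun C hC => by
      rw [(hme x).map_apply]
      have := hfin x
      exact ((K.isClosedEmbedding_fiber x).isCompact_preimage hC).measure_lt_top⟩)
    (fun x => ((hme x).ae_map_iff).mpr (ae_of_all _ fun g => g.2))
    (fun f => by simpa only [hint] using hcont f) hu hF hloc
  simpa only [hint] using h

/-- Left translation as a homeomorphism between fibres. -/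
def translateHomeomorph (γ : K.Arrow) : K.Fiber (K.s γ) ≃ₜ K.Fiber (K.r γ) where
  toFun := K.translate γ
  invFun g := ⟨K.mul (K.inv γ) g.1 ((K.s_inv γ).trans g.2.symm), (K.r_mul _ _ _).trans (K.r_inv γ)⟩
  left_inv g := by
    refine Subtype.ext ?_
    have := mulT_inv_cancel_left (G := K) (g := γ) (h := g.1) g.2.symm
    rw [mulT_eq g.2.symm, mulT_eq ((K.s_inv γ).trans (K.r_mul _ _ _).symm)] at this
    exact this
  right_inv g := by
    refine Subtype.ext ?_
    have := mulT_cancel_left_inv (G := K) (g := γ) (h := g.1) g.2.symm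
    have w := (K.s_inv γ).trans g.2.symm
    rw [mulT_eq w, mulT_eq ((K.r_inv γ).symm.trans (K.r_mul _ _ w).symm)] at this
    exact this
  continuous_toFun := by
    refine Continuous.subtype_mk ?_ _
    exact K.continuous_mul.comp (f := fun g : K.Fiber (K.s γ) =>
      (⟨(γ, g.1), g.2.symm⟩ : {q : K.Arrow × K.Arrow // K.s q.1 = K.r q.2}))
      ((continuous_const.prodMk continuous_subtype_val).subtype_mk _)
  continuous_invFun := by
    refine Continuous.subtype_mk ?_ _
    exact K.continuous_mul.comp (f := fun g : K.Fiber (K.r γ) =>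
      (⟨(K.inv γ, g.1), (K.s_inv γ).trans g.2.symm⟩ : {q : K.Arrow × K.Arrow // K.s q.1 = K.r q.2}))
      ((continuous_const.prodMk continuous_subtype_val).subtype_mk _)

theorem continuous_translate (γ : K.Arrow) : Continuous (K.translate γ) :=
  (translateHomeomorph γ).continuous

/-- Amenability may be tested on one compact set and one `ε` at a time. -/
theorem isAmenable_iff : K.IsAmenable ↔ ∀ C : Set K.Arrow, IsCompact C → ∀ ε : ℝ, 0 < ε →
    ∃ m : (x : K.Obj) → ProbabilityMeasure (K.Fiber x), K.IsContinuousMean m ∧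
      ∀ γ ∈ C, l1Dist ((m (K.s γ) : Measure (K.Fiber (K.s γ))).map (K.translate γ))
          (m (K.r γ) : Measure (K.Fiber (K.r γ))) ≤ ε := by
  constructor
  · rintro ⟨I, _, _, _, m, hm, hlim⟩ C hC ε hε
    have h := Metric.tendstoUniformlyOn_iff.mp (hlim C hC) ε hε
    obtain ⟨i, hi⟩ := h.exists
    refine ⟨m i, hm i, fun γ hγ => ?_⟩
    have := hi γ hγ
    rw [dist_comm, Real.dist_eq, sub_zero] at this
    exact (le_abs_self _).trans this.le
  · intro h
    choose m hm hε using fun (C : {C : Set K.Arrow // IsCompact C}) (n : ℕ) =>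
      h C.1 C.2 (1 / (n + 1 : ℝ)) Nat.one_div_pos_of_nat
    refine ⟨{C : Set K.Arrow // IsCompact C} × ℕ, inferInstance, ⟨?_⟩, ⟨⟨⟨∅, isCompact_empty⟩, 0⟩⟩,
      fun i => m i.1 i.2, fun i => hm _ _, fun C hC => ?_⟩
    · intro i j
      exact ⟨⟨⟨i.1.1 ∪ j.1.1, i.1.2.union j.1.2⟩, max i.2 j.2⟩,
        ⟨subset_union_left, le_max_left _ _⟩, ⟨subset_union_right, le_max_right _ _⟩⟩
    · rw [Metric.tendstoUniformlyOn_iff]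
      intro ε hεpos
      obtain ⟨n, hn⟩ := exists_nat_one_div_lt hεpos
      filter_upwards [eventually_ge_atTop
        ((⟨C, hC⟩, n) : {C : Set K.Arrow // IsCompact C} × ℕ)] with i hi γ hγ
      have h1 := hε i.1 i.2 γ (hi.1 hγ)
      rw [dist_comm, Real.dist_eq, sub_zero, abs_of_nonneg (l1Dist_nonneg _ _)]
      refine h1.trans_lt (lt_of_le_of_lt ?_ hn)
      exact Nat.one_div_le_one_div hi.2

/-- A continuous mean is uniformly tight over compact sets of units. -/
theorem IsContinuousMean.exists_cutoff {m : (x : K.Obj) → ProbabilityMeasure (K.Fiber x)}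
    (hm : K.IsContinuousMean m) {Q : Set K.Obj} (hQ : IsCompact Q) {ε : ℝ} (hε : 0 < ε) :
    ∃ φ : C_c(K.Arrow, ℝ), (∀ g, 0 ≤ φ g) ∧ (∀ g, φ g ≤ 1) ∧
      ∀ x ∈ Q, 1 - ε ≤ ∫ g, φ g.1 ∂(m x : Measure (K.Fiber x)) := by
  refine hQ.induction_on (p := fun Q => ∃ φ : C_c(K.Arrow, ℝ), (∀ g, 0 ≤ φ g) ∧ (∀ g, φ g ≤ 1) ∧
      ∀ x ∈ Q, 1 - ε ≤ ∫ g, φ g.1 ∂(m x : Measure (K.Fiber x))) ?_ ?_ ?_ ?_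
  · exact ⟨0, by simp, by simp, by simp⟩
  · rintro s t hst ⟨φ, h0, h1, h⟩
    exact ⟨φ, h0, h1, fun x hx => h x (hst hx)⟩
  · have key : ∀ (φ ψ : C_c(K.Arrow, ℝ)) x, (∀ g, φ g ≤ ψ g) →
        ∫ g, φ g.1 ∂(m x : Measure (K.Fiber x)) ≤ ∫ g, ψ g.1 ∂(m x : Measure (K.Fiber x)) := by
      intro φ ψ x hφψ
      have hi : ∀ φ : C_c(K.Arrow, ℝ), Integrable (fun g : K.Fiber x => φ g.1)
          (m x : Measure (K.Fiber x)) := fun φ =>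
        (K.restrictFiber φ x).continuous.integrable_of_hasCompactSupport
          (K.restrictFiber φ x).hasCompactSupport
      exact integral_mono (hi φ) (hi ψ) fun g => hφψ g.1
    rintro s t ⟨φ, h0, h1, h⟩ ⟨ψ, k0, k1, k⟩
    refine ⟨φ ⊔ ψ, fun g => le_sup_of_le_left (h0 g), fun g => sup_le (h1 g) (k1 g), ?_⟩
    rintro x (hx | hx)
    · exact (h x hx).trans (key _ _ x fun g => le_sup_left)
    · exact (k x hx).trans (key _ _ x fun g => le_sup_right)
  · intro x hx
    have := hm.1 x
    obtain ⟨C, -, hC, hCm⟩ := (isOpen_univ (X := K.Fiber x)).exists_lt_isCompact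
      (μ := (m x : Measure (K.Fiber x))) (r := ENNReal.ofReal (1 - ε)) (by
        rw [measure_univ]
        exact ENNReal.ofReal_lt_one.mpr (by linarith))
    obtain ⟨χ, c1, -, cnn, cle⟩ := (hC.image (K.isClosedEmbedding_fiber x).continuous).exists_cutoff
      isOpen_univ (subset_univ _)
    have h1 : 1 - ε < ∫ g, χ g.1 ∂(m x : Measure (K.Fiber x)) := by
      have h2 : 1 - ε < (m x : Measure (K.Fiber x)).real C := by
        by_contra hcon
        push Not at hcon
        exact absurd hCm (not_lt.mpr
          ((ENNReal.le_ofReal_iff_toReal_le (measure_ne_top _ _)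
            (measureReal_nonneg.trans hcon)).mpr hcon))
      refine h2.trans_le ?_
      rw [← integral_indicator_one hC.measurableSet]
      refine integral_mono ((integrable_const 1).indicator hC.measurableSet)
        ((K.restrictFiber χ x).continuous.integrable_of_hasCompactSupport
          (K.restrictFiber χ x).hasCompactSupport) fun g => ?_
      by_cases hg : g ∈ C
      · simp only [indicator_of_mem hg, Pi.one_apply]
        exact (c1 g.1 ⟨g, hg, rfl⟩).ge
      · simp only [indicator_of_notMem hg]
        exact cnn g.1
    refine ⟨{y | 1 - ε < ∫ g, χ g.1 ∂(m y : Measure (K.Fiber y))}, ?_, χ, cnn, cle,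
      fun y hy => (show 1 - ε < _ from hy).le⟩
    exact mem_nhdsWithin_of_mem_nhds
      ((isOpen_lt continuous_const (hm.2 χ)).mem_nhds h1)

/-- Comparison of the integrals of a function and of its translate. -/
theorem abs_integral_translate_sub_le (m : (x : K.Obj) → ProbabilityMeasure (K.Fiber x))
    (κ : K.Arrow) {Ψ : K.Arrow → ℝ} (hΨ : ContinuousOn Ψ {g | K.r g = K.r κ}) {C : ℝ}
    (hC : ∀ g, |Ψ g| ≤ C) :
    |∫ g, Ψ (K.mulT κ g.1) ∂(m (K.s κ) : Measure (K.Fiber (K.s κ)))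
        - ∫ g, Ψ g.1 ∂(m (K.r κ) : Measure (K.Fiber (K.r κ)))| ≤
      C * l1Dist ((m (K.s κ) : Measure (K.Fiber (K.s κ))).map (K.translate κ))
          (m (K.r κ) : Measure (K.Fiber (K.r κ))) := by
  have hc : Continuous fun g : K.Fiber (K.r κ) => Ψ g.1 :=
    continuousOn_iff_continuous_domRestrict.mp hΨ
  have h := abs_integral_sub_integral_le_l1Dist
    ((m (K.s κ) : Measure (K.Fiber (K.s κ))).map (K.translate κ))
    (m (K.r κ) : Measure (K.Fiber (K.r κ))) hc.stronglyMeasurable (fun g => hC g.1)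
  rw [integral_map (continuous_translate κ).measurable.aemeasurable
    hc.stronglyMeasurable.aestronglyMeasurable] at h
  convert h using 5 with g
  exact congrArg Ψ (mulT_eq g.2.symm)

variable {G H : LCGroupoid.{u}}

/-! ### Arrows of a semi-direct product -/

namespace LeftAction

variable {Y : Type u} [TopologicalSpace Y] [T2Space Y] [LocallyCompactSpace Y] (a : G.LeftAction Y)

/-- A point of `Y`, as a unit of `Y ⋊ G`. -/
def unit (y : Y) : a.semidirect.Obj := y

theorem continuous_unit : Continuous a.unit := continuous_id

/-- The point `y` of an arrow `(y, γ)` of `Y ⋊ G`. -/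
def pt (q : a.semidirect.Arrow) : Y := Prod.fst (Subtype.val q)

/-- The arrow `γ` of an arrow `(y, γ)` of `Y ⋊ G`. -/
def arr (q : a.semidirect.Arrow) : G.Arrow := Prod.snd (Subtype.val q)

/-- The arrow `(y, γ)` of `Y ⋊ G`. -/
def semiMk (y : Y) (g : G.Arrow) (h : a.p y = G.r g) : a.semidirect.Arrow :=
  Subtype.mk (p := fun q : Y × G.Arrow => a.p q.1 = G.r q.2) (y, g) h

theorem p_pt (q : a.semidirect.Arrow) : a.p (a.pt q) = G.r (a.arr q) := Subtype.property q

theorem semidirect_s (q : a.semidirect.Arrow) :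
    a.semidirect.s q = a.unit (a.actT (G.inv (a.arr q)) (a.pt q)) :=
  congrArg a.unit (a.actT_eq ((G.s_inv _).trans (a.p_pt q).symm)).symm

theorem arr_mulT {q q' : a.semidirect.Arrow} (w : a.semidirect.s q = a.semidirect.r q') :
    a.arr (a.semidirect.mulT q q') = G.mulT (a.arr q) (a.arr q') := by
  rw [mulT_eq w]
  exact (mulT_eq (a.comp_w q q' w)).symm

theorem isClosedEmbedding_pt_arr : IsClosedEmbedding fun q => (a.pt q, a.arr q) :=
  (isClosed_eq (a.continuous_p.comp continuous_fst) (G.continuous_r.comp continuous_snd) :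
    IsClosed {q : Y × G.Arrow | a.p q.1 = G.r q.2}).isClosedEmbedding_subtypeVal

theorem continuous_pt : Continuous a.pt := continuous_fst.comp a.isClosedEmbedding_pt_arr.continuous

theorem continuous_arr : Continuous a.arr :=
  continuous_snd.comp a.isClosedEmbedding_pt_arr.continuous

end LeftAction

/-! ### Transport of means along a bispace -/

section Transport

set_option linter.unusedSectionVars false

variable {Z : Type u} [TopologicalSpace Z] [T2Space Z] [LocallyCompactSpace Z]
  [MeasurableSpace Z] [BorelSpace Z]
  {Y' : Type u} [TopologicalSpace Y'] [T2Space Y'] [LocallyCompactSpace Y']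
  {Y : Type u} [TopologicalSpace Y] [T2Space Y] [LocallyCompactSpace Y]
  (E : Bispace G H Z) (c : H.LeftAction Y') (a : H.LeftAction Y)

/-- Given measures `ρ^y` on the fibres of `Z → H⁽⁰⁾`, which are `G`-orbits, and a point `(z, y)`
of the fibre product, the integral of `f` against the image of `ρ^y` under the identification of the
orbit of `z` with the fibre of `G` over the momentum of `z`. -/
noncomputable def orbitIntegral (ρ : Y' → Measure Z) (f : G.Arrow → ℝ) (w : E.Pull c) : ℝ :=
  ∫ z', f (E.da w.z z') ∂(ρ w.y)

/-- The average of a function `F` on the fibre product over the `H`-orbit of `w`, with respect to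
the mean `m` of `Y ⋊ H` cut off by `φ`. -/
noncomputable def meanAverage (f₀ : Y' → Y)
    (m : (y : a.semidirect.Obj) → ProbabilityMeasure (a.semidirect.Fiber y))
    (φ : a.semidirect.Arrow → ℝ) (F : E.Pull c → ℝ) (w : E.Pull c) : ℝ :=
  ∫ g, φ g.1 * F ((E.pullH c).actT (H.inv (a.arr g.1)) w)
    ∂(m (a.unit (f₀ w.y)) : Measure (a.semidirect.Fiber (a.unit (f₀ w.y))))

variable {E c a}

section OrbitIntegral

variable {S : Set Z} {ρ : Y' → Measure Z}

theorem continuousOn_orbitIntegral (hρ : IsKernel (fun y => {z | E.b.p z = c.p y}) S ρ)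
    {T : Type*} [TopologicalSpace T] {x : T → G.Obj} {F : T → G.Arrow → ℝ}
    (hF : ContinuousOn (fun q : T × G.Arrow => F q.1 q.2) {q | G.r q.2 = x q.1}) :
    ContinuousOn (fun q : T × E.Pull c => orbitIntegral E c ρ (F q.1) q.2)
      {q | E.a.p q.2.z = x q.1} := by
  rw [continuousOn_iff_continuous_domRestrict]
  refine hρ.continuous_integral (P := {q : T × E.Pull c | E.a.p q.2.z = x q.1})
    (u := fun p => p.1.2.y) (F := fun p z' => F p.1.1 (E.da p.1.2.z z'))
    (Bispace.Pull.continuous_y.comp (continuous_snd.comp continuous_subtype_val)) ?_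
  have hw : ∀ q : {q : T × E.Pull c | E.a.p q.2.z = x q.1} × Z, E.b.p q.2 = c.p q.1.1.2.y →
      E.b.p q.1.1.2.z = E.b.p q.2 := fun q hq => (Bispace.Pull.p_eq _).trans hq.symm
  refine hF.comp (f := fun q : {q : T × E.Pull c | E.a.p q.2.z = x q.1} × Z =>
    (q.1.1.1, E.da q.1.1.2.z q.2)) ?_ ?_
  · refine ContinuousOn.prodMk ?_ ?_
    · exact (continuous_fst.comp (continuous_subtype_val.comp continuous_fst)).continuousOn
    · refine E.continuousOn_da.comp (f := fun q : {q : T × E.Pull c | E.a.p q.2.z = x q.1} × Z =>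
        (q.1.1.2.z, q.2)) ?_ hw
      exact ((Bispace.Pull.continuous_z.comp (continuous_snd.comp
        (continuous_subtype_val.comp continuous_fst))).prodMk continuous_snd).continuousOn
  · intro q hq
    exact (E.r_da (hw q hq)).trans q.1.2

theorem continuousOn_da_right (w : E.Pull c) {f : G.Arrow → ℝ}
    (hf : ContinuousOn f {g | G.r g = E.a.p w.z}) :
    ContinuousOn (fun z' => f (E.da w.z z')) {z | E.b.p z = c.p w.y} := by
  have hw : ∀ z', E.b.p z' = c.p w.y → E.b.p w.z = E.b.p z' := fun z' h => w.p_eq.trans h.symm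
  refine hf.comp ?_ fun z' hz' => E.r_da (hw z' hz')
  exact E.continuousOn_da.comp (f := fun z' => (w.z, z'))
    (continuous_const.prodMk continuous_id).continuousOn hw

theorem orbitIntegral_add (hρ : IsKernel (fun y => {z | E.b.p z = c.p y}) S ρ) (w : E.Pull c)
    {f₁ f₂ : G.Arrow → ℝ} (h₁ : ContinuousOn f₁ {g | G.r g = E.a.p w.z})
    (h₂ : ContinuousOn f₂ {g | G.r g = E.a.p w.z}) :
    orbitIntegral E c ρ (fun g => f₁ g + f₂ g) w =
      orbitIntegral E c ρ f₁ w + orbitIntegral E c ρ f₂ w :=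
  integral_add (hρ.integrable _ (continuousOn_da_right w h₁))
    (hρ.integrable _ (continuousOn_da_right w h₂))

theorem orbitIntegral_smul (r : ℝ) (f : G.Arrow → ℝ) (w : E.Pull c) :
    orbitIntegral E c ρ (fun g => r * f g) w = r * orbitIntegral E c ρ f w :=
  integral_const_mul _ _

theorem orbitIntegral_nonneg {f : G.Arrow → ℝ} (hf : ∀ g, 0 ≤ f g) (w : E.Pull c) :
    0 ≤ orbitIntegral E c ρ f w :=
  integral_nonneg fun _ => hf _

theorem abs_orbitIntegral_le (hρ : IsKernel (fun y => {z | E.b.p z = c.p y}) S ρ)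
    {f : G.Arrow → ℝ} {C : ℝ} (hC : 0 ≤ C) (hf : ∀ g, |f g| ≤ C) (w : E.Pull c) :
    |orbitIntegral E c ρ f w| ≤ C :=
  hρ.abs_integral_le _ hC fun _ _ _ => hf _

theorem orbitIntegral_congr (hρ : IsKernel (fun y => {z | E.b.p z = c.p y}) S ρ) (w : E.Pull c)
    {f₁ f₂ : G.Arrow → ℝ}
    (h : ∀ z' ∈ S, E.b.p w.z = E.b.p z' → f₁ (E.da w.z z') = f₂ (E.da w.z z')) :
    orbitIntegral E c ρ f₁ w = orbitIntegral E c ρ f₂ w :=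
  integral_congr_ae ((hρ.mem _).mono fun z' hz' => h z' hz'.1 (w.p_eq.trans hz'.2.symm))

/-- The orbit integral intertwines left translation on `G` with the action of `G`. -/
theorem orbitIntegral_translate (hρ : IsKernel (fun y => {z | E.b.p z = c.p y}) S ρ)
    {g : G.Arrow} {w : E.Pull c} (hg : G.s g = E.a.p w.z) {f f' : G.Arrow → ℝ}
    (h : ∀ k, G.s g = G.r k → f' k = f (G.mulT g k)) :
    orbitIntegral E c ρ f' w = orbitIntegral E c ρ f ((E.pullG c).actT g w) := by
  rw [orbitIntegral, orbitIntegral, Bispace.pullG_y hg, Bispace.pullG_z hg]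
  refine integral_congr_ae ((hρ.mem _).mono fun z' hz' => ?_)
  have hw : E.b.p w.z = E.b.p z' := w.p_eq.trans hz'.2.symm
  change f' (E.da w.z z') = f (E.da (E.a.actT g w.z) z')
  rw [h _ (hg.trans (E.r_da hw).symm), E.da_act_left hw hg]

end OrbitIntegral

section MeanAverage

variable {f₀ : Y' → Y} (hfp : ∀ y, a.p (f₀ y) = c.p y)
  {m : (y : a.semidirect.Obj) → ProbabilityMeasure (a.semidirect.Fiber y)}
  {φ : C_c(a.semidirect.Arrow, ℝ)}

include hfp in
theorem composable_of_r {w : E.Pull c} {g : a.semidirect.Arrow}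
    (h : a.semidirect.r g = a.unit (f₀ w.y)) : H.s (H.inv (a.arr g)) = c.p w.y := by
  rw [H.s_inv, ← a.p_pt, ← hfp]
  exact congrArg a.p h

include hfp in
theorem a_p_pullH_inv {w : E.Pull c} {g : a.semidirect.Arrow}
    (h : a.semidirect.r g = a.unit (f₀ w.y)) :
    E.a.p ((E.pullH c).actT (H.inv (a.arr g)) w).z = E.a.p w.z := by
  have e := composable_of_r hfp h
  rw [Bispace.pullH_z e, E.a_p_act _ _ (e.trans w.p_eq.symm)]

include hfp in
theorem continuousOn_pullH_inv {T : Type*} [TopologicalSpace T] {x : T → G.Obj}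
    {F : T → E.Pull c → ℝ}
    (hF : ContinuousOn (fun q : T × E.Pull c => F q.1 q.2) {q | E.a.p q.2.z = x q.1}) :
    ContinuousOn (fun q : {q : T × E.Pull c | E.a.p q.2.z = x q.1} × a.semidirect.Arrow =>
      F q.1.1.1 ((E.pullH c).actT (H.inv (a.arr q.2)) q.1.1.2))
      {q | a.semidirect.r q.2 = a.unit (f₀ q.1.1.2.y)} := by
  refine hF.comp (f := fun q : {q : T × E.Pull c | E.a.p q.2.z = x q.1} × a.semidirect.Arrow =>
    (q.1.1.1, (E.pullH c).actT (H.inv (a.arr q.2)) q.1.1.2)) ?_ ?_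
  · refine ContinuousOn.prodMk ?_ ?_
    · exact (continuous_fst.comp (continuous_subtype_val.comp continuous_fst)).continuousOn
    · refine (E.pullH c).continuousOn_actT.comp
        (f := fun q : {q : T × E.Pull c | E.a.p q.2.z = x q.1} × a.semidirect.Arrow =>
        (H.inv (a.arr q.2), q.1.1.2)) ?_ ?_
      · exact ((H.continuous_inv.comp (a.continuous_arr.comp continuous_snd)).prodMk
          (continuous_snd.comp (continuous_subtype_val.comp continuous_fst))).continuousOn
      · exact fun q hq => composable_of_r hfp hq
  · intro q hq
    exact (a_p_pullH_inv hfp hq).trans q.1.2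

include hfp in
theorem continuousOn_meanAverage (hm : a.semidirect.IsContinuousMean m) (hf₀ : Continuous f₀)
    {T : Type*} [TopologicalSpace T] {x : T → G.Obj} {F : T → E.Pull c → ℝ}
    (hF : ContinuousOn (fun q : T × E.Pull c => F q.1 q.2) {q | E.a.p q.2.z = x q.1}) :
    ContinuousOn (fun q : T × E.Pull c => meanAverage E c a f₀ m φ (F q.1) q.2)
      {q | E.a.p q.2.z = x q.1} := by
  rw [continuousOn_iff_continuous_domRestrict]
  refine continuous_integral_fiber (K := a.semidirect)
    (μ := fun y => (m y : Measure (a.semidirect.Fiber y))) (fun y => inferInstance) hm.2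
    (P := {q : T × E.Pull c | E.a.p q.2.z = x q.1}) (u := fun p => a.unit (f₀ p.1.2.y))
    (F := fun p g => φ g * F p.1.1 ((E.pullH c).actT (H.inv (a.arr g)) p.1.2))
    (a.continuous_unit.comp <| hf₀.comp (Bispace.Pull.continuous_y.comp
      (continuous_snd.comp continuous_subtype_val))) ?_ ?_
  · exact (φ.continuous.comp continuous_snd).continuousOn.mul (continuousOn_pullH_inv hfp hF)
  · refine fun p₀ => ⟨tsupport φ, φ.hasCompactSupport, Eventually.of_forall fun p g _ hg => ?_⟩
    exact subset_tsupport _ (left_ne_zero_of_mul hg)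

include hfp in
theorem continuous_fiber_pullH_inv (w : E.Pull c) {F : E.Pull c → ℝ}
    (hF : ContinuousOn F {w' | E.a.p w'.z = E.a.p w.z}) :
    Continuous fun g : a.semidirect.Fiber (a.unit (f₀ w.y)) =>
      F ((E.pullH c).actT (H.inv (a.arr g.1)) w) := by
  have h1 : ContinuousOn (fun q : PUnit.{1} × E.Pull c => F q.2) {q | E.a.p q.2.z = E.a.p w.z} :=
    hF.comp continuous_snd.continuousOn fun q hq => hq
  have h2 := continuousOn_pullH_inv (a := a) hfp (x := fun _ => E.a.p w.z) (F := fun _ => F) h1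
  have h3 : Continuous fun g : a.semidirect.Fiber (a.unit (f₀ w.y)) =>
      (((⟨(PUnit.unit, w), rfl⟩ : {q : PUnit.{1} × E.Pull c | E.a.p q.2.z = E.a.p w.z}), g.1) :
        {q : PUnit.{1} × E.Pull c | E.a.p q.2.z = E.a.p w.z} × a.semidirect.Arrow) :=
    continuous_const.prodMk continuous_subtype_val
  exact h2.comp_continuous h3 fun g => g.2

include hfp in
theorem integrable_meanAverage (w : E.Pull c) {F : E.Pull c → ℝ}
    (hF : ContinuousOn F {w' | E.a.p w'.z = E.a.p w.z}) :
    Integrable (fun g => φ g.1 * F ((E.pullH c).actT (H.inv (a.arr g.1)) w))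
      (m (a.unit (f₀ w.y)) : Measure (a.semidirect.Fiber (a.unit (f₀ w.y)))) := by
  have h := continuous_fiber_pullH_inv hfp w hF
  exact ((a.semidirect.restrictFiber φ _).continuous.mul h).integrable_of_hasCompactSupport
    ((a.semidirect.restrictFiber φ _).hasCompactSupport.mul_right)

include hfp in
theorem meanAverage_add (w : E.Pull c) {F₁ F₂ F : E.Pull c → ℝ}
    (h₁ : ContinuousOn F₁ {w' | E.a.p w'.z = E.a.p w.z})
    (h₂ : ContinuousOn F₂ {w' | E.a.p w'.z = E.a.p w.z})
    (h : ∀ w', E.a.p w'.z = E.a.p w.z → F w' = F₁ w' + F₂ w') :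
    meanAverage E c a f₀ m φ F w =
      meanAverage E c a f₀ m φ F₁ w + meanAverage E c a f₀ m φ F₂ w := by
  rw [meanAverage, meanAverage, meanAverage,
    ← integral_add (integrable_meanAverage hfp w h₁) (integrable_meanAverage hfp w h₂)]
  congr 1
  ext g
  rw [h _ (a_p_pullH_inv hfp g.2), mul_add]

theorem meanAverage_smul (r : ℝ) (F : E.Pull c → ℝ) (w : E.Pull c) :
    meanAverage E c a f₀ m φ (fun w => r * F w) w = r * meanAverage E c a f₀ m φ F w := by
  rw [meanAverage, meanAverage, ← integral_const_mul]
  congr 1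
  ext g
  ring

theorem meanAverage_nonneg (hφ : ∀ g, 0 ≤ φ g) {F : E.Pull c → ℝ} (hF : ∀ w, 0 ≤ F w)
    (w : E.Pull c) : 0 ≤ meanAverage E c a f₀ m φ F w :=
  integral_nonneg fun _ => mul_nonneg (hφ _) (hF _)

theorem abs_meanAverage_le (hφ : ∀ g, 0 ≤ φ g) (hφ' : ∀ g, φ g ≤ 1) {F : E.Pull c → ℝ} {C : ℝ}
    (hF : ∀ w, |F w| ≤ C) (w : E.Pull c) : |meanAverage E c a f₀ m φ F w| ≤ C := by
  have h := norm_integral_le_of_norm_le_const (C := C)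
    (f := fun g => φ g.1 * F ((E.pullH c).actT (H.inv (a.arr g.1)) w))
    (μ := (m (a.unit (f₀ w.y)) : Measure (a.semidirect.Fiber (a.unit (f₀ w.y)))))
    (ae_of_all _ fun g => by
      rw [norm_mul, Real.norm_eq_abs, Real.norm_eq_abs, abs_of_nonneg (hφ _)]
      exact (mul_le_of_le_one_left (abs_nonneg _) (hφ' _)).trans (hF _))
  simpa [meanAverage] using h

include hfp in
theorem meanAverage_congr (w : E.Pull c) {F₁ F₂ : E.Pull c → ℝ}
    (h : ∀ g, a.semidirect.r g = a.unit (f₀ w.y) → φ g ≠ 0 →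
      F₁ ((E.pullH c).actT (H.inv (a.arr g)) w) = F₂ ((E.pullH c).actT (H.inv (a.arr g)) w)) :
    meanAverage E c a f₀ m φ F₁ w = meanAverage E c a f₀ m φ F₂ w := by
  rw [meanAverage, meanAverage]
  congr 1
  ext g
  by_cases hg : φ g.1 = 0
  · simp [hg]
  · rw [h g.1 g.2 hg]

include hfp in
/-- The average over `H`-orbits commutes with the action of `G`. -/
theorem meanAverage_translate {g : G.Arrow} {w : E.Pull c} (hg : G.s g = E.a.p w.z)
    {F F' : E.Pull c → ℝ}
    (h : ∀ w', G.s g = E.a.p w'.z → F' w' = F ((E.pullG c).actT g w')) :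
    meanAverage E c a f₀ m φ F' w = meanAverage E c a f₀ m φ F ((E.pullG c).actT g w) := by
  have hy : ((E.pullG c).actT g w).y = w.y := Bispace.pullG_y hg
  have key : ∀ k, a.semidirect.r k = a.unit (f₀ w.y) →
      F' ((E.pullH c).actT (H.inv (a.arr k)) w) =
        F ((E.pullH c).actT (H.inv (a.arr k)) ((E.pullG c).actT g w)) := by
    intro k hk
    have e := composable_of_r hfp hk
    have hp := a_p_pullH_inv hfp hk
    have e' : H.s (H.inv (a.arr k)) = c.p ((E.pullG c).actT g w).y := by rw [hy, e]
    rw [h _ (hg.trans hp.symm)]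
    congr 1
    ext
    · rw [Bispace.pullG_z (hg.trans hp.symm), Bispace.pullH_z e, Bispace.pullH_z e',
        Bispace.pullG_z hg, E.comm _ _ _ hg (e.trans w.p_eq.symm)]
    · rw [Bispace.pullG_y (hg.trans hp.symm), Bispace.pullH_y e, Bispace.pullH_y e', hy]
  have h2 : ∀ y, y = w.y → meanAverage E c a f₀ m φ F' w =
      ∫ k, φ k.1 * F ((E.pullH c).actT (H.inv (a.arr k.1)) ((E.pullG c).actT g w))
        ∂(m (a.unit (f₀ y)) : Measure (a.semidirect.Fiber (a.unit (f₀ y)))) := by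
    rintro _ rfl
    rw [meanAverage]
    congr 1
    ext k
    rw [key k.1 k.2]
  exact h2 _ hy

include hfp in
/-- If the mean `m` is almost invariant under the arrow relating two points of the same `H`-orbit,
then averages at these two points almost coincide. -/
theorem abs_meanAverage_sub_le (hφ' : ∀ g, φ g ≤ 1) {ε : ℝ}
    {w₁ w₂ : E.Pull c} (ho : E.Orb c w₁ w₂) {κ : a.semidirect.Arrow} (hκ : a.pt κ = f₀ w₁.y)
    (hκ' : a.arr κ = E.db w₁.z w₂.z)
    (hact : ∀ h y, H.s h = c.p y → f₀ (c.actT h y) = a.actT h (f₀ y))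
    (hl : l1Dist ((m (a.semidirect.s κ) : Measure (a.semidirect.Fiber (a.semidirect.s κ))).map
      (a.semidirect.translate κ))
      (m (a.semidirect.r κ) : Measure (a.semidirect.Fiber (a.semidirect.r κ))) ≤ ε)
    (h₁ : 1 - ε ≤
      ∫ g, φ g.1 ∂(m (a.unit (f₀ w₁.y)) : Measure (a.semidirect.Fiber (a.unit (f₀ w₁.y)))))
    (h₂ : 1 - ε ≤
      ∫ g, φ g.1 ∂(m (a.unit (f₀ w₂.y)) : Measure (a.semidirect.Fiber (a.unit (f₀ w₂.y)))))
    {F : E.Pull c → ℝ} (hF : ContinuousOn F {w' | E.a.p w'.z = E.a.p w₁.z})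
    (hF1 : ∀ w, |F w| ≤ 1) :
    |meanAverage E c a f₀ m φ F w₁ - meanAverage E c a f₀ m φ F w₂| ≤ 3 * ε := by
  set A : E.Pull c → ℝ := fun w => ∫ g, F ((E.pullH c).actT (H.inv (a.arr g.1)) w)
    ∂(m (a.unit (f₀ w.y)) : Measure (a.semidirect.Fiber (a.unit (f₀ w.y)))) with hA
  have trunc : ∀ w : E.Pull c, E.a.p w.z = E.a.p w₁.z →
      1 - ε ≤ ∫ g, φ g.1 ∂(m (a.unit (f₀ w.y)) : Measure (a.semidirect.Fiber (a.unit (f₀ w.y)))) →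
      |meanAverage E c a f₀ m φ F w - A w| ≤ ε := by
    intro w hw h
    have hFw : ContinuousOn F {w' | E.a.p w'.z = E.a.p w.z} := by rwa [hw]
    have hc := continuous_fiber_pullH_inv hfp w hFw
    have hi1 := integrable_meanAverage (m := m) (φ := φ) hfp w hFw
    have hi2 : Integrable (fun g => F ((E.pullH c).actT (H.inv (a.arr g.1)) w))
        (m (a.unit (f₀ w.y)) : Measure (a.semidirect.Fiber (a.unit (f₀ w.y)))) :=
      Integrable.of_bound hc.measurable.aestronglyMeasurable 1 (ae_of_all _ fun g => hF1 _)
    have hi3 : Integrable (fun g => φ g.1)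
        (m (a.unit (f₀ w.y)) : Measure (a.semidirect.Fiber (a.unit (f₀ w.y)))) :=
      (a.semidirect.restrictFiber φ _).continuous.integrable_of_hasCompactSupport
        (a.semidirect.restrictFiber φ _).hasCompactSupport
    rw [meanAverage, hA, ← integral_sub hi1 hi2]
    refine abs_integral_le_integral_abs.trans ?_
    have h3 : ∫ g, (1 - φ g.1)
        ∂(m (a.unit (f₀ w.y)) : Measure (a.semidirect.Fiber (a.unit (f₀ w.y)))) ≤ ε := by
      rw [integral_sub (integrable_const _) hi3]
      simp only [integral_const, probReal_univ, smul_eq_mul, mul_one]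
      linarith
    refine (integral_mono (hi1.sub hi2).abs ((integrable_const 1).sub hi3) fun g => ?_).trans h3
    change |φ g.1 * F _ - F _| ≤ 1 - φ g.1
    rw [← sub_one_mul, abs_mul, abs_of_nonpos (by linarith [hφ' g.1]), neg_sub]
    exact mul_le_of_le_one_right (by linarith [hφ' g.1]) (hF1 _)
  have hdb := ho.s_db
  have hinv : (E.pullH c).actT (H.inv (a.arr κ)) w₁ = w₂ := by
    have h := (E.pullH c).inv_actT_actT (y := w₂) hdb
    rw [ho.2] at h
    rw [hκ', h]
  have hr : a.semidirect.r κ = a.unit (f₀ w₁.y) := congrArg a.unit hκ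
  have hs1 := composable_of_r hfp hr
  have hs : a.semidirect.s κ = a.unit (f₀ w₂.y) := by
    rw [a.semidirect_s, hκ, ← hact _ _ hs1, ← Bispace.pullH_y hs1, hinv]
  have hA1 : ∀ y, y = a.unit (f₀ w₁.y) → A w₁ = ∫ g, F ((E.pullH c).actT (H.inv (a.arr g.1)) w₁)
      ∂(m y : Measure (a.semidirect.Fiber y)) := by rintro _ rfl; rfl
  have hA2 : ∀ y, y = a.unit (f₀ w₂.y) → A w₂ = ∫ g, F ((E.pullH c).actT (H.inv (a.arr g.1)) w₂)
      ∂(m y : Measure (a.semidirect.Fiber y)) := by rintro _ rfl; rfl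
  have hΨ : ContinuousOn (fun g => F ((E.pullH c).actT (H.inv (a.arr g)) w₁))
      {g | a.semidirect.r g = a.semidirect.r κ} := by
    rw [hr, continuousOn_iff_continuous_domRestrict]
    exact continuous_fiber_pullH_inv hfp w₁ hF
  have htr := abs_integral_translate_sub_le m κ hΨ (C := 1) (fun g => hF1 _)
  rw [← hA1 _ hr, one_mul] at htr
  have hA2' : A w₂ = ∫ g, F ((E.pullH c).actT (H.inv (a.arr (a.semidirect.mulT κ g.1))) w₁)
      ∂(m (a.semidirect.s κ) : Measure (a.semidirect.Fiber (a.semidirect.s κ))) := by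
    rw [hA2 _ hs]
    congr 1
    ext g
    have w : a.semidirect.s κ = a.semidirect.r g.1 := g.2.symm
    have w' : H.s (a.arr κ) = H.r (a.arr g.1) := a.comp_w κ g.1 w
    have w2 : H.s (H.inv (a.arr g.1)) = H.r (H.inv (a.arr κ)) := by
      rw [H.s_inv, H.r_inv, w']
    rw [a.arr_mulT w, mulT_eq w', H.inv_mul_rev _ _ w', ← mulT_eq w2,
      (E.pullH c).mul_actT hs1 w2, hinv]
  rw [← hA2'] at htr
  have t1 := abs_le.mp (trunc w₁ rfl h₁)
  have t2 := abs_le.mp (trunc w₂ ho.1.symm h₂)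
  have t3 := abs_le.mp (htr.trans hl)
  rw [abs_le]
  constructor <;> linarith [t1.1, t1.2, t2.1, t2.2, t3.1, t3.2]

end MeanAverage

end Transport

/-! ### Means on a semi-direct product from operators -/

section FiberExt

variable {X : Type u} [TopologicalSpace X] [T2Space X] [LocallyCompactSpace X] (a : G.LeftAction X)

namespace LeftAction

open Classical in
/-- The fibre of `X ⋊ G` over `ξ` is the fibre of `G` over `p ξ`; this extends a function on the
former by zero to all of `G`. -/
noncomputable def fiberExt (ξ : X) (f : a.semidirect.Fiber (a.unit ξ) → ℝ) (g : G.Arrow) : ℝ :=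
  if h : a.p ξ = G.r g then f ⟨a.semiMk ξ g h, rfl⟩ else 0

/-- The unit of `X ⋊ G` at `ξ`, as a point of the fibre over `ξ`. -/
def unitPt (ξ : X) : a.semidirect.Fiber (a.unit ξ) :=
  ⟨a.semidirect.e (a.unit ξ), a.semidirect.r_e _⟩

variable {a}

theorem fiberExt_eq {ξ : X} (f : a.semidirect.Fiber (a.unit ξ) → ℝ) {g : G.Arrow}
    (h : a.p ξ = G.r g) : a.fiberExt ξ f g = f ⟨a.semiMk ξ g h, rfl⟩ := dif_pos h

theorem continuousOn_fiberExt_param {F : X → a.semidirect.Arrow → ℝ}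
    (hF : Continuous fun q : X × a.semidirect.Arrow => F q.1 q.2) :
    ContinuousOn (fun q : X × G.Arrow => a.fiberExt q.1 (fun k => F q.1 k.1) q.2)
      {q | G.r q.2 = a.p q.1} := by
  rw [continuousOn_iff_continuous_domRestrict]
  have h1 : Continuous fun q : {q : X × G.Arrow | G.r q.2 = a.p q.1} =>
      (q.1.1, a.semiMk q.1.1 q.1.2 (Eq.symm q.2)) := by
    refine (continuous_fst.comp continuous_subtype_val).prodMk ?_
    rw [a.isClosedEmbedding_pt_arr.isInducing.continuous_iff]
    exact continuous_subtype_val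
  refine (hF.comp h1).congr fun q => ?_
  exact (fiberExt_eq (fun k => F q.1.1 k.1) (Eq.symm q.2)).symm

theorem continuousOn_fiberExt {ξ : X} {f : a.semidirect.Fiber (a.unit ξ) → ℝ} (hf : Continuous f) :
    ContinuousOn (a.fiberExt ξ f) {g | G.r g = a.p ξ} := by
  rw [continuousOn_iff_continuous_domRestrict]
  have h1 : Continuous fun g : {g : G.Arrow | G.r g = a.p ξ} =>
      (⟨a.semiMk ξ g.1 (Eq.symm g.2), rfl⟩ : a.semidirect.Fiber (a.unit ξ)) := by
    refine (a.semidirect.isClosedEmbedding_fiber _).isInducing.continuous_iff.mpr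
      (a.isClosedEmbedding_pt_arr.isInducing.continuous_iff.mpr ?_)
    exact continuous_const.prodMk continuous_subtype_val
  exact (hf.comp h1).congr fun g => (fiberExt_eq f (Eq.symm g.2)).symm

theorem fiberExt_add {ξ : X} (f₁ f₂ : a.semidirect.Fiber (a.unit ξ) → ℝ) :
    a.fiberExt ξ (fun q => f₁ q + f₂ q) = fun g => a.fiberExt ξ f₁ g + a.fiberExt ξ f₂ g := by
  ext g
  by_cases h : a.p ξ = G.r g <;> simp [fiberExt, h]

theorem fiberExt_smul {ξ : X} (r : ℝ) (f : a.semidirect.Fiber (a.unit ξ) → ℝ) :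
    a.fiberExt ξ (fun q => r * f q) = fun g => r * a.fiberExt ξ f g := by
  ext g
  by_cases h : a.p ξ = G.r g <;> simp [fiberExt, h]

end LeftAction

open LeftAction

/-- A positive operator from functions on `G` to functions on `X` of norm at most one, whose value
at `ξ` only depends on the restriction of the function to a compact subset of the fibre over `p ξ`,
gives a continuous mean of `X ⋊ G`: the missing mass is put on the units. -/
theorem exists_isContinuousMean_of_operator {M : (G.Arrow → ℝ) → X → ℝ} {C : Set G.Arrow}
    (hC : IsCompact C)
    (hcongr : ∀ f₁ f₂ ξ, (∀ g ∈ C, G.r g = a.p ξ → f₁ g = f₂ g) → M f₁ ξ = M f₂ ξ)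
    (hadd : ∀ f₁ f₂ ξ, ContinuousOn f₁ {g | G.r g = a.p ξ} → ContinuousOn f₂ {g | G.r g = a.p ξ} →
      M (fun g => f₁ g + f₂ g) ξ = M f₁ ξ + M f₂ ξ)
    (hsmul : ∀ (r : ℝ) f ξ, M (fun g => r * f g) ξ = r * M f ξ)
    (hnonneg : ∀ f ξ, (∀ g, 0 ≤ f g) → 0 ≤ M f ξ) (hone : ∀ ξ, M (fun _ => 1) ξ ≤ 1)
    (hcont : ∀ F : X → G.Arrow → ℝ,
      ContinuousOn (fun q : X × G.Arrow => F q.1 q.2) {q | G.r q.2 = a.p q.1} →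
      Continuous fun ξ => M (F ξ) ξ) :
    ∃ μ : (ξ : a.semidirect.Obj) → ProbabilityMeasure (a.semidirect.Fiber ξ),
      a.semidirect.IsContinuousMean μ ∧ ∀ (ξ : X) (f : C_c(a.semidirect.Fiber (a.unit ξ), ℝ)),
        ∫ q, f q ∂(μ (a.unit ξ) : Measure (a.semidirect.Fiber (a.unit ξ))) =
          M (a.fiberExt ξ f) ξ + (1 - M (fun _ => 1) ξ) * f (a.unitPt ξ) := by
  let Λ : (ξ : X) → C_c(a.semidirect.Fiber (a.unit ξ), ℝ) →ₗ[ℝ] ℝ := fun ξ =>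
    { toFun := fun f => M (a.fiberExt ξ f) ξ + (1 - M (fun _ => 1) ξ) * f (a.unitPt ξ)
      map_add' := fun f₁ f₂ => by
        have h1 : a.fiberExt ξ (f₁ + f₂ : C_c(a.semidirect.Fiber (a.unit ξ), ℝ)) =
          fun g => a.fiberExt ξ f₁ g + a.fiberExt ξ f₂ g := fiberExt_add f₁ f₂
        rw [h1, hadd (a.fiberExt ξ f₁) (a.fiberExt ξ f₂) ξ
          (continuousOn_fiberExt (map_continuous f₁))
          (continuousOn_fiberExt (map_continuous f₂)), CompactlySupportedContinuousMap.add_apply]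
        ring
      map_smul' := fun r f => by
        have h1 : a.fiberExt ξ (r • f : C_c(a.semidirect.Fiber (a.unit ξ), ℝ)) =
          fun g => r * a.fiberExt ξ f g := fiberExt_smul r f
        rw [h1, hsmul, CompactlySupportedContinuousMap.smul_apply, smul_eq_mul, RingHom.id_apply,
          smul_eq_mul]
        ring }
  let S : (ξ : X) → Set (a.semidirect.Fiber (a.unit ξ)) := fun ξ =>
    (fun q : a.semidirect.Fiber (a.unit ξ) => (a.pt q.1, a.arr q.1)) ⁻¹' ({ξ} ×ˢ C) ∪ {a.unitPt ξ}
  have hS : ∀ ξ, IsCompact (S ξ) := fun ξ =>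
    ((a.isClosedEmbedding_pt_arr.comp (a.semidirect.isClosedEmbedding_fiber (a.unit ξ))
      ).isCompact_preimage (isCompact_singleton.prod hC)).union isCompact_singleton
  have hSC : ∀ ξ g (h : a.p ξ = G.r g), g ∈ C →
      (⟨a.semiMk ξ g h, rfl⟩ : a.semidirect.Fiber (a.unit ξ)) ∈ S ξ := fun ξ g h hg =>
    Or.inl ⟨rfl, hg⟩
  have hpos : ∀ ξ (f : C_c(a.semidirect.Fiber (a.unit ξ), ℝ)), (∀ q ∈ S ξ, 0 ≤ f q) →
      0 ≤ Λ ξ f := by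
    intro ξ f hf
    refine add_nonneg ?_ (mul_nonneg (sub_nonneg.mpr (hone ξ)) (hf _ (Or.inr rfl)))
    rw [hcongr (a.fiberExt ξ f) (fun g => max (a.fiberExt ξ f g) 0) ξ ?_]
    · exact hnonneg _ _ fun g => le_max_right _ _
    · intro g hg hr
      rw [fiberExt_eq _ hr.symm, max_eq_left (hf _ (hSC ξ g hr.symm hg))]
  choose μ hreg hfin hmem hint using fun ξ =>
    exists_regular_measure_of_functional (Λ ξ) (hS ξ) (hpos ξ)
  have hprob : ∀ ξ, IsProbabilityMeasure (μ ξ) := by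
    intro ξ
    obtain ⟨χ, hχ1, -, -, -⟩ := (hS ξ).exists_cutoff isOpen_univ (subset_univ _)
    have h1 : ∫ q, χ q ∂(μ ξ) = ∫ q, (1 : ℝ) ∂(μ ξ) :=
      integral_congr_ae ((hmem ξ).mono fun b hb => hχ1 b hb)
    have h2 : Λ ξ χ = 1 := by
      change M (a.fiberExt ξ χ) ξ + (1 - M (fun _ => 1) ξ) * χ (a.unitPt ξ) = 1
      rw [hχ1 _ (Or.inr rfl), hcongr (a.fiberExt ξ χ) (fun _ => 1) ξ ?_]
      · ring
      · intro g hg hr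
        rw [fiberExt_eq _ hr.symm, hχ1 _ (hSC ξ g hr.symm hg)]
    rw [hint, h2, integral_const, smul_eq_mul, mul_one] at h1
    refine ⟨?_⟩
    rw [← ENNReal.ofReal_toReal (measure_ne_top (μ ξ) univ), ← measureReal_def, ← h1,
      ENNReal.ofReal_one]
  refine ⟨fun ξ => ⟨μ ξ, hprob ξ⟩, ⟨hreg, fun f => ?_⟩, fun ξ f => hint ξ f⟩
  have h1 : ∀ ξ : X, ∫ g : a.semidirect.Fiber (a.unit ξ), f g.1 ∂(μ ξ) =
      M (a.fiberExt ξ fun q => f q.1) ξ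
        + (1 - M (fun _ => 1) ξ) * f (a.semidirect.e (a.unit ξ)) := fun ξ =>
    hint ξ (a.semidirect.restrictFiber f (a.unit ξ))
  have h2 : Continuous fun ξ : X => M (a.fiberExt ξ fun q => f q.1) ξ
        + (1 - M (fun _ => 1) ξ) * f (a.semidirect.e (a.unit ξ)) := by
    refine (hcont (fun ξ => a.fiberExt ξ fun q => f q.1)
      (continuousOn_fiberExt_param (F := fun _ q => f q) (f.continuous.comp continuous_snd))).add ?_
    exact (continuous_const.sub (hcont (fun _ _ => 1) continuousOn_const)).mul
      (f.continuous.comp (a.semidirect.continuous_e.comp a.continuous_unit))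
  exact h2.congr fun ξ => (h1 ξ).symm

end FiberExt

/-! ### Transfer of amenability -/

section Transfer

variable {Z : Type u} [TopologicalSpace Z] [T2Space Z] [LocallyCompactSpace Z]
  [MeasurableSpace Z] [BorelSpace Z]
  {Y' : Type u} [TopologicalSpace Y'] [T2Space Y'] [LocallyCompactSpace Y']
  {Y : Type u} [TopologicalSpace Y] [T2Space Y] [LocallyCompactSpace Y]
  {X : Type u} [TopologicalSpace X] [T2Space X] [LocallyCompactSpace X]

namespace Bispace

/-- Over compact subsets of `Y`, there are continuous families of probability measures on the
fibres of `Z → H⁽⁰⁾`, which are the `G`-orbits. -/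
def HasFiberKernels (E : Bispace G H Z) (c : H.LeftAction Y') : Prop :=
  ∀ L : Set Y', IsCompact L → ∃ (S : Set Z) (ρ : Y' → Measure Z),
    IsKernel (fun y => {z | E.b.p z = c.p y}) S ρ ∧ ∀ y ∈ L, ρ y univ = 1

/-- Over compact subsets of `X`, there are continuous families of probability measures on the fibres
of `Z *_{H⁽⁰⁾} Y → G⁽⁰⁾`, each carried by a single `H`-orbit which depends equivariantly on the
point of `X`. -/
def HasOrbitKernels (E : Bispace G H Z) (c : H.LeftAction Y') (b : G.LeftAction X) : Prop :=
  ∀ L : Set X, IsCompact L → ∃ (S : Set (E.Pull c)) (ν : X → Measure (E.Pull c))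
    (O : X → Set (E.Pull c)),
    IsKernel (fun ξ => {w | E.a.p w.z = b.p ξ}) S ν ∧ (∀ ξ ∈ L, ν ξ univ = 1) ∧
    (∀ ξ, ∀ᵐ w ∂(ν ξ), w ∈ O ξ) ∧ (∀ ξ, ∀ w ∈ O ξ, ∀ w' ∈ O ξ, E.Orb c w w') ∧
    ∀ g ξ, G.s g = b.p ξ → ∀ w ∈ O ξ, E.a.p w.z = b.p ξ →
      (E.pullG c).actT g w ∈ O (b.actT g ξ)

end Bispace

variable (E : Bispace G H Z) (c : H.LeftAction Y') (a : H.LeftAction Y) (b : G.LeftAction X)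

/-- The composite of the three families of measures: integrate against `ν`, average over `H`-orbits
with `m`, and identify `G`-orbits, weighted by `ρ`, with fibres of `G`. -/
noncomputable def transferOperator (f₀ : Y' → Y)
    (m : (y : a.semidirect.Obj) → ProbabilityMeasure (a.semidirect.Fiber y))
    (φ : a.semidirect.Arrow → ℝ) (ρ : Y' → Measure Z) (f : G.Arrow → ℝ) (w : E.Pull c) : ℝ :=
  meanAverage E c a f₀ m φ (orbitIntegral E c ρ f) w

variable {E c a b}

/-- Let `Y` be an amenable `H`-space and let `X` be a `G`-space which is related to an `H`-space
`Y'` over `Y` by continuous families of probability measures. Then `X` is amenable. The constant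
`16 * ε` adds up errors of `3 * ε` for each of the two integrals and of `ε` for the mass on each
unit, doubled when the distance is tested on functions with values in `[0, 1]`. -/
theorem isAmenable_of_kernels {f₀ : Y' → Y} (hf₀ : Continuous f₀) (hfp : ∀ y, a.p (f₀ y) = c.p y)
    (hact : ∀ h y, H.s h = c.p y → f₀ (c.actT h y) = a.actT h (f₀ y))
    (hfib : E.HasFiberKernels c) (horb : E.HasOrbitKernels c b) (ha : a.IsAmenable) :
    b.IsAmenable := by
  refine isAmenable_iff.mpr fun L hL ε₀ hε₀ => ?_
  obtain ⟨ε, hε, hε16⟩ : ∃ ε : ℝ, 0 < ε ∧ 16 * ε ≤ ε₀ := ⟨ε₀ / 16, by positivity, by linarith⟩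
  -- The family `ν`, normalised on the ranges and the sources of the arrows in `L`.
  have hLX : IsCompact (b.pt '' L ∪ (fun q => b.actT (G.inv (b.arr q)) (b.pt q)) '' L) := by
    refine (hL.image b.continuous_pt).union (hL.image ?_)
    exact b.semidirect.continuous_s.congr fun q => b.semidirect_s q
  obtain ⟨S₁, ν, O, hν, hν1, hνO, hO, hOact⟩ := horb _ hLX
  -- A compact set containing the carriers of all measures to be compared.
  have hS₂ : IsCompact (S₁ ∪ {w | ∃ g ∈ b.arr '' L, ∃ w' ∈ S₁, G.s g = (E.pullG c).p w' ∧
      (E.pullG c).actT g w' = w}) :=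
    hν.isCompact.union ((E.pullG c).isCompact_image_actT (hL.image b.continuous_arr) hν.isCompact)
  set S₂ := S₁ ∪ {w | ∃ g ∈ b.arr '' L, ∃ w' ∈ S₁, G.s g = (E.pullG c).p w' ∧
      (E.pullG c).actT g w' = w} with hS₂def
  have hN : IsCompact ((fun q : E.Pull c × E.Pull c => E.db q.1.z q.2.z) ''
      ({q | E.a.p q.1.z = E.a.p q.2.z} ∩ S₂ ×ˢ S₂)) := by
    refine ((hS₂.prod hS₂).inter_left ?_).image_of_continuousOn ?_
    · exact isClosed_eq (E.a.continuous_p.comp (Bispace.Pull.continuous_z.comp continuous_fst))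
        (E.a.continuous_p.comp (Bispace.Pull.continuous_z.comp continuous_snd))
    · exact (E.continuousOn_db.comp (f := fun q : E.Pull c × E.Pull c => (q.1.z, q.2.z))
        ((Bispace.Pull.continuous_z.comp continuous_fst).prodMk
          (Bispace.Pull.continuous_z.comp continuous_snd)).continuousOn (fun q hq => hq)).mono
        inter_subset_left
  have hQ : IsCompact ((fun w : E.Pull c => a.unit (f₀ w.y)) '' S₂) :=
    hS₂.image (a.continuous_unit.comp (hf₀.comp Bispace.Pull.continuous_y))
  -- The mean `m` of `Y ⋊ H`, the cutoff `φ` and the family `ρ`.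
  obtain ⟨m, hm, hml⟩ := isAmenable_iff.mp ha _
    (a.isClosedEmbedding_pt_arr.isCompact_preimage (hQ.prod hN)) ε hε
  obtain ⟨φ, hφ0, hφ1, hφm⟩ := hm.exists_cutoff hQ hε
  have hNφ : IsCompact (H.inv '' (a.arr '' tsupport φ)) :=
    (φ.hasCompactSupport.isCompact.image a.continuous_arr).image H.continuous_inv
  have hS₃ := (E.pullH c).isCompact_image_actT hNφ hν.isCompact
  set S₃ := {w | ∃ h ∈ H.inv '' (a.arr '' tsupport φ), ∃ w' ∈ S₁, H.s h = (E.pullH c).p w' ∧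
      (E.pullH c).actT h w' = w} with hS₃def
  have hS₃mem : ∀ w ∈ S₁, ∀ g, a.semidirect.r g = a.unit (f₀ w.y) → φ g ≠ 0 →
      (E.pullH c).actT (H.inv (a.arr g)) w ∈ S₃ := fun w hw g hg hφg =>
    ⟨_, ⟨_, ⟨g, subset_tsupport _ hφg, rfl⟩, rfl⟩, w, hw, composable_of_r hfp hg, rfl⟩
  obtain ⟨S, ρ, hρ, hρ1⟩ := hfib _ (hS₃.image Bispace.Pull.continuous_y)
  -- The compact set of arrows of `G` which matter.
  have hC : IsCompact ((fun q : E.Pull c × Z => E.da q.1.z q.2) ''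
      ({q | E.b.p q.1.z = E.b.p q.2} ∩ S₃ ×ˢ S)) := by
    refine ((hS₃.prod hρ.isCompact).inter_left ?_).image_of_continuousOn ?_
    · exact isClosed_eq (E.b.continuous_p.comp (Bispace.Pull.continuous_z.comp continuous_fst))
        (E.b.continuous_p.comp continuous_snd)
    · exact (E.continuousOn_da.comp (f := fun q : E.Pull c × Z => (q.1.z, q.2))
        ((Bispace.Pull.continuous_z.comp continuous_fst).prodMk continuous_snd).continuousOn
        (fun q hq => hq)).mono inter_subset_left
  set Θ : (G.Arrow → ℝ) → E.Pull c → ℝ := transferOperator E c a f₀ m φ ρ with hΘ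
  have hΘcont : ∀ {T : Type u} [TopologicalSpace T] {x : T → G.Obj} {F : T → G.Arrow → ℝ},
      ContinuousOn (fun q : T × G.Arrow => F q.1 q.2) {q | G.r q.2 = x q.1} →
      ContinuousOn (fun q : T × E.Pull c => Θ (F q.1) q.2) {q | E.a.p q.2.z = x q.1} :=
    fun hF => continuousOn_meanAverage (F := fun t => orbitIntegral E c ρ _) hfp hm hf₀
      (continuousOn_orbitIntegral hρ hF)
  have hTcont1 : ∀ {x : G.Obj} {f : G.Arrow → ℝ}, ContinuousOn f {g | G.r g = x} →
      ContinuousOn (orbitIntegral E c ρ f) {w | E.a.p w.z = x} := fun {x f} hf =>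
    (continuousOn_orbitIntegral (T := PUnit.{1}) (x := fun _ => x) (F := fun _ => f) hρ
      (hf.comp continuous_snd.continuousOn fun q hq => hq)).comp
      (continuous_const.prodMk continuous_id : Continuous fun w : E.Pull c => (PUnit.unit, w)
        ).continuousOn fun w hw => hw
  have hΘcont1 : ∀ {x : G.Obj} {f : G.Arrow → ℝ}, ContinuousOn f {g | G.r g = x} →
      ContinuousOn (Θ f) {w | E.a.p w.z = x} := fun {x f} hf =>
    (hΘcont (T := PUnit) (x := fun _ => x) (F := fun _ => f)
      (hf.comp continuous_snd.continuousOn fun q hq => hq)).comp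
      (continuous_const.prodMk continuous_id : Continuous fun w : E.Pull c => (PUnit.unit, w)
        ).continuousOn fun w hw => hw
  have hΘadd : ∀ f₁ f₂ (w : E.Pull c), ContinuousOn f₁ {g | G.r g = E.a.p w.z} →
      ContinuousOn f₂ {g | G.r g = E.a.p w.z} → Θ (fun g => f₁ g + f₂ g) w = Θ f₁ w + Θ f₂ w := by
    intro f₁ f₂ w h₁ h₂
    exact meanAverage_add hfp w (hTcont1 h₁) (hTcont1 h₂) fun w' hw' =>
      orbitIntegral_add hρ w' (by rwa [hw']) (by rwa [hw'])
  have hΘsmul : ∀ (r : ℝ) f w, Θ (fun g => r * f g) w = r * Θ f w := by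
    intro r f w
    rw [hΘ, transferOperator, funext (orbitIntegral_smul (E := E) (c := c) (ρ := ρ) r f)]
    exact meanAverage_smul r _ w
  have hΘabs : ∀ f w, (∀ g, |f g| ≤ 1) → |Θ f w| ≤ 1 := fun f w hf =>
    abs_meanAverage_le hφ0 hφ1 (abs_orbitIntegral_le hρ zero_le_one hf) w
  have hΘnonneg : ∀ f w, (∀ g, 0 ≤ f g) → 0 ≤ Θ f w := fun f w hf =>
    meanAverage_nonneg hφ0 (orbitIntegral_nonneg hf) w
  have hΘcongr : ∀ f₁ f₂, ∀ w ∈ S₁, (∀ g ∈ (fun q : E.Pull c × Z => E.da q.1.z q.2) ''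
      ({q | E.b.p q.1.z = E.b.p q.2} ∩ S₃ ×ˢ S), G.r g = E.a.p w.z → f₁ g = f₂ g) →
      Θ f₁ w = Θ f₂ w := by
    intro f₁ f₂ w hw h
    refine meanAverage_congr hfp w fun g hg hφg => orbitIntegral_congr hρ _ fun z' hz' hb => ?_
    refine h _ ⟨(_, z'), ⟨hb, hS₃mem w hw g hg hφg, hz'⟩, rfl⟩ ?_
    rw [E.r_da hb, a_p_pullH_inv hfp hg]
  have hΘone : ∀ w ∈ S₁, 1 - ε ≤ Θ (fun _ => 1) w := by
    intro w hw
    have h1 : Θ (fun _ => 1) w = meanAverage E c a f₀ m φ (fun _ => 1) w := by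
      refine meanAverage_congr hfp w fun g hg hφg => ?_
      have h2 := hρ1 _ ⟨_, hS₃mem w hw g hg hφg, rfl⟩
      rw [orbitIntegral, integral_const, measureReal_def, h2]
      simp
    rw [h1, meanAverage]
    simp only [mul_one]
    exact hφm _ ⟨w, Or.inl hw, rfl⟩
  have hΘosc : ∀ f, (∀ g, |f g| ≤ 1) → ∀ w₁ ∈ S₂, ∀ w₂ ∈ S₂, E.Orb c w₁ w₂ →
      ContinuousOn f {g | G.r g = E.a.p w₁.z} → |Θ f w₁ - Θ f w₂| ≤ 3 * ε := by
    intro f hf w₁ hw₁ w₂ hw₂ ho hfc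
    have hk : a.p (f₀ w₁.y) = H.r (E.db w₁.z w₂.z) := by
      rw [hfp, ← w₁.p_eq, E.r_db ho.1]
    refine abs_meanAverage_sub_le hfp hφ1 ho (κ := a.semiMk _ _ hk) rfl rfl hact ?_ ?_ ?_
      (hTcont1 hfc) (abs_orbitIntegral_le hρ zero_le_one hf)
    · exact hml _ ⟨⟨w₁, hw₁, rfl⟩, ⟨(w₁, w₂), ⟨ho.1, hw₁, hw₂⟩, rfl⟩⟩
    · exact hφm _ ⟨w₁, hw₁, rfl⟩
    · exact hφm _ ⟨w₂, hw₂, rfl⟩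
  have hM1 : ∀ ξ, ∫ w, Θ (fun _ => 1) w ∂(ν ξ) ≤ 1 := fun ξ =>
    (le_abs_self _).trans (hν.abs_integral_le ξ zero_le_one fun w _ _ => hΘabs _ w (by simp))
  have hM1' : ∀ ξ, ν ξ univ = 1 → 1 - ε ≤ ∫ w, Θ (fun _ => 1) w ∂(ν ξ) := by
    intro ξ hξ
    have : IsProbabilityMeasure (ν ξ) := ⟨hξ⟩
    have h1 : ∫ w, (1 - ε) ∂(ν ξ) = 1 - ε := by simp
    rw [← h1]
    exact integral_mono_ae (integrable_const _)
      (hν.integrable ξ (hΘcont1 (f := fun _ => (1 : ℝ)) continuousOn_const))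
      ((hν.mem ξ).mono fun w hw => hΘone w hw.1)
  obtain ⟨μ, hμ, hμint⟩ := exists_isContinuousMean_of_operator (a := b)
    (M := fun f ξ => ∫ w, Θ f w ∂(ν ξ)) hC
    (fun f₁ f₂ ξ h => integral_congr_ae ((hν.mem ξ).mono fun w hw =>
      hΘcongr f₁ f₂ w hw.1 fun g hg hr => h g hg (hr.trans hw.2)))
    (fun f₁ f₂ ξ h₁ h₂ => by
      rw [← integral_add (hν.integrable ξ (hΘcont1 h₁)) (hν.integrable ξ (hΘcont1 h₂))]
      refine integral_congr_ae ((hν.mem ξ).mono fun w hw => ?_)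
      have hw' : E.a.p w.z = b.p ξ := hw.2
      exact hΘadd f₁ f₂ w (by rwa [hw']) (by rwa [hw']))
    (fun r f ξ => by
      simp only [hΘsmul]
      exact integral_const_mul _ _)
    (fun f ξ hf => integral_nonneg fun w => hΘnonneg f w hf) hM1
    (fun F hF => hν.continuous_integral (F := fun ξ w => Θ (F ξ) w) continuous_id (hΘcont hF))
  refine ⟨μ, hμ, fun γ hγ => ?_⟩
  -- Almost invariance, tested on a function `f` on the fibre.
  have hreg1 : (μ (b.semidirect.s γ) : Measure (b.semidirect.Fiber (b.semidirect.s γ))).Regular :=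
    hμ.1 _
  have hreg2 : (μ (b.semidirect.r γ) : Measure (b.semidirect.Fiber (b.semidirect.r γ))).Regular :=
    hμ.1 _
  have hreg3 : ((μ (b.semidirect.s γ) : Measure (b.semidirect.Fiber (b.semidirect.s γ))).map
      (b.semidirect.translate γ)).Regular :=
    Measure.Regular.map (translateHomeomorph γ)
  refine (l1Dist_le_of_forall_compactlySupported _ _ (ε := 8 * ε) fun f hf0 hf1 => ?_).trans
    (by linarith)
  set g : G.Arrow := b.arr γ with hg
  set ξ : X := b.pt γ with hξ
  set ξ' : X := b.semidirect.s γ with hξ'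
  have hξ'' : ξ' = b.actT (G.inv g) ξ := b.semidirect_s γ
  have hrg : G.r g = b.p ξ := (b.p_pt γ).symm
  have hsg : G.s g = b.p ξ' := by rw [hξ'', b.p_actT ((G.s_inv g).trans hrg), G.r_inv]
  have hgξ : b.actT g ξ' = ξ := by rw [hξ'', b.actT_inv_actT hrg]
  have hξ1 : ν ξ univ = 1 := hν1 _ (Or.inl ⟨γ, hγ, rfl⟩)
  have hξ1' : ν ξ' univ = 1 := hν1 _ (Or.inr ⟨γ, hγ, hξ''.symm⟩)
  -- The function `f`, and its translate, as functions on `G`.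
  let f' : C_c(b.semidirect.Fiber (b.unit ξ'), ℝ) :=
    ⟨⟨fun q => f (b.semidirect.translate γ q),
      f.continuous.comp (continuous_translate γ)⟩,
      f.hasCompactSupport.comp_homeomorph (translateHomeomorph γ)⟩
  have e1 : ∫ q, f q ∂((μ (b.semidirect.s γ) :
      Measure (b.semidirect.Fiber (b.semidirect.s γ))).map (b.semidirect.translate γ)) =
      ∫ w, Θ (b.fiberExt ξ' f') w ∂(ν ξ') +
        (1 - ∫ w, Θ (fun _ => 1) w ∂(ν ξ')) * f' (b.unitPt ξ') := by
    rw [← hμint ξ' f']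
    exact integral_map (continuous_translate γ).measurable.aemeasurable
      f.continuous.aestronglyMeasurable
  have e2 : ∫ q, f q ∂(μ (b.semidirect.r γ) : Measure (b.semidirect.Fiber (b.semidirect.r γ))) =
      ∫ w, Θ (b.fiberExt ξ f) w ∂(ν ξ) +
        (1 - ∫ w, Θ (fun _ => 1) w ∂(ν ξ)) * f (b.unitPt ξ) := hμint ξ f
  have hfabs : ∀ k, |b.fiberExt ξ f k| ≤ 1 := by
    intro k
    by_cases h : b.p ξ = G.r k
    · rw [show b.fiberExt ξ f k = f ⟨b.semiMk ξ k h, rfl⟩ from dif_pos h]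
      exact abs_le.mpr ⟨by linarith [hf0 ⟨b.semiMk ξ k h, rfl⟩], hf1 _⟩
    · rw [show b.fiberExt ξ f k = 0 from dif_neg h]
      simp
  have hfc : ContinuousOn (b.fiberExt ξ f) {k | G.r k = b.p ξ} :=
    LeftAction.continuousOn_fiberExt (map_continuous f)
  have htr : ∀ k, G.s g = G.r k → b.fiberExt ξ' f' k = b.fiberExt ξ f (G.mulT g k) := by
    intro k hk
    refine (LeftAction.fiberExt_eq (ξ := ξ') f' (hsg.symm.trans hk)).trans (Eq.trans ?_
      (LeftAction.fiberExt_eq (ξ := ξ) f (hrg.symm.trans (r_mulT hk).symm)).symm)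
    refine congrArg f (Subtype.ext ?_)
    refine b.isClosedEmbedding_pt_arr.injective (Prod.ext rfl ?_)
    exact (mulT_eq hk).symm
  have hΘtr : ∀ w : E.Pull c, E.a.p w.z = b.p ξ' →
      Θ (b.fiberExt ξ' f') w = Θ (b.fiberExt ξ f) ((E.pullG c).actT g w) := fun w hw =>
    meanAverage_translate hfp (hsg.trans hw.symm) fun w' hw' => orbitIntegral_translate hρ hw' htr
  -- Both integrals are close to the value of `Θ f` at one point `w₀` of the orbit of `ξ`.
  have hprob : IsProbabilityMeasure (ν ξ) := ⟨hξ1⟩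
  have hprob' : IsProbabilityMeasure (ν ξ') := ⟨hξ1'⟩
  obtain ⟨w₀, hw₀, hw₀O⟩ := ((hν.mem ξ).and (hνO ξ)).exists
  have hw₀p : E.a.p w₀.z = b.p ξ := hw₀.2
  have d2 : |∫ w, Θ (b.fiberExt ξ f) w ∂(ν ξ) - Θ (b.fiberExt ξ f) w₀| ≤ 3 * ε := by
    refine abs_integral_sub_le_of_isProbabilityMeasure hξ1
      (hν.integrable ξ (hΘcont1 hfc)).aestronglyMeasurable ?_
    filter_upwards [hν.mem ξ, hνO ξ] with w hw hwO
    have hwp : E.a.p w.z = b.p ξ := hw.2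
    exact hΘosc _ hfabs w (Or.inl hw.1) w₀ (Or.inl hw₀.1) (hO ξ w hwO w₀ hw₀O) (by rwa [hwp])
  have d1 : |∫ w, Θ (b.fiberExt ξ' f') w ∂(ν ξ') - Θ (b.fiberExt ξ f) w₀| ≤ 3 * ε := by
    refine abs_integral_sub_le_of_isProbabilityMeasure hξ1'
      (hν.integrable ξ' (hΘcont1 (LeftAction.continuousOn_fiberExt (map_continuous f')))
        ).aestronglyMeasurable ?_
    filter_upwards [hν.mem ξ', hνO ξ'] with w hw hwO
    have hwp : E.a.p w.z = b.p ξ' := hw.2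
    have hsw : G.s g = E.a.p w.z := hsg.trans hwp.symm
    have hgO := hOact g ξ' hsg w hwO hwp
    rw [hgξ] at hgO
    rw [hΘtr w hwp]
    refine hΘosc _ hfabs _ (Or.inr ⟨g, ⟨γ, hγ, rfl⟩, w, hw.1, hsw, rfl⟩) w₀ (Or.inl hw₀.1)
      (hO ξ _ hgO w₀ hw₀O) ?_
    rwa [show E.a.p ((E.pullG c).actT g w).z = b.p ξ from
      ((E.pullG c).p_actT hsw).trans hrg]
  have u1 := hM1 ξ
  have u1' := hM1 ξ'
  have u2 := hM1' ξ hξ1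
  have u2' := hM1' ξ' hξ1'
  have v1 := abs_le.mp d1
  have v2 := abs_le.mp d2
  have x0 := hf0 (b.unitPt ξ)
  have x1 := hf1 (b.unitPt ξ)
  have y0 : 0 ≤ f' (b.unitPt ξ') := hf0 _
  have y1 : f' (b.unitPt ξ') ≤ 1 := hf1 _
  have a1 : 0 ≤ (1 - ∫ w, Θ (fun _ => 1) w ∂(ν ξ)) * f (b.unitPt ξ) :=
    mul_nonneg (by linarith) x0
  have a2 : (1 - ∫ w, Θ (fun _ => 1) w ∂(ν ξ)) * f (b.unitPt ξ) ≤ ε :=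
    (mul_le_of_le_one_right (by linarith) x1).trans (by linarith)
  have a1' : 0 ≤ (1 - ∫ w, Θ (fun _ => 1) w ∂(ν ξ')) * f' (b.unitPt ξ') :=
    mul_nonneg (by linarith) y0
  have a2' : (1 - ∫ w, Θ (fun _ => 1) w ∂(ν ξ')) * f' (b.unitPt ξ') ≤ ε :=
    (mul_le_of_le_one_right (by linarith) y1).trans (by linarith)
  rw [e1, e2]
  refine abs_le.mpr ⟨?_, ?_⟩ <;> linarith

end Transfer

end LCGroupoid

/-! ### Positive functionals on the fibres of a map -/

/-- The tube lemma for an inequality which only has to hold along a closed relation. -/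
theorem IsCompact.eventually_forall_lt_of_closed_relation {P W : Type*} [TopologicalSpace P]
    [TopologicalSpace W] {K : Set W} (hK : IsCompact K) {R : Set (P × W)} (hR : IsClosed R)
    {Ψ : P × W → ℝ} (hΨ : ContinuousOn Ψ R) {p₀ : P} {ε : ℝ}
    (h : ∀ w ∈ K, (p₀, w) ∈ R → Ψ (p₀, w) < ε) :
    ∀ᶠ p in 𝓝 p₀, ∀ w ∈ K, (p, w) ∈ R → Ψ (p, w) < ε := by
  refine hK.eventually_forall_of_forall_eventually fun w hw => ?_
  by_cases hR' : (p₀, w) ∈ R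
  · exact eventually_nhdsWithin_iff.mp ((hΨ _ hR').eventually (gt_mem_nhds (h w hw hR')))
  · exact mem_of_superset (hR.isOpen_compl.mem_nhds hR') fun q hq hq' => (hq hq').elim

section FiberFunctional

variable {X₀ W : Type*} [TopologicalSpace W]

/-- `d.2` is a linear functional on `C_c(W)`, non-negative on the functions which are non-negative
on the part of `A` in the fibre of `q` over `d.1`. -/
structure IsFiberFunctional (q : W → X₀) (A : Set W) (d : X₀ × (C_c(W, ℝ) → ℝ)) : Prop where
  add : ∀ F F', d.2 (F + F') = d.2 F + d.2 F'
  smul : ∀ (r : ℝ) F, d.2 (r • F) = r * d.2 F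
  nonneg : ∀ F : C_c(W, ℝ), (∀ w ∈ A, q w = d.1 → 0 ≤ F w) → 0 ≤ d.2 F

namespace IsFiberFunctional

variable {q : W → X₀} {A : Set W} {d : X₀ × (C_c(W, ℝ) → ℝ)} (hd : IsFiberFunctional q A d)

include hd

theorem sub (F F' : C_c(W, ℝ)) : d.2 (F - F') = d.2 F - d.2 F' := by
  have h : F - F' = F + (-1 : ℝ) • F' := by
    ext w
    simp [sub_eq_add_neg]
  rw [h, hd.add, hd.smul]
  ring

theorem mono {F F' : C_c(W, ℝ)} (h : ∀ w ∈ A, q w = d.1 → F w ≤ F' w) : d.2 F ≤ d.2 F' := by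
  have := hd.nonneg (F' - F) fun w hw hx => by simpa using h w hw hx
  rw [hd.sub] at this
  linarith

theorem congr {F F' : C_c(W, ℝ)} (h : ∀ w ∈ A, q w = d.1 → F w = F' w) : d.2 F = d.2 F' :=
  le_antisymm (hd.mono fun w hw hx => (h w hw hx).le) (hd.mono fun w hw hx => (h w hw hx).ge)

end IsFiberFunctional

open Classical in
/-- The value of a functional on a function `f` whose restriction to the fibre extends to an element
of `C_c(W)`, and zero for other `f`. -/
noncomputable def fiberEval (q : W → X₀) (d : X₀ × (C_c(W, ℝ) → ℝ)) (f : W → ℝ) : ℝ :=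
  if h : ∃ F : C_c(W, ℝ), ∀ w, q w = d.1 → F w = f w then d.2 h.choose else 0

theorem fiberEval_eq {q : W → X₀} {A : Set W} {d : X₀ × (C_c(W, ℝ) → ℝ)}
    (hd : IsFiberFunctional q A d) {f : W → ℝ} {F : C_c(W, ℝ)} (h : ∀ w, q w = d.1 → F w = f w) :
    fiberEval q d f = d.2 F := by
  have h' : ∃ F : C_c(W, ℝ), ∀ w, q w = d.1 → F w = f w := ⟨F, h⟩
  rw [fiberEval, dif_pos h']
  exact hd.congr fun w _ hx => (h'.choose_spec w hx).trans (h w hx).symm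

variable [TopologicalSpace X₀] [T2Space X₀] [T2Space W] [LocallyCompactSpace W]

/-- Lower bounds for functionals, by values of a function which depends continuously on a parameter
over the base, are preserved under limits. -/
theorem isClosed_setOf_lower_bound {q : W → X₀} (hq : Continuous q) {A : Set W}
    {T : Type*} [TopologicalSpace T] {t : T → X₀} (ht : Continuous t) (hto : IsOpenMap t)
    {T₀ : Set T} (hT₀ : IsOpen T₀) {Φ : T → W → ℝ}
    (hΦ : ContinuousOn (fun p : T × W => Φ p.1 p.2) {p | q p.2 = t p.1})
    (hloc : ∀ τ₀, ∃ K, IsCompact K ∧ ∀ᶠ τ in 𝓝 τ₀, ∀ w ∈ A, q w = t τ → 0 < Φ τ w → w ∈ K)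
    (hA : IsClosed A) (m : ℝ) :
    IsClosed {d : X₀ × (C_c(W, ℝ) → ℝ) | ((∀ F F', d.2 (F + F') = d.2 F + d.2 F') ∧
      ∀ (r : ℝ) F, d.2 (r • F) = r * d.2 F) ∧ ∀ τ ∈ T₀, t τ = d.1 → ∀ F : C_c(W, ℝ),
        (∀ w ∈ A, q w = t τ → Φ τ w ≤ F w) → m ≤ d.2 F} := by
  have hev : ∀ F : C_c(W, ℝ), Continuous fun d : X₀ × (C_c(W, ℝ) → ℝ) => d.2 F := fun F =>
    (continuous_apply F).comp continuous_snd
  have hlin : IsClosed {d : X₀ × (C_c(W, ℝ) → ℝ) | (∀ F F', d.2 (F + F') = d.2 F + d.2 F') ∧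
      ∀ (r : ℝ) F, d.2 (r • F) = r * d.2 F} := by
    simp only [ofPred_and, ofPred_forall]
    refine IsClosed.inter (isClosed_iInter fun F => isClosed_iInter fun F' => ?_)
      (isClosed_iInter fun r => isClosed_iInter fun F => ?_)
    · exact isClosed_eq (hev _) ((hev F).add (hev F'))
    · exact isClosed_eq (hev _) (continuous_const.mul (hev F))
  refine isClosed_of_closure_subset fun d hd => ?_
  have hdl := closure_minimal (fun d hd => hd.1) hlin hd
  refine ⟨hdl, fun τ₀ hτ₀ hτd F hF => ?_⟩
  obtain ⟨K, hK, hKτ⟩ := hloc τ₀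
  have hK' : IsCompact (K ∪ tsupport F) := hK.union F.hasCompactSupport
  obtain ⟨χ, hχ1, -, hχ0, -⟩ := hK'.exists_cutoff isOpen_univ (subset_univ _)
  refine le_of_forall_pos_le_add fun δ hδ => ?_
  obtain ⟨ε, hε, hεδ⟩ : ∃ ε > 0, ε * d.2 χ ≤ δ := by
    refine ⟨δ / (|d.2 χ| + 1), by positivity, ?_⟩
    rw [div_mul_eq_mul_div, div_le_iff₀ (by positivity)]
    have := le_abs_self (d.2 χ)
    nlinarith
  have hR : IsClosed {p : T × W | q p.2 = t p.1 ∧ p.2 ∈ A} :=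
    (isClosed_eq (hq.comp continuous_snd) (ht.comp continuous_fst)).inter
      (hA.preimage continuous_snd)
  have hV := hK'.eventually_forall_lt_of_closed_relation hR
    (Ψ := fun p => Φ p.1 p.2 - F p.2) (p₀ := τ₀) (ε := ε)
    ((hΦ.mono fun p hp => hp.1).sub (F.continuous.comp continuous_snd).continuousOn)
    (fun w _ hw => by
      have := hF w hw.2 hw.1
      linarith)
  have hτ : ∀ᶠ τ in 𝓝 τ₀, ∀ w ∈ A, q w = t τ → Φ τ w ≤ (F + ε • χ) w := by
    filter_upwards [hV, hKτ] with τ h1 h2 w hwA hw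
    rw [CompactlySupportedContinuousMap.add_apply, CompactlySupportedContinuousMap.smul_apply,
      smul_eq_mul]
    by_cases hwK : w ∈ K ∪ tsupport F
    · have := h1 w hwK ⟨hw, hwA⟩
      rw [hχ1 w hwK]
      linarith
    · have h3 : Φ τ w ≤ 0 := by
        by_contra h
        exact hwK (Or.inl (h2 w hwA hw (not_le.mp h)))
      have h4 : F w = 0 := image_eq_zero_of_notMem_tsupport fun h => hwK (Or.inr h)
      rw [h4, zero_add]
      exact h3.trans (mul_nonneg hε.le (hχ0 w))
  obtain ⟨V, hVs, hVo, hV₀⟩ := mem_nhds_iff.mp hτ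
  have hN : (t '' (V ∩ T₀)) ×ˢ (univ : Set (C_c(W, ℝ) → ℝ)) ∈ 𝓝 d :=
    ((hto _ (hVo.inter hT₀)).prod isOpen_univ).mem_nhds ⟨⟨τ₀, ⟨hV₀, hτ₀⟩, hτd⟩, trivial⟩
  have hm : m ≤ d.2 (F + ε • χ) := by
    by_contra h
    have hN' := inter_mem hN (((hev (F + ε • χ)).isOpen_preimage _ isOpen_Iio).mem_nhds
      (show d.2 (F + ε • χ) ∈ Iio m from not_le.mp h))
    obtain ⟨d', ⟨⟨⟨τ, ⟨hτV, hτT⟩, hτd'⟩, -⟩, hd'm⟩, hd'⟩ := mem_closure_iff_nhds.mp hd _ hN'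
    exact not_le.mpr hd'm (hd'.2 τ hτT hτd' _ (hVs hτV))
  rw [hdl.1, hdl.2] at hm
  linarith

/-- Continuity of the value of a functional on a function, jointly in both. The function only has to
be defined and continuous along the fibres. -/
theorem continuous_fiberEval {q : W → X₀} (hq : Continuous q) {A : Set W} {P : Type*}
    [TopologicalSpace P] {d : P → X₀ × (C_c(W, ℝ) → ℝ)} (hd : Continuous d)
    (hdf : ∀ p, IsFiberFunctional q A (d p)) {f : P → W → ℝ}
    (hf : ContinuousOn (fun p : P × W => f p.1 p.2) {p | q p.2 = (d p.1).1})
    (hloc : ∀ p₀, ∃ K, IsCompact K ∧ ∀ᶠ p in 𝓝 p₀, ∀ w, q w = (d p).1 → f p w ≠ 0 → w ∈ K) :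
    Continuous fun p => fiberEval q (d p) (f p) := by
  have hR : IsClosed {p : P × W | q p.2 = (d p.1).1} :=
    isClosed_eq (hq.comp continuous_snd) (continuous_fst.comp (hd.comp continuous_fst))
  have hex : ∀ p, ∃ F : C_c(W, ℝ), ∀ w, q w = (d p).1 → F w = f p w := by
    intro p
    obtain ⟨K, hK, hKp⟩ := hloc p
    have hT : IsClosed {w | q w = (d p).1} := isClosed_eq hq continuous_const
    obtain ⟨F, hF⟩ := hT.exists_compactlySupported_eqOn (f := f p)
      (hf.comp (continuous_const.prodMk continuous_id).continuousOn fun w hw => hw) hK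
      (fun w hw => hKp.self_of_nhds w hw)
    exact ⟨F, fun w hw => hF hw⟩
  have hev : ∀ F : C_c(W, ℝ), Continuous fun p => (d p).2 F := fun F =>
    (continuous_apply F).comp (continuous_snd.comp hd)
  rw [continuous_iff_continuousAt]
  intro p₀
  obtain ⟨F, hF⟩ := hex p₀
  obtain ⟨K, hK, hKp⟩ := hloc p₀
  have hK' : IsCompact (K ∪ tsupport F) := hK.union F.hasCompactSupport
  obtain ⟨χ, hχ1, -, hχ0, -⟩ := hK'.exists_cutoff isOpen_univ (subset_univ _)
  rw [ContinuousAt, fiberEval_eq (hdf p₀) hF, Metric.tendsto_nhds]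
  intro δ hδ
  set ε : ℝ := δ / 2 / (|(d p₀).2 χ| + 1) with hεdef
  have hε : 0 < ε := by positivity
  have hεδ : ε * (|(d p₀).2 χ| + 1) = δ / 2 := div_mul_cancel₀ _ (by positivity)
  have hV := hK'.eventually_forall_lt_of_closed_relation hR
    (Ψ := fun p => |f p.1 p.2 - F p.2|) (p₀ := p₀) (ε := ε)
    (hf.sub (F.continuous.comp continuous_snd).continuousOn).abs
    (fun w _ hw => by
      simp only
      rw [hF w hw, sub_self, abs_zero]
      exact hε)
  have hχn : ∀ᶠ p in 𝓝 p₀, (d p).2 χ < |(d p₀).2 χ| + 1 :=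
    (hev χ).continuousAt.eventually (gt_mem_nhds ((le_abs_self _).trans_lt (lt_add_one _)))
  have hFn : ∀ᶠ p in 𝓝 p₀, |(d p).2 F - (d p₀).2 F| < δ / 2 := by
    have := Metric.tendsto_nhds.mp ((hev F).continuousAt (x := p₀)) (δ / 2) (half_pos hδ)
    simpa only [Real.dist_eq] using this
  filter_upwards [hV, hKp, hχn, hFn] with p h1 h2 h3 h4
  obtain ⟨F', hF'⟩ := hex p
  rw [fiberEval_eq (hdf p) hF', Real.dist_eq]
  have hle : ∀ w, q w = (d p).1 → |F' w - F w| ≤ ε * χ w := by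
    intro w hw
    rw [hF' w hw]
    by_cases hwK : w ∈ K ∪ tsupport F
    · rw [hχ1 w hwK, mul_one]
      exact (h1 w hwK hw).le
    · have e1 : f p w = 0 := by
        by_contra h
        exact hwK (Or.inl (h2 w hw h))
      have e2 : F w = 0 := image_eq_zero_of_notMem_tsupport fun h => hwK (Or.inr h)
      rw [e1, e2, sub_self, abs_zero]
      exact mul_nonneg hε.le (hχ0 w)
  have u1 : (d p).2 F' - (d p).2 F ≤ ε * (d p).2 χ := by
    rw [← (hdf p).sub, ← (hdf p).smul]
    refine (hdf p).mono fun w _ hw => ?_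
    simpa using (abs_le.mp (hle w hw)).2
  have u2 : -(ε * (d p).2 χ) ≤ (d p).2 F' - (d p).2 F := by
    rw [← (hdf p).sub, ← (hdf p).smul, ← neg_one_mul, ← (hdf p).smul]
    refine (hdf p).mono fun w _ hw => ?_
    have := (abs_le.mp (hle w hw)).1
    simpa using this
  have u3 : ε * (d p).2 χ ≤ δ / 2 := by
    rw [← hεδ]
    exact mul_le_mul_of_nonneg_left h3.le hε.le
  have h5 := abs_lt.mp h4
  exact abs_lt.mpr ⟨by linarith, by linarith⟩

end FiberFunctional

namespace LCGroupoid

variable {G H : LCGroupoid.{u}}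

/-! ### Delone functionals -/

namespace Bispace

variable {Z : Type u} [TopologicalSpace Z]
  {Y : Type u} [TopologicalSpace Y]

section Basic

variable {E : Bispace G H Z} {c : H.LeftAction Y}

theorem inv_db_mulT_db {z z' z'' : Z} (h : E.a.p z = E.a.p z') (h' : E.a.p z = E.a.p z'') :
    H.mulT (H.inv (E.db z z')) (E.db z z'') = E.db z' z'' := by
  have w : H.s (H.inv (E.db z z')) = H.r (E.db z z'') := by rw [H.s_inv, E.r_db h, E.r_db h']
  refine (E.db_eq ((s_mulT w).trans (E.s_db _ _ h')) ?_).symm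
  rw [E.b.mul_actT (E.s_db _ _ h') w, E.db_act _ _ h']
  have h1 := E.b.inv_actT_actT (g := E.db z z') (E.s_db _ _ h)
  rwa [E.db_act _ _ h] at h1

theorem inv_db_actT {z z' : Z} (h : E.a.p z = E.a.p z') : E.b.actT (H.inv (E.db z z')) z = z' := by
  have h1 := E.b.inv_actT_actT (g := E.db z z') (E.s_db _ _ h)
  rwa [E.db_act _ _ h] at h1

theorem continuousOn_comp_db (φ : C_c(H.Arrow, ℝ)) :
    ContinuousOn (fun p : Z × E.Pull c => φ (E.db p.1 p.2.z)) {p | E.a.p p.2.z = E.a.p p.1} :=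
  φ.continuous.comp_continuousOn <| E.continuousOn_db.comp
    (f := fun p : Z × E.Pull c => (p.1, p.2.z))
    (continuous_fst.prodMk (Pull.continuous_z.comp continuous_snd)).continuousOn
    fun _ hp => Eq.symm hp

theorem isCompact_pull (hc : IsProperMap c.p) {B : Set Z} (hB : IsCompact B) :
    IsCompact {w : E.Pull c | w.z ∈ B} := by
  have h1 : IsCompact (B ×ˢ (c.p ⁻¹' (E.b.p '' B))) :=
    hB.prod (hc.isCompact_preimage (hB.image E.b.continuous_p))
  have h2 : IsCompact {w : E.Pull c | (w.z, w.y) ∈ B ×ˢ (c.p ⁻¹' (E.b.p '' B))} :=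
    (E.isClosed_pull c).isClosedEmbedding_subtypeVal.isCompact_preimage h1
  convert h2 using 1
  ext w
  exact ⟨fun h => ⟨h, w.z, h, w.p_eq⟩, fun h => h.1⟩

theorem exists_isCompact_of_db_mem [T2Space Z] (hc : IsProperMap c.p) {B : Set Z} (hB : IsCompact B)
    {N : Set H.Arrow} (hN : IsCompact N) : ∃ K : Set (E.Pull c), IsCompact K ∧
      ∀ z ∈ B, ∀ w : E.Pull c, E.a.p w.z = E.a.p z → E.db z w.z ∈ N → w ∈ K := by
  refine ⟨_, isCompact_pull hc (E.b.isCompact_image_actT (hN.image H.continuous_inv) hB),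
    fun z hz w hw hN => ⟨_, ⟨_, hN, rfl⟩, z, hz, ?_, inv_db_actT hw.symm⟩⟩
  rw [H.s_inv, E.r_db hw.symm]

end Basic

variable (E : Bispace G H Z) (c : H.LeftAction Y)

/-- A functional on the fibre of `Z *_{H⁽⁰⁾} Y` over `d.1`, carried by the part of one `H`-orbit
which lies over `C`, which is locally bounded above at the scale `φ` (the mass of no translate of
`φ` exceeds `M`) and bounded below at the scale `ψ` (the mass of every translate of `ψ` based at a
point over the interior of `C` is at least one). A translate of `φ` or `ψ` is only meaningful along
one fibre, so the bounds are stated for the `F` in `C_c` which dominate a translate of `-φ` or of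
`ψ` there. The model is the counting measure of a Delone subset of the orbit. -/
structure IsDelone (C : Set H.Obj) (φ ψ : C_c(H.Arrow, ℝ)) (M : ℝ)
    (d : G.Obj × (C_c(E.Pull c, ℝ) → ℝ)) : Prop where
  isFiberFunctional : IsFiberFunctional (fun w : E.Pull c => E.a.p w.z) {w | E.b.p w.z ∈ C} d
  upper : ∀ z, E.a.p z = d.1 → ∀ F : C_c(E.Pull c, ℝ), (∀ w : E.Pull c, E.b.p w.z ∈ C →
    E.a.p w.z = E.a.p z → -φ (E.db z w.z) ≤ F w) → -M ≤ d.2 F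
  lower : ∀ z, E.b.p z ∈ interior C → E.a.p z = d.1 → ∀ F : C_c(E.Pull c, ℝ),
    (∀ w : E.Pull c, E.b.p w.z ∈ C → E.a.p w.z = E.a.p z → ψ (E.db z w.z) ≤ F w) → 1 ≤ d.2 F
  orb : ∀ F F' : C_c(E.Pull c, ℝ), (∀ w w', E.Orb c w w' → F w * F' w' = 0) → d.2 F * d.2 F' = 0

section Closed

variable [T2Space Z] [LocallyCompactSpace Z] [T2Space Y] [LocallyCompactSpace Y] {E c}
  {C : Set H.Obj} {φ ψ : C_c(H.Arrow, ℝ)} {M : ℝ}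

theorem isClosed_isDelone (hc : IsProperMap c.p) (hC : IsClosed C) (hφ : ∀ h, 0 ≤ φ h) :
    IsClosed {d | E.IsDelone c C φ ψ M d} := by
  have hq : Continuous fun w : E.Pull c => E.a.p w.z := E.a.continuous_p.comp Pull.continuous_z
  have hA : IsClosed {w : E.Pull c | E.b.p w.z ∈ C} :=
    hC.preimage (E.b.continuous_p.comp Pull.continuous_z)
  have h1 := isClosed_setOf_lower_bound hq (A := {w | E.b.p w.z ∈ C}) (T := G.Obj) (t := id)
    continuous_id IsOpenMap.id isOpen_univ (Φ := fun _ _ => 0) continuousOn_const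
    (fun _ => ⟨∅, isCompact_empty, by simp⟩) hA 0
  have h2 := isClosed_setOf_lower_bound hq (A := {w | E.b.p w.z ∈ C}) E.a.continuous_p E.isOpenMap_a
    isOpen_univ (Φ := fun z w => -φ (E.db z w.z)) (continuousOn_comp_db φ).neg
    (fun _ => ⟨∅, isCompact_empty, Eventually.of_forall fun z w _ _ h => by
      linarith [hφ (E.db z w.z)]⟩) hA (-M)
  have h3 := isClosed_setOf_lower_bound hq (A := {w | E.b.p w.z ∈ C}) E.a.continuous_p E.isOpenMap_a
    (isOpen_interior.preimage E.b.continuous_p : IsOpen (E.b.p ⁻¹' interior C))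
    (Φ := fun z w => ψ (E.db z w.z)) (continuousOn_comp_db ψ) (fun z₀ => by
      obtain ⟨B, hB, hB₀⟩ := exists_compact_mem_nhds z₀
      obtain ⟨K, hK, hKB⟩ := exists_isCompact_of_db_mem (E := E) hc hB ψ.hasCompactSupport
      refine ⟨K, hK, mem_of_superset hB₀ fun z hz w _ hw h => hKB z hz w hw ?_⟩
      exact subset_tsupport _ h.ne') hA 1
  have hev : ∀ F : C_c(E.Pull c, ℝ), Continuous fun d : G.Obj × (C_c(E.Pull c, ℝ) → ℝ) => d.2 F :=
    fun F => (continuous_apply F).comp continuous_snd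
  have h4 : IsClosed {d : G.Obj × (C_c(E.Pull c, ℝ) → ℝ) | ∀ F F' : C_c(E.Pull c, ℝ),
      (∀ w w', E.Orb c w w' → F w * F' w' = 0) → d.2 F * d.2 F' = 0} := by
    simp only [ofPred_forall]
    exact isClosed_iInter fun F => isClosed_iInter fun F' => isClosed_iInter fun _ =>
      isClosed_eq ((hev F).mul (hev F')) continuous_const
  convert ((h1.inter h2).inter h3).inter h4 using 1
  ext d
  constructor
  · intro (h : E.IsDelone c C φ ψ M d)
    have hl := And.intro h.isFiberFunctional.add h.isFiberFunctional.smul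
    refine ⟨⟨⟨⟨hl, fun x _ hx F hF => ?_⟩, ⟨hl, fun z _ => h.upper z⟩⟩, ⟨hl, h.lower⟩⟩, h.orb⟩
    obtain rfl : x = d.1 := hx
    exact h.isFiberFunctional.nonneg F hF
  · rintro ⟨⟨⟨h1, h2⟩, h3⟩, h4⟩
    exact ⟨⟨h1.1.1, h1.1.2, fun F hF => h1.2 d.1 trivial rfl F hF⟩,
      fun z => h2.2 z trivial, h3.2, h4⟩

/-- Functionals which are bounded at the scale `φ` are bounded on every element of `C_c`. -/
theorem exists_forall_abs_isDelone_le (hC : IsClosed C) (hφ : ∀ h, 0 ≤ φ h)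
    (hφ1 : ∀ x ∈ C, φ (H.e x) = 1) (hM : 0 ≤ M) (F : C_c(E.Pull c, ℝ)) :
    ∃ b : ℝ, ∀ d, E.IsDelone c C φ ψ M d → |d.2 F| ≤ b := by
  classical
  have hA : IsClosed {w : E.Pull c | E.b.p w.z ∈ C} :=
    hC.preimage (E.b.continuous_p.comp Pull.continuous_z)
  -- Near each point, there is a bump function to which the bound at the scale `φ` applies.
  have hloc : ∀ w₀ : E.Pull c, E.b.p w₀.z ∈ C → ∃ f : C_c(E.Pull c, ℝ), (∀ w, 0 ≤ f w) ∧
      (∀ᶠ w in 𝓝 w₀, f w = 1) ∧ ∀ d, E.IsDelone c C φ ψ M d → d.2 f ≤ 2 * M := by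
    intro w₀ hw₀
    have h0 : ContinuousOn (fun p : E.Pull c × E.Pull c => φ (E.db p.1.z p.2.z))
        {p | E.a.p p.1.z = E.a.p p.2.z} :=
      φ.continuous.comp_continuousOn (E.continuousOn_db.comp
        (f := fun p : E.Pull c × E.Pull c => (p.1.z, p.2.z))
        ((Pull.continuous_z.comp continuous_fst).prodMk
          (Pull.continuous_z.comp continuous_snd)).continuousOn fun p hp => hp)
    have h1 : ∀ᶠ p in 𝓝 (w₀, w₀), p ∈ {p : E.Pull c × E.Pull c | E.a.p p.1.z = E.a.p p.2.z} →
        1 / 2 < φ (E.db p.1.z p.2.z) := by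
      refine eventually_nhdsWithin_iff.mp ((h0 (w₀, w₀) rfl).eventually (lt_mem_nhds ?_))
      beta_reduce
      rw [E.db_self, hφ1 _ hw₀]
      norm_num
    rw [nhds_prod_eq] at h1
    obtain ⟨U, hU, hUφ⟩ := mem_prod_self_iff.mp h1
    obtain ⟨U', hU', hU'o, hwU'⟩ := mem_nhds_iff.mp hU
    obtain ⟨B, hBn, hBU, hB⟩ := local_compact_nhds (hU'o.mem_nhds hwU')
    obtain ⟨f, hf1, hfU, hf0, hfle⟩ := hB.exists_cutoff hU'o hBU
    refine ⟨f, hf0, mem_of_superset hBn hf1, fun d hd => ?_⟩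
    by_cases hne : ∃ w₁ : E.Pull c, E.a.p w₁.z = d.1 ∧ f w₁ ≠ 0
    · obtain ⟨w₁, hw₁, hfw₁⟩ := hne
      have h2 := hd.upper w₁.z hw₁ ((-(1 / 2) : ℝ) • f) fun w _ hw => by
        rw [CompactlySupportedContinuousMap.smul_apply, smul_eq_mul]
        by_cases hfw : f w = 0
        · rw [hfw, mul_zero]
          linarith [hφ (E.db w₁.z w.z)]
        · have h3 : 1 / 2 < φ (E.db w₁.z w.z) := hUφ (mk_mem_prod
            (hU' (not_imp_comm.mp (hfU w₁) hfw₁)) (hU' (not_imp_comm.mp (hfU w) hfw))) hw.symm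
          linarith [hfle w]
      rw [hd.isFiberFunctional.smul] at h2
      linarith
    · have h2 : d.2 f = d.2 0 := hd.isFiberFunctional.congr fun w _ hw => by
        by_contra h
        exact hne ⟨w, hw, h⟩
      have h3 := hd.isFiberFunctional.smul 0 f
      rw [zero_smul, zero_mul] at h3
      rw [h2, h3]
      linarith
  choose! f hf0 hf1 hfM using hloc
  have hK : IsCompact (tsupport F ∩ {w : E.Pull c | E.b.p w.z ∈ C}) :=
    F.hasCompactSupport.isCompact.inter_right hA
  obtain ⟨t, ht, htK⟩ := hK.elim_nhds_subcover (fun w₀ => {w | f w₀ w = 1})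
    fun w₀ hw₀ => hf1 w₀ hw₀.2
  obtain ⟨m, hm⟩ := F.hasCompactSupport.exists_bound_of_continuous F.continuous
  have hm0 : 0 ≤ max m 0 := le_max_right _ _
  refine ⟨max m 0 * (t.card * (2 * M)), fun d hd => ?_⟩
  have hsum : ∀ s : Finset (E.Pull c), d.2 (∑ w₀ ∈ s, f w₀) = ∑ w₀ ∈ s, d.2 (f w₀) := by
    intro s
    refine Finset.induction_on s ?_ fun w₀ s hw₀ ih => ?_
    · have h3 := hd.isFiberFunctional.smul 0 0
      rw [zero_smul, zero_mul] at h3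
      simpa using h3
    · rw [Finset.sum_insert hw₀, Finset.sum_insert hw₀, hd.isFiberFunctional.add, ih]
  have hle : ∀ w : E.Pull c, E.b.p w.z ∈ C → |F w| ≤ max m 0 * (∑ w₀ ∈ t, f w₀) w := by
    intro w hw
    rw [CompactlySupportedContinuousMap.coe_sum, Finset.sum_apply]
    by_cases hwF : w ∈ tsupport F
    · obtain ⟨w₀, hw₀t, hw₀⟩ := mem_iUnion₂.mp (htK ⟨hwF, hw⟩)
      have h1 : 1 ≤ ∑ w₀ ∈ t, f w₀ w := by
        rw [← show f w₀ w = 1 from hw₀]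
        exact Finset.single_le_sum (f := fun w₀ => f w₀ w) (fun i hi => hf0 i (ht i hi).2 w) hw₀t
      calc |F w| ≤ max m 0 * 1 := by
            rw [mul_one]; exact (hm w).trans (le_max_left _ _)
        _ ≤ _ := mul_le_mul_of_nonneg_left h1 hm0
    · rw [image_eq_zero_of_notMem_tsupport hwF, abs_zero]
      exact mul_nonneg hm0 (Finset.sum_nonneg fun i hi => hf0 i (ht i hi).2 w)
  have hub : d.2 (max m 0 • ∑ w₀ ∈ t, f w₀) ≤ max m 0 * (t.card * (2 * M)) := by
    rw [hd.isFiberFunctional.smul, hsum]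
    refine mul_le_mul_of_nonneg_left ?_ hm0
    rw [← nsmul_eq_mul]
    exact Finset.sum_le_card_nsmul _ _ _ fun i hi => hfM i (ht i hi).2 d hd
  refine abs_le.mpr ⟨?_, ?_⟩
  · have h1 : d.2 ((-1 : ℝ) • (max m 0 • ∑ w₀ ∈ t, f w₀)) ≤ d.2 F :=
      hd.isFiberFunctional.mono fun w hw _ => by
        have := (abs_le.mp (hle w hw)).1
        rw [CompactlySupportedContinuousMap.smul_apply, CompactlySupportedContinuousMap.smul_apply,
          smul_eq_mul, smul_eq_mul]
        linarith
    rw [hd.isFiberFunctional.smul] at h1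
    linarith
  · refine le_trans (hd.isFiberFunctional.mono fun w hw _ => ?_) hub
    rw [CompactlySupportedContinuousMap.smul_apply, smul_eq_mul]
    exact (abs_le.mp (hle w hw)).2

end Closed

/-! ### Delone subsets of orbits -/

section Separated

variable {E} {C : Set H.Obj} {φ : C_c(H.Arrow, ℝ)}

/-- The number of points of a set separated at the scale `φ` in translates of a compact set is
bounded. -/
theorem exists_encard_le_of_separated (hC : IsClosed C) (hφ1 : ∀ x ∈ C, φ (H.e x) = 1)
    {K : Set H.Arrow} (hK : IsCompact K) : ∃ n : ℕ, ∀ (x : G.Obj) (D : Set Z),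
      (∀ z ∈ D, E.a.p z = x ∧ E.b.p z ∈ C) →
      (∀ z ∈ D, ∀ z' ∈ D, 0 < φ (E.db z z') → z = z') →
      ∀ z, E.a.p z = x → {z' ∈ D | E.db z z' ∈ K}.encard ≤ n := by
  classical
  have hloc : ∀ h₀ ∈ K ∩ H.s ⁻¹' C, ∃ A ∈ 𝓝 h₀, ∀ g ∈ A, ∀ h ∈ A, H.r g = H.r h →
      0 < φ (H.mulT (H.inv g) h) := by
    intro h₀ hh₀
    have h0 : ContinuousOn (fun p : H.Arrow × H.Arrow => φ (H.mulT (H.inv p.1) p.2))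
        {p | H.r p.1 = H.r p.2} :=
      φ.continuous.comp_continuousOn (H.continuousOn_mulT.comp
        (f := fun p : H.Arrow × H.Arrow => (H.inv p.1, p.2))
        ((H.continuous_inv.comp continuous_fst).prodMk continuous_snd).continuousOn
        fun p hp => (H.s_inv _).trans hp)
    have h1 : ∀ᶠ p in 𝓝 (h₀, h₀), p ∈ {p : H.Arrow × H.Arrow | H.r p.1 = H.r p.2} →
        0 < φ (H.mulT (H.inv p.1) p.2) := by
      refine eventually_nhdsWithin_iff.mp ((h0 (h₀, h₀) rfl).eventually (lt_mem_nhds ?_))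
      beta_reduce
      rw [mulT_eq (H.s_inv _), H.inv_mul, hφ1 _ hh₀.2]
      exact one_pos
    rw [nhds_prod_eq] at h1
    obtain ⟨A, hA, hAφ⟩ := mem_prod_self_iff.mp h1
    exact ⟨A, hA, fun g hg h hh hr => hAφ (mk_mem_prod hg hh) hr⟩
  choose! A hA hAφ using hloc
  obtain ⟨t, ht, htK⟩ := (hK.inter_right (hC.preimage H.continuous_s)).elim_nhds_subcover A hA
  refine ⟨t.card, fun x D hD hsep z hz => ?_⟩
  have : Nonempty H.Arrow := ⟨H.e (E.b.p z)⟩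
  have hex : ∀ z' ∈ {z' ∈ D | E.db z z' ∈ K}, ∃ i ∈ t, E.db z z' ∈ A i := by
    intro z' hz'
    have h1 : E.db z z' ∈ K ∩ H.s ⁻¹' C := by
      refine ⟨hz'.2, ?_⟩
      rw [mem_preimage, E.s_db _ _ (hz.trans (hD z' hz'.1).1.symm)]
      exact (hD z' hz'.1).2
    simpa using htK h1
  choose! i hit hiA using hex
  rw [← encard_coe_eq_coe_finsetCard]
  refine encard_le_encard_of_injOn (f := i) (fun z' hz' => hit z' hz') fun z₁ h₁ z₂ h₂ he => ?_
  have e₁ := hz.trans (hD z₁ h₁.1).1.symm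
  have e₂ := hz.trans (hD z₂ h₂.1).1.symm
  refine hsep z₁ h₁.1 z₂ h₂.1 ?_
  rw [← inv_db_mulT_db e₁ e₂]
  refine hAφ _ (ht _ (hit z₁ h₁)) _ (hiA z₁ h₁) _ (by rw [he]; exact hiA z₂ h₂) ?_
  rw [E.r_db e₁, E.r_db e₂]

/-- Separated sets which are maximal, by Zorn's lemma: every point over `C` of the fibre over `x` is
close, at the scale `φ`, to a point of the set. -/
theorem exists_maximal_separated (C : Set H.Obj) (φ : C_c(H.Arrow, ℝ)) (x : G.Obj) :
    ∃ D : Set Z, (∀ z ∈ D, E.a.p z = x ∧ E.b.p z ∈ C) ∧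
      (∀ z ∈ D, ∀ z' ∈ D, 0 < φ (E.db z z') → z = z') ∧
      ∀ z, E.a.p z = x → E.b.p z ∈ C →
        ∃ z' ∈ D, z = z' ∨ 0 < φ (E.db z z') ∨ 0 < φ (E.db z' z) := by
  obtain ⟨D, hD⟩ := zorn_subset {D : Set Z | (∀ z ∈ D, E.a.p z = x ∧ E.b.p z ∈ C) ∧
      ∀ z ∈ D, ∀ z' ∈ D, 0 < φ (E.db z z') → z = z'} fun c hc hchain => by
    refine ⟨⋃₀ c, ⟨?_, ?_⟩, fun s hs => subset_sUnion_of_mem hs⟩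
    · rintro z ⟨s, hs, hz⟩
      exact (hc hs).1 z hz
    · rintro z ⟨s, hs, hz⟩ z' ⟨s', hs', hz'⟩ hφ
      obtain h | h := hchain.total hs hs'
      · exact (hc hs').2 z (h hz) z' hz' hφ
      · exact (hc hs).2 z hz z' (h hz') hφ
  refine ⟨D, hD.prop.1, hD.prop.2, fun z hz hzC => ?_⟩
  by_contra! hcon
  have hins : insert z D ∈ {D : Set Z | (∀ z ∈ D, E.a.p z = x ∧ E.b.p z ∈ C) ∧
      ∀ z ∈ D, ∀ z' ∈ D, 0 < φ (E.db z z') → z = z'} := by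
    refine ⟨?_, ?_⟩
    · rintro z' (rfl | hz')
      · exact ⟨hz, hzC⟩
      · exact hD.prop.1 z' hz'
    · rintro z₁ (rfl | h₁) z₂ (rfl | h₂) hφ
      · rfl
      · exact absurd hφ (not_lt.mpr (hcon z₂ h₂).2.1)
      · exact absurd hφ (not_lt.mpr (hcon z₁ h₁).2.2)
      · exact hD.prop.2 z₁ h₁ z₂ h₂ hφ
  exact (hcon z (hD.le_of_ge hins (subset_insert z D) (mem_insert z D))).1 rfl

end Separated

end Bispace

namespace Bispace

variable {Z : Type u} [TopologicalSpace Z] [T2Space Z] [LocallyCompactSpace Z]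
  {Y : Type u} [TopologicalSpace Y] [T2Space Y] [LocallyCompactSpace Y]
  {E : Bispace G H Z} {c : H.LeftAction Y}
  {C : Set H.Obj} {φ ψ : C_c(H.Arrow, ℝ)} {M : ℝ}

omit [T2Space Z] [LocallyCompactSpace Z] in
theorem inv_db {z z' : Z} (h : E.a.p z = E.a.p z') : H.inv (E.db z z') = E.db z' z :=
  (E.db_eq ((H.s_inv _).trans (E.r_db h)) (inv_db_actT h)).symm

omit [T2Space Z] [LocallyCompactSpace Z] [T2Space Y] [LocallyCompactSpace Y] in
/-- Counting measures of maximal separated subsets of orbits are Delone functionals. -/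
theorem exists_isDelone (E : Bispace G H Z) (c : H.LeftAction Y) (hC : IsClosed C)
    (hφ1 : ∀ x ∈ C, φ (H.e x) = 1) (hφle : ∀ h, φ h ≤ 1)
    (hψ0 : ∀ h, 0 ≤ ψ h) (hψ1 : ∀ h, φ h ≠ 0 ∨ φ (H.inv h) ≠ 0 → ψ h = 1) :
    ∃ M : ℝ, 0 ≤ M ∧ ∀ x, ∃ l, E.IsDelone c C φ ψ M (x, l) := by
  classical
  obtain ⟨n, hn⟩ := E.exists_encard_le_of_separated hC hφ1 φ.hasCompactSupport.isCompact
  refine ⟨n, n.cast_nonneg, fun x => ?_⟩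
  obtain ⟨D, hDx, hDs, hDm⟩ := E.exists_maximal_separated C φ x
  obtain ⟨z₀, hz₀⟩ := E.a.surjective_p x
  obtain ⟨y₀, hy₀⟩ := c.surjective_p (E.b.p z₀)
  let w₀ : E.Pull c := Pull.mk z₀ y₀ hy₀.symm
  let w : Z → E.Pull c := fun z => (E.pullH c).actT (E.db z z₀) w₀
  have hz : ∀ z, E.a.p z = x → E.a.p z = E.a.p z₀ := fun z hz => hz.trans hz₀.symm
  have hs : ∀ z, E.a.p z = x → H.s (E.db z z₀) = c.p w₀.y := fun z h =>
    (E.s_db z z₀ (hz z h)).trans hy₀.symm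
  have hwz : ∀ z, E.a.p z = x → (w z).z = z := fun z h => by
    simp only [w]
    rw [pullH_z (hs z h)]
    exact E.db_act z z₀ (hz z h)
  have horb : ∀ z z', E.a.p z = x → E.a.p z' = x → E.Orb c (w z) (w z') := fun z z' h h' =>
    (orb_of_act (hs z h)).trans (orb_of_act (hs z' h')).symm
  have hfin : ∀ F : C_c(E.Pull c, ℝ), (Function.support fun z : D => F (w z)).Finite := by
    intro F
    have hB : IsCompact ((fun z => E.db z₀ z) ''
        (Pull.z '' tsupport F ∩ {z | E.a.p z₀ = E.a.p z})) := by
      refine ((F.hasCompactSupport.isCompact.image Pull.continuous_z).inter_right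
        (isClosed_eq continuous_const E.a.continuous_p)).image_of_continuousOn ?_
      exact E.continuousOn_db.comp (f := fun z => (z₀, z))
        (continuous_const.prodMk continuous_id).continuousOn fun z hz => hz.2
    obtain ⟨m, hm⟩ := E.exists_encard_le_of_separated hC hφ1 hB
    have h1 := finite_of_encard_le_coe (hm x D hDx hDs z₀ hz₀)
    refine (h1.preimage (f := fun z : D => z.1) Subtype.val_injective.injOn).subset
      fun z hzF => ⟨z.2, z.1, ⟨⟨w z, subset_tsupport _ hzF, hwz _ (hDx _ z.2).1⟩, ?_⟩, rfl⟩
    exact (hz _ (hDx _ z.2).1).symm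
  have hwC : ∀ z : D, E.b.p (w z).z ∈ C := fun z => by
    rw [hwz _ (hDx _ z.2).1]
    exact (hDx _ z.2).2
  have hwx : ∀ z : D, E.a.p (w z).z = x := fun z => by
    rw [hwz _ (hDx _ z.2).1]
    exact (hDx _ z.2).1
  refine ⟨fun F => ∑ᶠ z : D, F (w z), ⟨fun F F' => ?_, fun r F => ?_, fun F hF => ?_⟩, ?_, ?_, ?_⟩
  · exact finsum_add_distrib (hfin F) (hfin F')
  · exact (mul_finsum _ _).symm
  · exact finsum_nonneg fun z => hF _ (hwC z) (hwx z)
  · intro z hzx F hF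
    have hzx' : E.a.p z = x := hzx
    have hF' : ∀ z' : D, -φ (E.db z z') ≤ F (w z') := fun z' => by
      have := hF (w z') (hwC z') ((hwx z').trans hzx'.symm)
      rwa [hwz _ (hDx _ z'.2).1] at this
    change -(n : ℝ) ≤ ∑ᶠ z : D, F (w z)
    rw [finsum_eq_sum_of_support_subset _ (s := (hfin F).toFinset) (by simp)]
    have h1 : ∀ z' ∈ (hfin F).toFinset,
        (if E.db z z'.1 ∈ tsupport φ then (-1 : ℝ) else 0) ≤ F (w z') := by
      intro z' _
      split_ifs with h
      · exact le_trans (neg_le_neg (hφle _)) (hF' z')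
      · have := hF' z'
        rwa [image_eq_zero_of_notMem_tsupport h, neg_zero] at this
    refine le_trans ?_ (Finset.sum_le_sum h1)
    rw [← Finset.sum_filter, Finset.sum_const, nsmul_eq_mul, mul_neg, mul_one, neg_le_neg_iff,
      Nat.cast_le]
    have h2 := hn x D hDx hDs z hzx'
    have h3 : (((hfin F).toFinset.filter fun z' : D => E.db z z'.1 ∈ tsupport φ).map
        (Function.Embedding.subtype _) : Set Z).encard ≤ n := by
      refine (encard_le_encard ?_).trans h2
      intro z' hz'
      simp only [Finset.coe_map, mem_image, Finset.mem_coe, Finset.mem_filter] at hz'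
      obtain ⟨z'', ⟨-, h⟩, rfl⟩ := hz'
      exact ⟨z''.2, h⟩
    rw [encard_coe_eq_coe_finsetCard, Finset.card_map] at h3
    exact_mod_cast h3
  · intro z hzC hzx F hF
    have hzx' : E.a.p z = x := hzx
    have hF' : ∀ z' : D, ψ (E.db z z') ≤ F (w z') := fun z' => by
      have := hF (w z') (hwC z') ((hwx z').trans hzx'.symm)
      rwa [hwz _ (hDx _ z'.2).1] at this
    have hF0 : ∀ z' : D, 0 ≤ F (w z') := fun z' => (hψ0 _).trans (hF' z')
    obtain ⟨z', hz', hzz'⟩ := hDm z hzx' (interior_subset hzC)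
    have h1 : ψ (E.db z z') = 1 := by
      refine hψ1 _ ?_
      obtain rfl | h | h := hzz'
      · left
        rw [E.db_self, hφ1 _ (interior_subset hzC)]
        exact one_ne_zero
      · exact Or.inl h.ne'
      · rw [inv_db (hzx'.trans (hDx z' hz').1.symm)]
        exact Or.inr h.ne'
    refine le_trans ?_ (single_le_finsum (⟨z', hz'⟩ : D) (hfin F) hF0)
    rw [← h1]
    exact hF' ⟨z', hz'⟩
  · intro F F' h
    by_contra! hne
    obtain ⟨hF, hF'⟩ := mul_ne_zero_iff.mp hne
    obtain ⟨z, hz⟩ : ∃ z : D, F (w z) ≠ 0 := by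
      by_contra! h0
      exact hF (finsum_eq_zero_of_forall_eq_zero h0)
    obtain ⟨z', hz'⟩ : ∃ z : D, F' (w z) ≠ 0 := by
      by_contra! h0
      exact hF' (finsum_eq_zero_of_forall_eq_zero h0)
    exact mul_ne_zero hz hz' (h _ _ (horb _ _ (hDx _ z.2).1 (hDx _ z'.2).1))

/-- That a Delone functional is carried by one orbit may be tested on its own fibre. -/
theorem IsDelone.orb_of_fiber {d : G.Obj × (C_c(E.Pull c, ℝ) → ℝ)} (hd : E.IsDelone c C φ ψ M d)
    {F F' : C_c(E.Pull c, ℝ)}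
    (h : ∀ w w', E.a.p w.z = d.1 → E.Orb c w w' → F w * F' w' = 0) : d.2 F * d.2 F' = 0 := by
  by_contra hne
  obtain ⟨hF, hF'⟩ := mul_ne_zero_iff.mp hne
  have hK := F.hasCompactSupport.isCompact.union F'.hasCompactSupport.isCompact
  obtain ⟨χ, hχ1, -, hχ0, -⟩ := hK.exists_cutoff isOpen_univ (subset_univ _)
  have hχd : 0 ≤ d.2 χ := hd.isFiberFunctional.nonneg χ fun w _ _ => hχ0 w
  obtain ⟨ε, hε, hε1, hε2⟩ : ∃ ε > 0, ε * d.2 χ < |d.2 F| ∧ ε * d.2 χ < |d.2 F'| := by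
    have hm : 0 < min |d.2 F| |d.2 F'| := lt_min (abs_pos.mpr hF) (abs_pos.mpr hF')
    refine ⟨min |d.2 F| |d.2 F'| / (d.2 χ + 1), by positivity, ?_⟩
    rw [← lt_min_iff, div_mul_eq_mul_div, div_lt_iff₀ (by positivity)]
    nlinarith
  -- The soft threshold `τ` at `ε` moves a function by at most `ε`.
  let τ : ℝ → ℝ := fun t => t - max (-ε) (min t ε)
  have hτc : Continuous τ := by fun_prop
  have hτ0 : τ 0 = 0 := by simp [τ, hε.le]
  have hτd : ∀ t, |t - τ t| ≤ ε := fun t => by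
    simp only [τ, sub_sub_cancel]
    exact abs_le.mpr ⟨le_max_left _ _, max_le (by linarith) (min_le_right _ _)⟩
  have hτne : ∀ t, τ t ≠ 0 → ε ≤ |t| := fun t ht => by
    by_contra! hlt
    obtain ⟨h1, h2⟩ := abs_lt.mp hlt
    refine ht ?_
    simp only [τ]
    rw [min_eq_left h2.le, max_eq_right h1.le, sub_self]
  let comp : C_c(E.Pull c, ℝ) → C_c(E.Pull c, ℝ) := fun f =>
    ⟨⟨fun w => τ (f w), hτc.comp f.continuous⟩, f.hasCompactSupport.comp_left hτ0⟩
  have hclose : ∀ f : C_c(E.Pull c, ℝ), tsupport f ⊆ tsupport F ∪ tsupport F' →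
      ε * d.2 χ < |d.2 f| → d.2 (comp f) ≠ 0 := by
    intro f hf hlt h0
    have hle : ∀ w, |f w - τ (f w)| ≤ ε * χ w := by
      intro w
      by_cases hw : w ∈ tsupport f
      · rw [hχ1 w (hf hw), mul_one]
        exact hτd _
      · rw [image_eq_zero_of_notMem_tsupport hw, hτ0, sub_self, abs_zero]
        exact mul_nonneg hε.le (hχ0 w)
    have h1 : d.2 (f - comp f) ≤ d.2 (ε • χ) := hd.isFiberFunctional.mono fun w _ _ =>
      (abs_le.mp (hle w)).2
    have h2 : d.2 ((-ε) • χ) ≤ d.2 (f - comp f) := hd.isFiberFunctional.mono fun w _ _ => by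
      have := (abs_le.mp (hle w)).1
      rw [CompactlySupportedContinuousMap.smul_apply, smul_eq_mul, neg_mul]
      exact this
    rw [hd.isFiberFunctional.sub, hd.isFiberFunctional.smul, h0, sub_zero] at h1
    rw [hd.isFiberFunctional.sub, hd.isFiberFunctional.smul, h0, sub_zero] at h2
    exact absurd (abs_le.mpr ⟨by linarith, h1⟩) (not_le.mpr hlt)
  -- The momenta of the related pairs where both functions exceed the threshold.
  have hB : IsCompact ((fun p : E.Pull c × E.Pull c => E.a.p p.1.z) ''
      (tsupport F ×ˢ tsupport F' ∩ {p | E.Orb c p.1 p.2 ∧ ε ≤ |F p.1| ∧ ε ≤ |F' p.2|})) := by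
    refine ((F.hasCompactSupport.isCompact.prod F'.hasCompactSupport.isCompact).inter_right
      (isClosed_orb.inter (IsClosed.inter ?_ ?_))).image
      (E.a.continuous_p.comp (Pull.continuous_z.comp continuous_fst))
    · exact isClosed_le continuous_const (F.continuous.comp continuous_fst).abs
    · exact isClosed_le continuous_const (F'.continuous.comp continuous_snd).abs
  set B := (fun p : E.Pull c × E.Pull c => E.a.p p.1.z) ''
      (tsupport F ×ˢ tsupport F' ∩ {p | E.Orb c p.1 p.2 ∧ ε ≤ |F p.1| ∧ ε ≤ |F' p.2|}) with hBdef
  have hdB : d.1 ∉ B := by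
    rintro ⟨p, ⟨-, hp, h1, h2⟩, hpd⟩
    have h3 := h p.1 p.2 hpd hp
    obtain h3 | h3 := mul_eq_zero.mp h3
    · rw [h3, abs_zero] at h1
      exact not_lt.mpr h1 hε
    · rw [h3, abs_zero] at h2
      exact not_lt.mpr h2 hε
  obtain ⟨g, hg1, hg0, -, -⟩ := (isCompact_singleton (x := d.1)).exists_cutoff
    hB.isClosed.isOpen_compl (singleton_subset_iff.mpr hdB)
  let f : C_c(E.Pull c, ℝ) := ⟨⟨fun w => g (E.a.p w.z) * τ (F w),
    (g.continuous.comp (E.a.continuous_p.comp Pull.continuous_z)).mul (hτc.comp F.continuous)⟩,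
    (F.hasCompactSupport.comp_left hτ0).mul_left⟩
  have hf : d.2 f = d.2 (comp F) := hd.isFiberFunctional.congr fun w _ hw => by
    change g (E.a.p w.z) * τ (F w) = τ (F w)
    rw [hw, hg1 _ rfl, one_mul]
  have h1 := hd.orb f (comp F') fun w w' ho => by
    change g (E.a.p w.z) * τ (F w) * τ (F' w') = 0
    by_contra hne'
    obtain ⟨hne1, hne2⟩ := mul_ne_zero_iff.mp hne'
    obtain ⟨hne0, hne1⟩ := mul_ne_zero_iff.mp hne1
    refine hne0 (hg0 _ fun hB => hB ⟨(w, w'), ⟨⟨subset_tsupport _ fun h0 => hne1 ?_,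
      subset_tsupport _ fun h0 => hne2 ?_⟩, ho, hτne _ hne1, hτne _ hne2⟩, rfl⟩)
    · rw [h0, hτ0]
    · rw [h0, hτ0]
  rw [hf] at h1
  exact mul_ne_zero (hclose F subset_union_left hε1) (hclose F' subset_union_right hε2) h1

/-! ### The space of Delone functionals -/

/-- The carrier of a functional on a fibre. -/
def carrier (E : Bispace G H Z) (c : H.LeftAction Y) (d : G.Obj × (C_c(E.Pull c, ℝ) → ℝ)) :
    Set (E.Pull c) :=
  {w | E.a.p w.z = d.1 ∧ ∀ F : C_c(E.Pull c, ℝ), (∀ w, 0 ≤ F w) → F w ≠ 0 → d.2 F ≠ 0}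

theorem IsDelone.orb_of_mem_carrier {d : G.Obj × (C_c(E.Pull c, ℝ) → ℝ)}
    (hd : E.IsDelone c C φ ψ M d) {w w' : E.Pull c} (hw : w ∈ E.carrier c d)
    (hw' : w' ∈ E.carrier c d) : E.Orb c w w' := by
  by_contra h
  obtain ⟨U, V, hU, hV, hwU, hwV, hUV⟩ := isOpen_prod_iff.mp
    (isClosed_orb (E := E) (c := c)).isOpen_compl w w' h
  obtain ⟨F, hF1, hFU, hF0, -⟩ := (isCompact_singleton (x := w)).exists_cutoff hU
    (singleton_subset_iff.mpr hwU)
  obtain ⟨F', hF1', hFV, hF0', -⟩ := (isCompact_singleton (x := w')).exists_cutoff hV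
    (singleton_subset_iff.mpr hwV)
  refine mul_ne_zero (hw.2 F hF0 ?_) (hw'.2 F' hF0' ?_) (hd.orb F F' fun w₁ w₂ ho => ?_)
  · rw [hF1 _ rfl]
    exact one_ne_zero
  · rw [hF1' _ rfl]
    exact one_ne_zero
  · by_contra hne
    obtain ⟨h1, h2⟩ := mul_ne_zero_iff.mp hne
    exact hUV (mk_mem_prod (not_imp_comm.mp (hFU w₁) h1) (not_imp_comm.mp (hFV w₂) h2)) ho

theorem exists_compactlySupported_translate (E : Bispace G H Z) (c : H.LeftAction Y) (g : G.Arrow)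
    (F : C_c(E.Pull c, ℝ)) :
    ∃ F' : C_c(E.Pull c, ℝ), ∀ w, E.a.p w.z = G.s g → F' w = F ((E.pullG c).actT g w) := by
  have hT : IsClosed {w : E.Pull c | E.a.p w.z = G.s g} :=
    isClosed_eq (E.a.continuous_p.comp Pull.continuous_z) continuous_const
  obtain ⟨F', hF'⟩ := hT.exists_compactlySupported_eqOn
    (f := fun w => F ((E.pullG c).actT g w)) (F.continuous.comp_continuousOn
      ((E.pullG c).continuousOn_actT.comp (f := fun w => (g, w))
        (continuous_const.prodMk continuous_id).continuousOn fun w hw => Eq.symm hw))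
    ((E.pullG c).isCompact_image_actT (isCompact_singleton (x := G.inv g))
      F.hasCompactSupport.isCompact) fun w hw hne => by
      have hs : G.s g = (E.pullG c).p w := Eq.symm hw
      exact ⟨_, rfl, _, subset_tsupport _ hne, by rw [G.s_inv, (E.pullG c).p_actT hs],
        (E.pullG c).inv_actT_actT hs⟩
  exact ⟨F', fun w hw => hF' hw⟩

/-- The image of a functional on a fibre under an arrow of `G`. -/
noncomputable def translateFunctional (E : Bispace G H Z) (c : H.LeftAction Y) (g : G.Arrow)
    (d : G.Obj × (C_c(E.Pull c, ℝ) → ℝ)) : G.Obj × (C_c(E.Pull c, ℝ) → ℝ) :=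
  (G.r g, fun F => fiberEval (fun w => E.a.p w.z) d fun w => F ((E.pullG c).actT g w))

omit [T2Space Z] [LocallyCompactSpace Z] [T2Space Y] [LocallyCompactSpace Y] in
theorem translateFunctional_eq {d : G.Obj × (C_c(E.Pull c, ℝ) → ℝ)} (hd : E.IsDelone c C φ ψ M d)
    {g : G.Arrow} (hg : G.s g = d.1) {F F' : C_c(E.Pull c, ℝ)}
    (h : ∀ w, E.a.p w.z = G.s g → F' w = F ((E.pullG c).actT g w)) :
    (E.translateFunctional c g d).2 F = d.2 F' :=
  fiberEval_eq hd.isFiberFunctional fun w hw => h w (hw.trans hg.symm)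

theorem IsDelone.translateFunctional {d : G.Obj × (C_c(E.Pull c, ℝ) → ℝ)}
    (hd : E.IsDelone c C φ ψ M d) {g : G.Arrow} (hg : G.s g = d.1) :
    E.IsDelone c C φ ψ M (E.translateFunctional c g d) := by
  choose T hT using E.exists_compactlySupported_translate c g
  have hTd : ∀ F, (E.translateFunctional c g d).2 F = d.2 (T F) := fun F =>
    translateFunctional_eq hd hg (hT F)
  have hpz : ∀ w : E.Pull c, E.a.p w.z = d.1 → E.a.p ((E.pullG c).actT g w).z = G.r g := fun w hw =>
    (E.pullG c).p_actT (hg.trans hw.symm)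
  have hbz : ∀ w : E.Pull c, E.a.p w.z = d.1 → E.b.p ((E.pullG c).actT g w).z = E.b.p w.z :=
    fun w hw => by
      rw [pullG_z (hg.trans hw.symm)]
      exact E.b_p_act g _ (hg.trans hw.symm)
  have hzs : ∀ z, E.a.p z = G.r g → G.s (G.inv g) = E.a.p z := fun z hz => (G.s_inv g).trans hz.symm
  have hzd : ∀ z, E.a.p z = G.r g → E.a.p (E.a.actT (G.inv g) z) = d.1 := fun z hz => by
    rw [E.a.p_actT (hzs z hz), G.r_inv, hg]
  have hdb : ∀ z (w : E.Pull c), E.a.p z = G.r g → E.a.p w.z = d.1 →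
      E.db z ((E.pullG c).actT g w).z = E.db (E.a.actT (G.inv g) z) w.z := fun z w hz hw => by
    rw [pullG_z (hg.trans hw.symm), ← E.db_act_act ((hzd z hz).trans hw.symm)
      (hg.trans (hzd z hz).symm), E.a.actT_inv_actT hz.symm]
  refine ⟨⟨fun F F' => ?_, fun r F => ?_, fun F hF => ?_⟩, fun z hz F hF => ?_,
    fun z hzC hz F hF => ?_, fun F F' h => ?_⟩
  · rw [hTd F, hTd F', ← hd.isFiberFunctional.add]
    refine translateFunctional_eq hd hg fun w hw => ?_
    rw [CompactlySupportedContinuousMap.add_apply, hT F w hw, hT F' w hw,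
      CompactlySupportedContinuousMap.add_apply]
  · rw [hTd F, ← hd.isFiberFunctional.smul]
    refine translateFunctional_eq hd hg fun w hw => ?_
    rw [CompactlySupportedContinuousMap.smul_apply, hT F w hw,
      CompactlySupportedContinuousMap.smul_apply]
  · rw [hTd]
    refine hd.isFiberFunctional.nonneg _ fun w hwC hw => ?_
    rw [hT F w (hw.trans hg.symm)]
    exact hF _ (by rw [mem_ofPred_eq, hbz w hw]; exact hwC) (hpz w hw)
  · rw [hTd]
    refine hd.upper (E.a.actT (G.inv g) z) (hzd z hz) _ fun w hwC hw => ?_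
    have hw' := hw.trans (hzd z hz)
    rw [hT F w (hw'.trans hg.symm), ← hdb z w hz hw']
    exact hF _ (by rw [hbz w hw']; exact hwC) ((hpz w hw').trans hz.symm)
  · rw [hTd]
    refine hd.lower (E.a.actT (G.inv g) z) (by rwa [E.b_p_act _ _ (hzs z hz)]) (hzd z hz) _
      fun w hwC hw => ?_
    have hw' := hw.trans (hzd z hz)
    rw [hT F w (hw'.trans hg.symm), ← hdb z w hz hw']
    exact hF _ (by rw [hbz w hw']; exact hwC) ((hpz w hw').trans hz.symm)
  · rw [hTd, hTd]
    refine hd.orb_of_fiber fun w w' hw ho => ?_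
    have hw' : E.a.p w'.z = G.s g := ho.1.symm.trans (hw.trans hg.symm)
    rw [hT F w (hw.trans hg.symm), hT F' w' hw']
    exact h _ _ (ho.act (hg.trans hw.symm))

theorem IsDelone.mem_carrier_translate {d : G.Obj × (C_c(E.Pull c, ℝ) → ℝ)}
    (hd : E.IsDelone c C φ ψ M d) {g : G.Arrow} (hg : G.s g = d.1) {w : E.Pull c}
    (hw : w ∈ E.carrier c d) :
    (E.pullG c).actT g w ∈ E.carrier c (E.translateFunctional c g d) := by
  have hgw : G.s g = E.a.p w.z := hg.trans hw.1.symm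
  refine ⟨(E.pullG c).p_actT hgw, fun F hF0 hFw => ?_⟩
  obtain ⟨F', hF'⟩ := E.exists_compactlySupported_translate c g F
  let f : C_c(E.Pull c, ℝ) := ⟨⟨fun w => |F' w|, F'.continuous.abs⟩,
    F'.hasCompactSupport.comp_left abs_zero⟩
  have hf : ∀ w, E.a.p w.z = G.s g → f w = F ((E.pullG c).actT g w) := fun w hw => by
    change |F' w| = _
    rw [hF' w hw, abs_of_nonneg (hF0 _)]
  rw [translateFunctional_eq hd hg hf]
  refine hw.2 f (fun w => abs_nonneg _) ?_
  rwa [hf w hgw.symm]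

/-- `G` acts on the space of Delone functionals. -/
noncomputable def deloneAction (E : Bispace G H Z) (c : H.LeftAction Y) (C : Set H.Obj)
    (φ ψ : C_c(H.Arrow, ℝ)) (M : ℝ) (hne : ∀ x, ∃ l, E.IsDelone c C φ ψ M (x, l)) :
    G.LeftAction {d // E.IsDelone c C φ ψ M d} where
  p d := d.1.1
  continuous_p := continuous_fst.comp continuous_subtype_val
  surjective_p x := by
    obtain ⟨l, hl⟩ := hne x
    exact ⟨⟨_, hl⟩, rfl⟩
  act g d w := ⟨E.translateFunctional c g d.1, d.2.translateFunctional w⟩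
  p_act g d w := rfl
  e_act d := by
    refine Subtype.ext (Prod.ext (G.r_e _) (funext fun F => ?_))
    refine translateFunctional_eq d.2 (G.s_e _) fun w hw => ?_
    rw [G.s_e] at hw
    rw [← hw]
    exact congrArg F ((E.pullG c).e_actT w).symm
  mul_act g₂ g₁ d w w' := by
    refine Subtype.ext (Prod.ext (G.r_mul _ _ _) (funext fun F => ?_))
    obtain ⟨F₂, hF₂⟩ := E.exists_compactlySupported_translate c g₂ F
    obtain ⟨F₁, hF₁⟩ := E.exists_compactlySupported_translate c g₁ F₂
    refine (translateFunctional_eq d.2 ((G.s_mul _ _ _).trans w) (F' := F₁) fun v hv => ?_).trans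
      (Eq.trans (translateFunctional_eq d.2 w hF₁).symm
      (translateFunctional_eq (d.2.translateFunctional w) w' hF₂).symm)
    have hv' : G.s g₁ = E.a.p v.z := (G.s_mul _ _ w').symm.trans hv.symm
    rw [hF₁ v hv'.symm, hF₂ _ (((E.pullG c).p_actT hv').trans w'.symm), ← mulT_eq w',
      (E.pullG c).mul_actT hv' w']
  continuous_act := by
    refine Continuous.subtype_mk (Continuous.prodMk ?_ (continuous_pi fun F => ?_)) _
    · exact G.continuous_r.comp (continuous_fst.comp continuous_subtype_val)
    refine continuous_fiberEval (E.a.continuous_p.comp Pull.continuous_z)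
      (d := fun p : {p : G.Arrow × {d // E.IsDelone c C φ ψ M d} // G.s p.1 = p.2.1.1} => p.1.2.1)
      (f := fun p w => F ((E.pullG c).actT p.1.1 w))
      (continuous_subtype_val.comp (continuous_snd.comp continuous_subtype_val))
      (fun p => p.1.2.2.isFiberFunctional) ?_ fun p₀ => ?_
    · refine F.continuous.comp_continuousOn ((E.pullG c).continuousOn_actT.comp
        (f := fun q : {p : G.Arrow × {d // E.IsDelone c C φ ψ M d} // G.s p.1 = p.2.1.1} ×
          E.Pull c => (q.1.1.1, q.2)) ?_ fun q hq => q.1.2.trans (Eq.symm hq))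
      exact ((continuous_fst.comp (continuous_subtype_val.comp continuous_fst)).prodMk
        continuous_snd).continuousOn
    · obtain ⟨B, hB, hB₀⟩ := exists_compact_mem_nhds p₀.1.1
      refine ⟨_, (E.pullG c).isCompact_image_actT (hB.image G.continuous_inv)
        F.hasCompactSupport.isCompact, ?_⟩
      filter_upwards [(continuous_fst.comp continuous_subtype_val).continuousAt hB₀]
        with p hp w hw hne
      have hs : G.s p.1.1 = (E.pullG c).p w := p.2.trans (Eq.symm hw)
      exact ⟨_, ⟨_, hp, rfl⟩, _, subset_tsupport _ hne, by rw [G.s_inv, (E.pullG c).p_actT hs]; rfl,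
        (E.pullG c).inv_actT_actT hs⟩

/-- The momentum map of the space of Delone functionals is proper: by Tychonoff's theorem, because
the functionals on the fibres over `K` form a closed set of pointwise bounded functionals. -/
theorem isCompact_isDelone (hc : IsProperMap c.p) (hC : IsClosed C) (hφ : ∀ h, 0 ≤ φ h)
    (hφ1 : ∀ x ∈ C, φ (H.e x) = 1) (hM : 0 ≤ M) {K : Set G.Obj} (hK : IsCompact K) :
    IsCompact ((fun d : {d // E.IsDelone c C φ ψ M d} => d.1.1) ⁻¹' K) := by
  choose b hb using exists_forall_abs_isDelone_le (E := E) (c := c) (ψ := ψ) hC hφ hφ1 hM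
  have h1 : IsCompact (K ×ˢ univ.pi fun F => Icc (-b F) (b F)) :=
    hK.prod (isCompact_univ_pi fun F => isCompact_Icc)
  have h2 := (isClosed_isDelone (E := E) (c := c) (M := M) (φ := φ) (ψ := ψ) hc hC hφ
    ).isClosedEmbedding_subtypeVal.isCompact_preimage h1
  refine h2.of_isClosed_subset ?_ fun d hd => ⟨hd, fun F _ => abs_le.mp (hb F d.1 d.2)⟩
  exact hK.isClosed.preimage (continuous_fst.comp continuous_subtype_val)

omit [T2Space Z] [LocallyCompactSpace Z] [T2Space Y] [LocallyCompactSpace Y] in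
/-- A Radon measure on the fibre over `d.1` is concentrated on the carrier of `d` if it vanishes on
the non-negative functions on which `d` vanishes. -/
theorem ae_mem_carrier {d : G.Obj × (C_c(E.Pull c, ℝ) → ℝ)} {μ : Measure (E.Pull c)}
    (hreg : μ.Regular) (hx : ∀ᵐ w ∂μ, E.a.p w.z = d.1)
    (h : ∀ F : C_c(E.Pull c, ℝ), (∀ w, 0 ≤ F w) → d.2 F = 0 → ∫ w, F w ∂μ = 0) :
    ∀ᵐ w ∂μ, w ∈ E.carrier c d := by
  set U : Set (E.Pull c) := ⋃ F : {F : C_c(E.Pull c, ℝ) // (∀ w, 0 ≤ F w) ∧ d.2 F = 0},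
    {w | F.1 w ≠ 0} with hU
  have hUo : IsOpen U := isOpen_iUnion fun F => isOpen_ne_fun F.1.continuous continuous_const
  have hU0 : μ U = 0 := by
    rw [hUo.measure_eq_iSup_isCompact]
    simp only [ENNReal.iSup_eq_zero]
    intro K hKU hK
    refine hK.measure_zero_of_nhdsWithin fun w hw => ?_
    obtain ⟨F, hF⟩ := mem_iUnion.mp (hKU hw)
    refine ⟨{w | F.1 w ≠ 0}, mem_nhdsWithin_of_mem_nhds
      ((isOpen_ne_fun F.1.continuous continuous_const).mem_nhds hF), ?_⟩
    have h1 := (integral_eq_zero_iff_of_nonneg F.2.1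
      (F.1.continuous.integrable_of_hasCompactSupport F.1.hasCompactSupport)).mp
      (h F.1 F.2.1 F.2.2)
    exact h1
  filter_upwards [hx, compl_mem_ae_iff.mpr hU0] with w hw hwU
  refine ⟨hw, fun F hF0 hFw hdF => hwU (mem_iUnion.mpr ⟨⟨F, hF0, hdF⟩, hFw⟩)⟩

/-- Cutting off and normalising Delone functionals gives continuous families of probability
measures. -/
theorem exists_isKernel_isDelone (hc : IsProperMap c.p) (hψle : ∀ h, ψ h ≤ 1)
    {S : Set Z} (hS : IsCompact S) (hSC : ∀ z ∈ S, E.b.p z ∈ interior C) :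
    ∃ (S' : Set (E.Pull c)) (ν : {d // E.IsDelone c C φ ψ M d} → Measure (E.Pull c)),
      IsKernel (fun d => {w | E.a.p w.z = d.1.1}) S' ν ∧
      (∀ d, d.1.1 ∈ E.a.p '' S → ν d univ = 1) ∧ ∀ d, ∀ᵐ w ∂(ν d), w ∈ E.carrier c d.1 := by
  obtain ⟨K, hK, hSK⟩ := exists_isCompact_of_db_mem (E := E) hc hS ψ.hasCompactSupport.isCompact
  obtain ⟨f, hf1, -, hf0, hfle⟩ := hK.exists_cutoff isOpen_univ (subset_univ _)
  have hfS : ∀ d : {d // E.IsDelone c C φ ψ M d}, d.1.1 ∈ E.a.p '' S → 1 ≤ d.1.2 f := by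
    rintro d ⟨z, hz, hzd⟩
    refine d.2.lower z (hSC z hz) hzd f fun w _ hw => ?_
    by_cases h : ψ (E.db z w.z) = 0
    · rw [h]
      exact hf0 w
    · rw [hf1 w (hSK z hz w hw (subset_tsupport _ h))]
      exact hψle _
  have hev : ∀ F : C_c(E.Pull c, ℝ),
      Continuous fun d : {d // E.IsDelone c C φ ψ M d} => d.1.2 F := fun F =>
    (continuous_apply F).comp (continuous_snd.comp continuous_subtype_val)
  have hpos : ∀ d : {d // E.IsDelone c C φ ψ M d}, 0 < max (d.1.2 f) 1 := fun d =>
    lt_max_of_lt_right one_pos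
  let Λ : {d // E.IsDelone c C φ ψ M d} → C_c(E.Pull c, ℝ) →ₗ[ℝ] ℝ := fun d =>
    { toFun := fun F => d.1.2 (F * f) / max (d.1.2 f) 1
      map_add' := fun F F' => by
        rw [add_mul, d.2.isFiberFunctional.add, add_div]
      map_smul' := fun r F => by
        rw [smul_mul_assoc, d.2.isFiberFunctional.smul, mul_div_assoc, RingHom.id_apply,
          smul_eq_mul] }
  have hsupp : ∀ (F F' : C_c(E.Pull c, ℝ)), (∀ w ∈ tsupport f, F w = F' w) → F * f = F' * f := by
    intro F F' h
    ext w
    rw [CompactlySupportedContinuousMap.mul_apply, CompactlySupportedContinuousMap.mul_apply]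
    by_cases hw : w ∈ tsupport f
    · rw [h w hw]
    · rw [image_eq_zero_of_notMem_tsupport hw, mul_zero, mul_zero]
  have hone : ∀ (d) (F : C_c(E.Pull c, ℝ)), (∀ w ∈ tsupport f, F w = 1) →
      Λ d F = d.1.2 f / max (d.1.2 f) 1 := by
    intro d F hF
    have : F * f = f := by
      ext w
      rw [CompactlySupportedContinuousMap.mul_apply]
      by_cases hw : w ∈ tsupport f
      · rw [hF w hw, one_mul]
      · rw [image_eq_zero_of_notMem_tsupport hw, mul_zero]
    change d.1.2 (F * f) / max (d.1.2 f) 1 = _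
    rw [this]
  obtain ⟨ν, hν, hνint, hν1, hνreg⟩ := IsKernel.exists_of_functional
    (D := fun d : {d // E.IsDelone c C φ ψ M d} => {w : E.Pull c | E.a.p w.z = d.1.1})
    f.hasCompactSupport.isCompact
    (isClosed_eq (E.a.continuous_p.comp (Pull.continuous_z.comp continuous_snd))
      (continuous_fst.comp (continuous_subtype_val.comp continuous_fst))) Λ
    (fun d F hF => by
      refine div_nonneg (d.2.isFiberFunctional.nonneg _ fun w _ hw => ?_) (hpos d).le
      rw [CompactlySupportedContinuousMap.mul_apply]
      by_cases hw' : w ∈ tsupport f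
      · exact mul_nonneg (hF w hw' hw) (hf0 w)
      · rw [image_eq_zero_of_notMem_tsupport hw', mul_zero])
    (fun d F hF => by
      rw [hone d F hF]
      exact div_le_one_of_le₀ (le_max_left _ _) (hpos d).le)
    (fun F => (hev (F * f)).div ((hev f).max continuous_const) fun d => (hpos d).ne')
  refine ⟨_, ν, hν, fun d hd => hν1 d fun F hF => ?_, fun d => ?_⟩
  · rw [hone d F hF, max_eq_left (hfS d hd), div_self (zero_lt_one.trans_le (hfS d hd)).ne']
  · refine ae_mem_carrier (hνreg d) ((hν.mem d).mono fun w hw => hw.2) fun F hF0 hdF => ?_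
    rw [hνint]
    have h1 : d.1.2 (F * f) = 0 := by
      refine le_antisymm ?_ (d.2.isFiberFunctional.nonneg _ fun w _ _ => ?_)
      · rw [← hdF]
        refine d.2.isFiberFunctional.mono fun w _ _ => ?_
        rw [CompactlySupportedContinuousMap.mul_apply]
        exact mul_le_of_le_one_right (hF0 w) (hfle w)
      · rw [CompactlySupportedContinuousMap.mul_apply]
        exact mul_nonneg (hF0 w) (hf0 w)
    change d.1.2 (F * f) / _ = 0
    rw [h1, zero_div]

/-- Kernels on orbits, as in `Bispace.HasOrbitKernels`, whose mass is only prescribed at points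
below a compact set over the interior of `C`. -/
def HasOrbitKernelsOver (E : Bispace G H Z) (c : H.LeftAction Y) (C : Set H.Obj)
    {X : Type u} [TopologicalSpace X] (b : G.LeftAction X) : Prop :=
  ∀ S : Set Z, IsCompact S → (∀ z ∈ S, E.b.p z ∈ interior C) →
    ∃ (S' : Set (E.Pull c)) (ν : X → Measure (E.Pull c)) (O : X → Set (E.Pull c)),
      IsKernel (fun ξ => {w | E.a.p w.z = b.p ξ}) S' ν ∧
      (∀ ξ, b.p ξ ∈ E.a.p '' S → ν ξ univ = 1) ∧
      (∀ ξ, ∀ᵐ w ∂(ν ξ), w ∈ O ξ) ∧ (∀ ξ, ∀ w ∈ O ξ, ∀ w' ∈ O ξ, E.Orb c w w') ∧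
      ∀ g ξ, G.s g = b.p ξ → ∀ w ∈ O ξ, (E.pullG c).actT g w ∈ O (b.actT g ξ)

/-- For every compact `C`, there is a proper `G`-space with kernels on orbits over `C`. -/
theorem exists_hasOrbitKernelsOver (E : Bispace G H Z) (c : H.LeftAction Y)
    (hc : IsProperMap c.p) (hC : IsCompact C) :
    ∃ (X : Type u) (_ : TopologicalSpace X) (_ : T2Space X) (b : G.LeftAction X),
      (∀ K, IsCompact K → IsCompact (b.p ⁻¹' K)) ∧ E.HasOrbitKernelsOver c C b := by
  obtain ⟨φ, hφ1, -, hφ0, hφle⟩ := (hC.image H.continuous_e).exists_cutoff isOpen_univ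
    (subset_univ _)
  obtain ⟨ψ, hψ1, -, hψ0, hψle⟩ := (φ.hasCompactSupport.isCompact.union
    (φ.hasCompactSupport.isCompact.image H.continuous_inv)).exists_cutoff isOpen_univ
    (subset_univ _)
  have hφ1' : ∀ x ∈ C, φ (H.e x) = 1 := fun x hx => hφ1 _ ⟨x, hx, rfl⟩
  obtain ⟨M, hM, hne⟩ := exists_isDelone E c hC.isClosed hφ1' hφle hψ0 (ψ := ψ) fun h hh => by
    refine hψ1 h ?_
    obtain hh | hh := hh
    · exact Or.inl (subset_tsupport _ hh)
    · exact Or.inr ⟨_, subset_tsupport _ hh, LCGroupoid.inv_inv h⟩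
  refine ⟨_, inferInstance, inferInstance, E.deloneAction c C φ ψ M hne,
    fun K hK => isCompact_isDelone hc hC.isClosed hφ0 hφ1' hM hK, fun S hS hSC => ?_⟩
  obtain ⟨S', ν, hν, hν1, hνc⟩ := exists_isKernel_isDelone (φ := φ) (M := M) hc hψle hS hSC
  refine ⟨S', ν, fun d => E.carrier c d.1, hν, hν1, hνc,
    fun d w hw w' hw' => d.2.orb_of_mem_carrier hw hw', fun g d hg w hw => ?_⟩
  rw [LeftAction.actT_eq _ hg]
  exact d.2.mem_carrier_translate hg hw

end Bispace

/-! ### Fibre products of proper `G`-spaces -/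

namespace LeftAction

/-- The fibre product of a family of `G`-spaces over the unit space, recorded together with the
common momentum of the components. -/
def FiberProd {I : Type u} {X : I → Type u} [∀ i, TopologicalSpace (X i)]
    (b : ∀ i, G.LeftAction (X i)) : Type u :=
  {q : G.Obj × (∀ i, X i) // ∀ i, (b i).p (q.2 i) = q.1}

variable {I : Type u} {X : I → Type u} [∀ i, TopologicalSpace (X i)] (b : ∀ i, G.LeftAction (X i))

instance : TopologicalSpace (FiberProd b) :=
  inferInstanceAs (TopologicalSpace {q : G.Obj × (∀ i, X i) // ∀ i, (b i).p (q.2 i) = q.1})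

instance [∀ i, T2Space (X i)] : T2Space (FiberProd b) := by
  exact inferInstanceAs (T2Space {q : G.Obj × (∀ i, X i) // ∀ i, (b i).p (q.2 i) = q.1})

/-- The diagonal action on a fibre product. -/
def fiberProd : G.LeftAction (FiberProd b) where
  p q := q.1.1
  continuous_p := continuous_fst.comp continuous_subtype_val
  surjective_p x := by
    choose y hy using fun i => (b i).surjective_p x
    exact ⟨⟨(x, y), hy⟩, rfl⟩
  act g q w := ⟨(G.r g, fun i => (b i).act g (q.1.2 i) (w.trans (q.2 i).symm)),
    fun i => (b i).p_act _ _ _⟩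
  p_act _ _ _ := rfl
  e_act q := Subtype.ext (Prod.ext (G.r_e _) (funext fun i =>
    ((b i).act_congr (congrArg G.e (q.2 i).symm) rfl _ (G.s_e _)).trans ((b i).e_act _)))
  mul_act g₂ g₁ q w w' := Subtype.ext (Prod.ext (G.r_mul _ _ _) (funext fun i =>
    (b i).mul_act g₂ g₁ _ _ w'))
  continuous_act := by
    refine Continuous.subtype_mk (Continuous.prodMk
      (G.continuous_r.comp (continuous_fst.comp continuous_subtype_val))
      (continuous_pi fun i => ?_)) _
    refine (b i).continuous_act.comp
      (f := fun q : {q : G.Arrow × FiberProd b // G.s q.1 = q.2.1.1} =>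
      (⟨(q.1.1, q.1.2.1.2 i), q.2.trans (q.1.2.2 i).symm⟩ :
        {q : G.Arrow × X i // G.s q.1 = (b i).p q.2})) (Continuous.subtype_mk ?_ _)
    exact (continuous_fst.comp continuous_subtype_val).prodMk ((continuous_apply i).comp
      (continuous_snd.comp (continuous_subtype_val.comp
        (continuous_snd.comp continuous_subtype_val))))

theorem isCompact_fiberProd [∀ i, T2Space (X i)]
    (hb : ∀ i K, IsCompact K → IsCompact ((b i).p ⁻¹' K)) {K : Set G.Obj}
    (hK : IsCompact K) : IsCompact ((fiberProd b).p ⁻¹' K) := by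
  have h1 : IsCompact (K ×ˢ univ.pi fun i => (b i).p ⁻¹' K) :=
    hK.prod (isCompact_univ_pi fun i => hb i K hK)
  have h2 : IsClosed {q : G.Obj × (∀ i, X i) | ∀ i, (b i).p (q.2 i) = q.1} := by
    simp only [ofPred_forall]
    exact isClosed_iInter fun i => isClosed_eq
      ((b i).continuous_p.comp ((continuous_apply i).comp continuous_snd)) continuous_fst
  refine (h2.isClosedEmbedding_subtypeVal.isCompact_preimage h1).of_isClosed_subset
    (hK.isClosed.preimage (fiberProd b).continuous_p) fun q hq => ⟨hq, fun i _ => ?_⟩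
  change (b i).p (q.1.2 i) ∈ K
  rw [q.2 i]
  exact hq

theorem locallyCompactSpace_of_proper {X : Type u} [TopologicalSpace X] [T2Space X]
    (b : G.LeftAction X) (hb : ∀ K, IsCompact K → IsCompact (b.p ⁻¹' K)) :
    LocallyCompactSpace X := by
  have : WeaklyLocallyCompactSpace X := ⟨fun x => by
    obtain ⟨K, hK, hKx⟩ := exists_compact_mem_nhds (b.p x)
    exact ⟨_, hb K hK, b.continuous_p.continuousAt hKx⟩⟩
  infer_instance

theorem isProperMap_p {X : Type u} [TopologicalSpace X] [T2Space X]
    (b : G.LeftAction X) (hb : ∀ K, IsCompact K → IsCompact (b.p ⁻¹' K)) : IsProperMap b.p := by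
  exact isProperMap_iff_isCompact_preimage.mpr ⟨b.continuous_p, fun {K} hK => hb K hK⟩

end LeftAction

/-- The action of `G` on its unit space. -/
def unitAction (G : LCGroupoid.{u}) : G.LeftAction G.Obj where
  p := id
  continuous_p := continuous_id
  surjective_p := Function.surjective_id
  act g _ _ := G.r g
  p_act _ _ _ := rfl
  e_act x := G.r_e x
  mul_act _ _ _ _ _ := G.r_mul _ _ _
  continuous_act := G.continuous_r.comp (continuous_fst.comp continuous_subtype_val)

namespace Bispace

variable {Z : Type u} [TopologicalSpace Z] [T2Space Z] [LocallyCompactSpace Z]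
  {Y : Type u} [TopologicalSpace Y] [T2Space Y] [LocallyCompactSpace Y]

omit [T2Space Z] in
/-- Compact subsets of the unit space lift to compact subsets of `Z`. -/
theorem exists_isCompact_image (E : Bispace G H Z) {L : Set G.Obj} (hL : IsCompact L) :
    ∃ S : Set Z, IsCompact S ∧ L ⊆ E.a.p '' interior S := by
  choose σ hσ using E.a.surjective_p
  choose B hB hBn using fun x => exists_compact_mem_nhds (σ x)
  obtain ⟨t, -, ht⟩ := hL.elim_nhds_subcover (fun x => E.a.p '' interior (B x)) fun x _ =>
    (E.isOpenMap_a _ isOpen_interior).mem_nhds ⟨σ x, mem_interior_iff_mem_nhds.mpr (hBn x), hσ x⟩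
  refine ⟨⋃ x ∈ t, B x, t.isCompact_biUnion fun x _ => hB x, fun x hx => ?_⟩
  obtain ⟨x', hx', z, hz, rfl⟩ := mem_iUnion₂.mp (ht hx)
  exact ⟨z, interior_mono (subset_biUnion_of_mem (u := B) hx') hz, rfl⟩

/-- There is one space of Delone functionals for each compact subset `C` of the unit space of `H`;
their fibre product over the unit space of `G` serves all `C` at once. -/
theorem exists_hasOrbitKernels (E : Bispace G H Z) (c : H.LeftAction Y) (hc : IsProperMap c.p) :
    ∃ (X : Type u) (_ : TopologicalSpace X) (_ : T2Space X) (_ : LocallyCompactSpace X)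
      (b : G.LeftAction X), IsProperMap b.p ∧ E.HasOrbitKernels c b := by
  choose X tX t2X b hb hker using fun C : {C : Set H.Obj // IsCompact C} =>
    E.exists_hasOrbitKernelsOver c hc C.2
  have hcomp := fun K => LeftAction.isCompact_fiberProd b hb (K := K)
  refine ⟨_, inferInstance, inferInstance,
    (LeftAction.fiberProd b).locallyCompactSpace_of_proper fun K hK => hcomp K hK,
    LeftAction.fiberProd b, (LeftAction.fiberProd b).isProperMap_p fun K hK => hcomp K hK, ?_⟩
  intro L hL
  obtain ⟨S, hS, hLS⟩ := E.exists_isCompact_image (hL.image (LeftAction.fiberProd b).continuous_p)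
  obtain ⟨C, hC, hSC⟩ := exists_compact_superset (hS.image E.b.continuous_p)
  obtain ⟨S', ν, O, hν, hν1, hνO, hO, hOact⟩ := hker ⟨C, hC⟩ S hS fun z hz => hSC ⟨z, hz, rfl⟩
  have hp : ∀ q : LeftAction.FiberProd b, (b ⟨C, hC⟩).p (q.1.2 ⟨C, hC⟩) = q.1.1 := fun q => q.2 _
  have hπ : Continuous fun q : LeftAction.FiberProd b => q.1.2 ⟨C, hC⟩ :=
    (continuous_apply _).comp (continuous_snd.comp continuous_subtype_val)
  refine ⟨S', fun q => ν (q.1.2 ⟨C, hC⟩), fun q => O (q.1.2 ⟨C, hC⟩), ?_, fun q hq => hν1 _ ?_,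
    fun q => hνO _, fun q => hO _, fun g q hg w hw _ => ?_⟩
  · refine ⟨hν.isCompact, ?_, fun q => ?_, fun q => hν.mass _, fun f => (hν.cont f).comp hπ⟩
    · have := hν.isClosed.preimage ((hπ.comp continuous_fst).prodMk continuous_snd)
      convert this using 1
      ext q
      exact Eq.congr_right (hp q.1).symm
    · have := hν.mem (q.1.2 ⟨C, hC⟩)
      rwa [hp q] at this
  · rw [hp q]
    exact image_mono interior_subset (hLS ⟨q, hq, rfl⟩)
  · have h1 := hOact g _ (hg.trans (hp q).symm) w hw
    rw [LeftAction.actT_eq _ hg]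
    rwa [LeftAction.actT_eq _ (hg.trans (hp q).symm)] at h1

end Bispace

end LCGroupoid

/-- Images of kernels under continuous maps are kernels. -/
theorem IsKernel.map {A A' B B' : Type*} [TopologicalSpace A] [TopologicalSpace A']
    [TopologicalSpace B] [MeasurableSpace B] [BorelSpace B] [T2Space B] [LocallyCompactSpace B]
    [TopologicalSpace B'] [MeasurableSpace B'] [BorelSpace B'] [T2Space B']
    {D : A → Set B} {S : Set B} {μ : A → Measure B} (h : IsKernel D S μ) {u : A' → A}
    (hu : Continuous u) {f : B → B'} (hf : Continuous f) {D' : A' → Set B'}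
    (hD' : IsClosed {q : A' × B' | q.2 ∈ D' q.1}) (hDD' : ∀ a, ∀ b ∈ D (u a), f b ∈ D' a) :
    IsKernel D' (f '' S) fun a => (μ (u a)).map f := by
  have hS := h.isCompact.image hf
  have hDa : ∀ a, IsClosed (D' a) := fun a =>
    hD'.preimage (continuous_const.prodMk continuous_id : Continuous fun b => (a, b))
  refine ⟨hS, hD', fun a => ?_, fun a => ?_, fun g => ?_⟩
  · refine (ae_map_iff hf.measurable.aemeasurable
      (hS.isClosed.inter (hDa a)).measurableSet).mpr ?_
    exact (h.mem (u a)).mono fun b hb => ⟨⟨b, hb.1, rfl⟩, hDD' a b hb.2⟩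
  · rw [Measure.map_apply hf.measurable MeasurableSet.univ]
    exact h.mass _
  · have h1 : ∀ a, ∫ b, g b ∂((μ (u a)).map f) = ∫ b, g (f b) ∂(μ (u a)) := fun a =>
      integral_map hf.measurable.aemeasurable
        (g.continuous.stronglyMeasurable_of_hasCompactSupport g.hasCompactSupport
          ).aestronglyMeasurable
    simp only [h1]
    exact h.continuous_integral hu (F := fun _ b => g (f b))
      (g.continuous.comp (hf.comp continuous_snd)).continuousOn

namespace LCGroupoid

variable {G H : LCGroupoid.{u}}

/-! ### Invariance of amenability at infinity -/

namespace LeftAction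

variable {Y B : Type u} [TopologicalSpace Y] [TopologicalSpace B]

/-- The diagonal action on the fibre product of two spaces. -/
def prod (a : H.LeftAction Y) (b : H.LeftAction B) :
    H.LeftAction {q : Y × B // a.p q.1 = b.p q.2} where
  p q := a.p q.1.1
  continuous_p := a.continuous_p.comp (continuous_fst.comp continuous_subtype_val)
  surjective_p x := by
    obtain ⟨y, hy⟩ := a.surjective_p x
    obtain ⟨y', hy'⟩ := b.surjective_p x
    exact ⟨⟨(y, y'), hy.trans hy'.symm⟩, hy⟩
  act g q w := ⟨(a.act g q.1.1 w, b.act g q.1.2 (w.trans q.2)),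
    (a.p_act _ _ _).trans (b.p_act _ _ _).symm⟩
  p_act g q w := a.p_act _ _ _
  e_act q := Subtype.ext (Prod.ext (a.e_act _)
    ((b.act_congr (congrArg H.e q.2) rfl _ (H.s_e _)).trans (b.e_act _)))
  mul_act g₂ g₁ q w w' := Subtype.ext (Prod.ext (a.mul_act _ _ _ w w') (b.mul_act _ _ _ _ w'))
  continuous_act := by
    have h1 : Continuous fun q : {q : H.Arrow × {q : Y × B // a.p q.1 = b.p q.2} //
        H.s q.1 = a.p q.2.1.1} => q.1.1 := continuous_fst.comp continuous_subtype_val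
    have h2 : Continuous fun q : {q : H.Arrow × {q : Y × B // a.p q.1 = b.p q.2} //
        H.s q.1 = a.p q.2.1.1} => q.1.2.1 :=
      continuous_subtype_val.comp (continuous_snd.comp continuous_subtype_val)
    refine Continuous.subtype_mk (Continuous.prodMk ?_ ?_) _
    · exact a.continuous_act.comp (f := fun q : {q : H.Arrow × {q : Y × B // a.p q.1 = b.p q.2} //
        H.s q.1 = a.p q.2.1.1} => (⟨(q.1.1, q.1.2.1.1), q.2⟩ :
          {q : H.Arrow × Y // H.s q.1 = a.p q.2}))
        (Continuous.subtype_mk (h1.prodMk (continuous_fst.comp h2)) _)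
    · exact b.continuous_act.comp (f := fun q : {q : H.Arrow × {q : Y × B // a.p q.1 = b.p q.2} //
        H.s q.1 = a.p q.2.1.1} => (⟨(q.1.1, q.1.2.1.2), q.2.trans q.1.2.2⟩ :
          {q : H.Arrow × B // H.s q.1 = b.p q.2}))
        (Continuous.subtype_mk (h1.prodMk (continuous_snd.comp h2)) _)

end LeftAction

namespace Bispace

variable {Z : Type u} [TopologicalSpace Z] [T2Space Z] [LocallyCompactSpace Z]

/-- Orbit kernels for the exchanged groupoids are fibre kernels. -/
theorem HasOrbitKernels.hasFiberKernels [MeasurableSpace Z] [BorelSpace Z] {E : Bispace G H Z}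
    {B : Type u} [TopologicalSpace B] {b : H.LeftAction B}
    (hb : E.swap.HasOrbitKernels G.unitAction b) {Y' : Type u} [TopologicalSpace Y']
    {c : H.LeftAction Y'} {u : Y' → B} (hu : Continuous u) (hup : ∀ y, b.p (u y) = c.p y) :
    E.HasFiberKernels c := by
  intro L hL
  obtain ⟨S, ν, -, hν, hν1, -⟩ := hb _ (hL.image hu)
  refine ⟨_, _, hν.map (f := Pull.z) hu Pull.continuous_z
    (D' := fun y => {z | E.b.p z = c.p y}) ?_ ?_, fun y hy => ?_⟩
  · exact isClosed_eq (E.b.continuous_p.comp continuous_snd) (c.continuous_p.comp continuous_fst)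
  · intro y w hw
    exact Eq.trans hw (hup y)
  · rw [Measure.map_apply Pull.continuous_z.measurable MeasurableSet.univ]
    exact hν1 _ ⟨y, hy, rfl⟩

/-- Orbit kernels come from Delone functionals for `H`, and fibre kernels from Delone functionals
for the exchanged bispace, which form an `H`-space `B`. The space `B` need not be amenable: it is
only needed to make sure that fibre kernels exist over `Y ×_{H⁽⁰⁾} B`. -/
theorem amenableAtInfinity (E : Bispace G H Z) (hH : H.AmenableAtInfinity) :
    G.AmenableAtInfinity := by
  let : MeasurableSpace Z := borel Z
  have : BorelSpace Z := ⟨rfl⟩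
  obtain ⟨Y, _, _, _, a, ha, haa⟩ := hH
  obtain ⟨B, _, _, _, b, hb, hker⟩ := E.swap.exists_hasOrbitKernels G.unitAction
    (Homeomorph.refl _).isProperMap
  have hcl : IsClosed {q : Y × B | a.p q.1 = b.p q.2} :=
    isClosed_eq (a.continuous_p.comp continuous_fst) (b.continuous_p.comp continuous_snd)
  have hK : ∀ K, IsCompact K → IsCompact ((a.prod b).p ⁻¹' K) := fun K hK => by
    refine (hcl.isClosedEmbedding_subtypeVal.isCompact_preimage
      ((ha.isCompact_preimage hK).prod (hb.isCompact_preimage hK))).of_isClosed_subset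
      (hK.isClosed.preimage (a.prod b).continuous_p) fun q hq => ⟨hq, ?_⟩
    change b.p q.1.2 ∈ K
    rw [← q.2]
    exact hq
  have : LocallyCompactSpace {q : Y × B // a.p q.1 = b.p q.2} :=
    (a.prod b).locallyCompactSpace_of_proper hK
  obtain ⟨X, tX, t2X, lX, d, hd, hdk⟩ := E.exists_hasOrbitKernels (a.prod b)
    ((a.prod b).isProperMap_p hK)
  refine ⟨X, tX, t2X, lX, d, hd, isAmenable_of_kernels (E := E) (c := a.prod b) (a := a)
    (f₀ := fun q => q.1.1) (continuous_fst.comp continuous_subtype_val) (fun _ => rfl)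
    (fun h y hy => ?_) ?_ hdk haa⟩
  · rw [(a.prod b).actT_eq hy, a.actT_eq (show H.s h = a.p y.1.1 from hy)]
    rfl
  · exact hker.hasFiberKernels (u := fun q => q.1.2)
      (continuous_snd.comp continuous_subtype_val) fun q => q.2.symm

end Bispace

theorem Equivalent.amenableAtInfinity (h : Equivalent G H) (hH : H.AmenableAtInfinity) :
    G.AmenableAtInfinity := by
  obtain ⟨Z, _, _, _, ⟨E⟩⟩ := h
  exact E.toBispace.amenableAtInfinity hH

/-! ### Equivalences with a continuous section -/

namespace Bispace

variable {Z : Type u} [TopologicalSpace Z] {Y : Type u} [TopologicalSpace Y]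

/-- The cocycle of `G` with values in `H` attached to a section `σ` of the momentum map of `Z`: it
measures how far `σ` is from being `G`-equivariant. -/
noncomputable def cocycle (E : Bispace G H Z) (σ : G.Obj → Z) (g : G.Arrow) : H.Arrow :=
  E.db (σ (G.r g)) (E.a.actT g (σ (G.s g)))

section Cocycle

variable {E : Bispace G H Z} {σ : G.Obj → Z}

theorem a_p_section (hσ : ∀ x, E.a.p (σ x) = x) (g : G.Arrow) :
    E.a.p (σ (G.r g)) = E.a.p (E.a.actT g (σ (G.s g))) := by
  rw [hσ, E.a.p_actT (hσ _).symm]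

theorem s_cocycle (hσ : ∀ x, E.a.p (σ x) = x) (g : G.Arrow) :
    H.s (E.cocycle σ g) = E.b.p (σ (G.s g)) := by
  rw [cocycle, E.s_db _ _ (a_p_section hσ g), E.b_p_act _ _ (hσ _).symm]

theorem r_cocycle (hσ : ∀ x, E.a.p (σ x) = x) (g : G.Arrow) :
    H.r (E.cocycle σ g) = E.b.p (σ (G.r g)) :=
  E.r_db (a_p_section hσ g)

theorem cocycle_actT (hσ : ∀ x, E.a.p (σ x) = x) (g : G.Arrow) :
    E.b.actT (E.cocycle σ g) (E.a.actT g (σ (G.s g))) = σ (G.r g) :=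
  E.db_act _ _ (a_p_section hσ g)

theorem cocycle_e (hσ : ∀ x, E.a.p (σ x) = x) (x : G.Obj) :
    E.cocycle σ (G.e x) = H.e (E.b.p (σ x)) := by
  have h := E.a.e_actT (σ x)
  rw [hσ] at h
  rw [cocycle, G.r_e, G.s_e, h, E.db_self]

theorem cocycle_mul (hσ : ∀ x, E.a.p (σ x) = x) {g₂ g₁ : G.Arrow} (w : G.s g₂ = G.r g₁) :
    E.cocycle σ (G.mulT g₂ g₁) = H.mulT (E.cocycle σ g₂) (E.cocycle σ g₁) := by
  have e₁ : G.s g₁ = E.a.p (σ (G.s g₁)) := (hσ _).symm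
  have e₂ : G.s g₂ = E.a.p (E.a.actT g₁ (σ (G.s g₁))) := by rw [E.a.p_actT e₁, w]
  have w' : H.s (E.cocycle σ g₂) = H.r (E.cocycle σ g₁) := by
    rw [s_cocycle hσ, r_cocycle hσ, w]
  have e₃ : H.s (E.cocycle σ g₁) = E.b.p (E.a.actT g₁ (σ (G.s g₁))) := by
    rw [s_cocycle hσ, E.b_p_act _ _ e₁]
  have e₄ : H.s (E.cocycle σ g₁) = E.b.p (E.a.actT g₂ (E.a.actT g₁ (σ (G.s g₁)))) := by
    rw [e₃, E.b_p_act _ _ e₂]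
  rw [cocycle, r_mulT w, s_mulT w, E.a.mul_actT e₁ w]
  refine E.db_eq ((s_mulT w').trans e₄) ?_
  rw [E.b.mul_actT e₄ w', ← E.comm _ _ _ e₂ e₃, cocycle_actT hσ, ← w, cocycle_actT hσ]

theorem continuous_cocycle (hσc : Continuous σ) (hσ : ∀ x, E.a.p (σ x) = x) :
    Continuous (E.cocycle σ) := by
  have h1 : Continuous fun g : G.Arrow => E.a.actT g (σ (G.s g)) :=
    E.a.continuousOn_actT.comp_continuous
      (continuous_id.prodMk (hσc.comp G.continuous_s)) fun g => (hσ _).symm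
  exact E.continuousOn_db.comp_continuous ((hσc.comp G.continuous_r).prodMk h1)
    fun g => a_p_section hσ g

end Cocycle

/-- Pulling back an `H`-space along `x ↦ E.b.p (σ x)` gives a `G`-space: `G` acts through its
cocycle. -/
noncomputable def sectionAction (E : Bispace G H Z) (c : H.LeftAction Y) {σ : G.Obj → Z}
    (hσc : Continuous σ) (hσ : ∀ x, E.a.p (σ x) = x) :
    G.LeftAction {q : G.Obj × Y // E.b.p (σ q.1) = c.p q.2} where
  p q := q.1.1
  continuous_p := continuous_fst.comp continuous_subtype_val
  surjective_p x := by
    obtain ⟨y, hy⟩ := c.surjective_p (E.b.p (σ x))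
    exact ⟨⟨(x, y), hy.symm⟩, rfl⟩
  act g q w := ⟨(G.r g, c.act (E.cocycle σ g) q.1.2
    ((s_cocycle hσ g).trans ((congrArg (fun x => E.b.p (σ x)) w).trans q.2))),
    (r_cocycle hσ g).symm.trans (c.p_act _ _ _).symm⟩
  p_act _ _ _ := rfl
  e_act q := Subtype.ext (Prod.ext (G.r_e _)
    ((c.act_congr ((cocycle_e hσ _).trans (congrArg H.e q.2)) rfl _ (H.s_e _)).trans (c.e_act _)))
  mul_act g₂ g₁ q w w' := Subtype.ext (Prod.ext (G.r_mul _ _ _) <| by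
    have e : H.s (E.cocycle σ g₂) = H.r (E.cocycle σ g₁) := by
      rw [s_cocycle hσ, r_cocycle hσ, w']
    have e' : H.s (E.cocycle σ g₁) = c.p q.1.2 :=
      (s_cocycle hσ g₁).trans ((congrArg (fun x => E.b.p (σ x)) w).trans q.2)
    refine (c.act_congr ?_ rfl _ ((H.s_mul _ _ e).trans e')).trans (c.mul_act _ _ _ e' e)
    rw [← mulT_eq w', cocycle_mul hσ w', mulT_eq e])
  continuous_act := by
    refine Continuous.subtype_mk (Continuous.prodMk
      (G.continuous_r.comp (continuous_fst.comp continuous_subtype_val)) ?_) _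
    refine c.continuous_act.comp (f := fun q : {q : G.Arrow ×
      {q : G.Obj × Y // E.b.p (σ q.1) = c.p q.2} // G.s q.1 = q.2.1.1} =>
      (⟨(E.cocycle σ q.1.1, q.1.2.1.2), (s_cocycle hσ _).trans
        ((congrArg (fun x => E.b.p (σ x)) q.2).trans q.1.2.2)⟩ :
        {q : H.Arrow × Y // H.s q.1 = c.p q.2})) (Continuous.subtype_mk ?_ _)
    exact ((continuous_cocycle hσc hσ).comp (continuous_fst.comp continuous_subtype_val)).prodMk
      (continuous_snd.comp (continuous_subtype_val.comp
        (continuous_snd.comp continuous_subtype_val)))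

variable [T2Space Z] [LocallyCompactSpace Z] [T2Space Y] [LocallyCompactSpace Y]

omit [T2Space Z] [LocallyCompactSpace Z] [T2Space Y] [LocallyCompactSpace Y] in
theorem isCompact_sectionAction (E : Bispace G H Z) {c : H.LeftAction Y} (hc : IsProperMap c.p)
    {σ : G.Obj → Z} (hσc : Continuous σ) (hσ : ∀ x, E.a.p (σ x) = x) {K : Set G.Obj}
    (hK : IsCompact K) : IsCompact ((E.sectionAction c hσc hσ).p ⁻¹' K) := by
  have hcl : IsClosed {q : G.Obj × Y | E.b.p (σ q.1) = c.p q.2} :=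
    isClosed_eq (E.b.continuous_p.comp (hσc.comp continuous_fst))
      (c.continuous_p.comp continuous_snd)
  refine (hcl.isClosedEmbedding_subtypeVal.isCompact_preimage
    (hK.prod (hc.isCompact_preimage (hK.image (E.b.continuous_p.comp hσc))))).of_isClosed_subset
    (hK.isClosed.preimage (E.sectionAction c hσc hσ).continuous_p) fun q hq => ⟨hq, q.1.1, hq, q.2⟩

omit [LocallyCompactSpace Z] [LocallyCompactSpace Y] in
/-- The Dirac measures at the points of the section are kernels on orbits. -/
theorem hasOrbitKernels_sectionAction (E : Bispace G H Z) {c : H.LeftAction Y}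
    (hc : IsProperMap c.p) {σ : G.Obj → Z} (hσc : Continuous σ) (hσ : ∀ x, E.a.p (σ x) = x) :
    E.HasOrbitKernels c (E.sectionAction c hσc hσ) := by
  have : LocallyCompactSpace {q : G.Obj × Y // E.b.p (σ q.1) = c.p q.2} :=
    (E.sectionAction c hσc hσ).locallyCompactSpace_of_proper fun K hK =>
      E.isCompact_sectionAction hc hσc hσ hK
  intro L hL
  obtain ⟨χ, hχ1, -, hχ0, hχle⟩ := hL.exists_cutoff isOpen_univ (subset_univ _)
  let w : {q : G.Obj × Y // E.b.p (σ q.1) = c.p q.2} → E.Pull c := fun q =>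
    Pull.mk (σ q.1.1) q.1.2 q.2
  have hw : Continuous w := continuousOn_univ.mp (Pull.continuousOn_mk
    (hσc.comp (continuous_fst.comp continuous_subtype_val)).continuousOn
    (continuous_snd.comp continuous_subtype_val).continuousOn)
  have hS := χ.hasCompactSupport.isCompact.image hw
  have hcl : IsClosed {q : {q : G.Obj × Y // E.b.p (σ q.1) = c.p q.2} × E.Pull c |
      E.a.p q.2.z = q.1.1.1} :=
    isClosed_eq (E.a.continuous_p.comp (Pull.continuous_z.comp continuous_snd))
      (continuous_fst.comp (continuous_subtype_val.comp continuous_fst))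
  have hae : ∀ (ξ) (P : E.Pull c → Prop), (χ ξ ≠ 0 → P (w ξ)) → MeasurableSet {v | P v} →
      ∀ᵐ v ∂(ENNReal.ofReal (χ ξ) • Measure.dirac (w ξ)), P v := by
    intro ξ P hP hPm
    by_cases h : χ ξ = 0
    · rw [h, ENNReal.ofReal_zero, zero_smul]
      exact ae_zero ▸ eventually_bot
    · exact Measure.ae_smul_measure ((ae_dirac_iff hPm).mpr (hP h)) _
  refine ⟨_, fun ξ => ENNReal.ofReal (χ ξ) • Measure.dirac (w ξ),
    fun ξ => {v | E.Orb c v (w ξ)}, ⟨hS, hcl, fun ξ => ?_, fun ξ => ?_, fun f => ?_⟩,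
    fun ξ hξ => ?_,
    fun ξ => ?_, fun ξ v hv v' hv' => hv.trans hv'.symm, fun g ξ hg v hv hvp => ?_⟩
  · refine hae ξ _ (fun h => ⟨⟨ξ, subset_tsupport _ h, rfl⟩, hσ _⟩) ?_
    exact (hS.isClosed.inter (hcl.preimage
      (continuous_const.prodMk continuous_id : Continuous fun v => (ξ, v)))).measurableSet
  · simpa using hχle ξ
  · simp only [integral_smul_measure, integral_dirac, ENNReal.toReal_ofReal (hχ0 _), smul_eq_mul]
    exact χ.continuous.mul (f.continuous.comp hw)
  · simp [hχ1 ξ hξ]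
  · refine hae ξ _ (fun _ => Orb.refl _) ?_
    exact ((isClosed_orb (E := E) (c := c)).preimage
      (continuous_id.prodMk continuous_const : Continuous fun v => (v, w ξ))).measurableSet
  · have hgw : G.s g = E.a.p (w ξ).z := hg.trans (hσ _).symm
    have hv' : E.Orb c v (w ξ) := hv
    refine (hv'.act (hg.trans hvp.symm)).trans ?_
    have e : H.s (E.cocycle σ g) = c.p ((E.pullG c).actT g (w ξ)).y := by
      rw [pullG_y hgw, s_cocycle hσ, hg]
      exact ξ.2
    have h1 := orb_of_act e
    have h2 : (E.pullH c).actT (E.cocycle σ g) ((E.pullG c).actT g (w ξ)) =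
        w ((E.sectionAction c hσc hσ).actT g ξ) := by
      rw [(E.sectionAction c hσc hσ).actT_eq hg]
      ext
      · rw [pullH_z e, pullG_z hgw]
        have h3 := cocycle_actT hσ g
        rw [hg] at h3
        exact h3
      · rw [pullH_y e, pullG_y hgw]
        exact c.actT_eq _
    rw [h2] at h1
    exact h1.symm

omit [T2Space Z] [LocallyCompactSpace Z] [T2Space Y] [LocallyCompactSpace Y] in
theorem HasFiberKernels.of_unitAction [MeasurableSpace Z] {E : Bispace G H Z}
    (h : E.HasFiberKernels H.unitAction) (c : H.LeftAction Y) : E.HasFiberKernels c := by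
  intro L hL
  obtain ⟨S, ρ, hρ, hρ1⟩ := h _ (hL.image c.continuous_p)
  refine ⟨S, fun y => ρ (c.p y), ⟨hρ.isCompact, ?_, fun y => hρ.mem _, fun y => hρ.mass _,
    fun f => (hρ.cont f).comp c.continuous_p⟩, fun y hy => hρ1 _ ⟨y, hy, rfl⟩⟩
  exact hρ.isClosed.preimage ((c.continuous_p.comp continuous_fst).prodMk continuous_snd)

/-- The amenable `G`-space is the pullback of the amenable `H`-space along the section; a section of
the latter pulls back to a section of the former. -/
theorem stronglyAmenableAtInfinity [MeasurableSpace Z] [BorelSpace Z] (E : Bispace G H Z)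
    {σ : G.Obj → Z} (hσc : Continuous σ) (hσ : ∀ x, E.a.p (σ x) = x)
    (hfib : E.HasFiberKernels H.unitAction) (hH : H.StronglyAmenableAtInfinity) :
    G.StronglyAmenableAtInfinity := by
  obtain ⟨Y, _, _, _, c, hc, hca, τ, hτc, hτ⟩ := hH
  have hK := fun K hK => E.isCompact_sectionAction hc hσc hσ (K := K) hK
  have : LocallyCompactSpace {q : G.Obj × Y // E.b.p (σ q.1) = c.p q.2} :=
    (E.sectionAction c hσc hσ).locallyCompactSpace_of_proper hK
  refine ⟨_, inferInstance, inferInstance, this, E.sectionAction c hσc hσ,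
    (E.sectionAction c hσc hσ).isProperMap_p hK, isAmenable_of_kernels (E := E) (c := c) (a := c)
    (f₀ := id) continuous_id (fun _ => rfl) (fun _ _ _ => rfl) (hfib.of_unitAction c)
    (E.hasOrbitKernels_sectionAction hc hσc hσ) hca,
    fun x => ⟨(x, τ (E.b.p (σ x))), (hτ _).symm⟩, ?_, fun x => rfl⟩
  exact Continuous.subtype_mk
    (continuous_id.prodMk (hτc.comp (E.b.continuous_p.comp hσc))) _

/-! ### Fibre kernels from a Haar system -/

section Haar

variable {E : Bispace G H Z}

omit [T2Space Z] [LocallyCompactSpace Z] in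
theorem exists_compactlySupported_orbit (E : Bispace G H Z) (F : C_c(Z, ℝ)) (z : Z) :
    ∃ f : C_c(G.Arrow, ℝ), ∀ g, G.r g = E.a.p z → f g = F (E.a.actT (G.inv g) z) := by
  have hT : IsClosed {g | G.r g = E.a.p z} := isClosed_eq G.continuous_r continuous_const
  have hK : IsCompact ((fun z' => E.da z z') '' (tsupport F ∩ {z' | E.b.p z = E.b.p z'})) :=
    (F.hasCompactSupport.isCompact.inter_right
      (isClosed_eq continuous_const E.b.continuous_p)).image_of_continuousOn
      (E.continuousOn_da.comp (f := fun z' => (z, z')) (continuous_const.prodMk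
        continuous_id).continuousOn fun z' hz' => hz'.2)
  obtain ⟨f, hf⟩ := hT.exists_compactlySupported_eqOn (f := fun g => F (E.a.actT (G.inv g) z))
    (F.continuous.comp_continuousOn (E.a.continuousOn_actT.comp (f := fun g => (G.inv g, z))
      (G.continuous_inv.prodMk continuous_const).continuousOn
      fun g hg => (G.s_inv g).trans hg)) hK fun g hg hne => by
      have h1 : G.s (G.inv g) = E.a.p z := (G.s_inv g).trans hg
      refine ⟨_, ⟨subset_tsupport _ hne, (E.b_p_act _ _ h1).symm⟩, ?_⟩
      refine E.da_eq ?_ (E.a.actT_inv_actT hg)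
      rw [E.a.p_actT h1, G.r_inv]
  exact ⟨f, fun g hg => hf hg⟩

variable {lam : (x : G.Obj) → Measure (G.Fiber x)}

/-- The integral of a function on `Z` over the `G`-orbit of `z`. -/
noncomputable def haarIntegral (E : Bispace G H Z) (lam : (x : G.Obj) → Measure (G.Fiber x))
    (F : Z → ℝ) (z : Z) : ℝ :=
  ∫ g, F (E.a.actT (G.inv g.1) z) ∂(lam (E.a.p z))

omit [T2Space Z] [LocallyCompactSpace Z] in
theorem integrable_haarIntegral (hreg : ∀ x, (lam x).Regular) (F : C_c(Z, ℝ)) (z : Z) :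
    Integrable (fun g : G.Fiber (E.a.p z) => F (E.a.actT (G.inv g.1) z)) (lam (E.a.p z)) := by
  have := hreg (E.a.p z)
  obtain ⟨f, hf⟩ := E.exists_compactlySupported_orbit F z
  refine ((G.restrictFiber f (E.a.p z)).continuous.integrable_of_hasCompactSupport
    (G.restrictFiber f (E.a.p z)).hasCompactSupport).congr (ae_of_all _ fun g => ?_)
  exact hf g.1 g.2

omit [T2Space Z] in
theorem continuous_haarIntegral (hreg : ∀ x, (lam x).Regular)
    (hcont : ∀ f : C_c(G.Arrow, ℝ), Continuous fun x => ∫ g, f g.1 ∂(lam x)) (F : C_c(Z, ℝ)) :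
    Continuous (E.haarIntegral lam F) := by
  refine continuous_integral_fiber (K := G) (μ := lam) (fun x => by have := hreg x; infer_instance)
    hcont (P := Z) (u := E.a.p) (F := fun z g => F (E.a.actT (G.inv g) z)) E.a.continuous_p ?_
    fun z₀ => ?_
  · exact F.continuous.comp_continuousOn (E.a.continuousOn_actT.comp
      (f := fun q : Z × G.Arrow => (G.inv q.2, q.1))
      ((G.continuous_inv.comp continuous_snd).prodMk continuous_fst).continuousOn
      fun q hq => (G.s_inv _).trans hq)
  · obtain ⟨B, hB, hB₀⟩ := exists_compact_mem_nhds z₀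
    refine ⟨(fun q : Z × Z => E.da q.1 q.2) '' (B ×ˢ tsupport F ∩ {q | E.b.p q.1 = E.b.p q.2}),
      ?_, mem_of_superset hB₀ fun z hz g hg hne => ?_⟩
    · exact ((hB.prod F.hasCompactSupport.isCompact).inter_right
        (isClosed_eq (E.b.continuous_p.comp continuous_fst)
          (E.b.continuous_p.comp continuous_snd))).image_of_continuousOn
        (E.continuousOn_da.mono inter_subset_right)
    · have h1 : G.s (G.inv g) = E.a.p z := (G.s_inv g).trans hg
      refine ⟨(z, E.a.actT (G.inv g) z), ⟨⟨hz, subset_tsupport _ hne⟩, (E.b_p_act _ _ h1).symm⟩, ?_⟩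
      refine E.da_eq ?_ (E.a.actT_inv_actT hg)
      rw [E.a.p_actT h1, G.r_inv]

omit [T2Space Z] [LocallyCompactSpace Z] in
/-- By invariance of the Haar system, the integral over an orbit does not depend on the point by
which the orbit is given. -/
theorem haarIntegral_eq
    (hinv : ∀ (γ : G.Arrow) (f : C_c(G.Arrow, ℝ)),
      ∫ g, f (G.translate γ g).1 ∂(lam (G.s γ)) = ∫ g, f g.1 ∂(lam (G.r γ)))
    (F : C_c(Z, ℝ)) {z z' : Z} (h : E.b.p z = E.b.p z') :
    E.haarIntegral lam F z = E.haarIntegral lam F z' := by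
  obtain ⟨g, hg, rfl⟩ : ∃ g, G.s g = E.a.p z' ∧ E.a.actT g z' = z :=
    ⟨E.da z z', E.s_da _ _ h, E.da_act _ _ h⟩
  obtain ⟨f, hf⟩ := E.exists_compactlySupported_orbit F (E.a.actT g z')
  have hr : G.r g = E.a.p (E.a.actT g z') := (E.a.p_actT hg).symm
  have h1 : E.haarIntegral lam F (E.a.actT g z') =
      ∫ k, f k.1 ∂(lam (E.a.p (E.a.actT g z'))) :=
    integral_congr_ae (ae_of_all _ fun k => (hf k.1 k.2).symm)
  have h2 : E.haarIntegral lam F z' = ∫ k, F (E.a.actT (G.inv k.1) z') ∂(lam (G.s g)) := by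
    rw [haarIntegral, hg]
  rw [h1, h2, ← hr, ← hinv g f]
  refine integral_congr_ae (ae_of_all _ fun k => ?_)
  have hk : G.s g = G.r k.1 := k.2.symm
  change f (G.mul g k.1 hk) = F (E.a.actT (G.inv k.1) z')
  rw [hf _ ((G.r_mul _ _ _).trans hr), G.inv_mul_rev]
  have w : G.s (G.inv k.1) = G.r (G.inv g) :=
    (G.s_inv _).trans (hk.symm.trans (G.r_inv g).symm)
  rw [← mulT_eq w, E.a.mul_actT ((G.s_inv g).trans hr) w, E.a.inv_actT_actT hg]

/-- A Haar system of `G` gives kernels on the fibres of `Z → H⁽⁰⁾`, which are `G`-orbits. -/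
theorem hasFiberKernels_of_hasHaarSystem [MeasurableSpace Z] [BorelSpace Z] (E : Bispace G H Z)
    (hG : G.HasHaarSystem) : E.HasFiberKernels H.unitAction := by
  obtain ⟨lam, hlam, hcont, hinv⟩ := hG
  have hreg := fun x => (hlam x).1
  intro L hL
  have hL' : IsCompact L := hL
  obtain ⟨S, hS, hLS⟩ := E.swap.exists_isCompact_image hL'
  obtain ⟨k, hk1, -, hk0, hkle⟩ := hS.exists_cutoff isOpen_univ (subset_univ _)
  choose ζ hζ using E.b.surjective_p
  -- The integral over an orbit, as a function of the orbit.
  let I : C_c(Z, ℝ) → H.Obj → ℝ := fun F v => E.haarIntegral lam F (ζ v)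
  have hI : ∀ F z, I F (E.b.p z) = E.haarIntegral lam F z := fun F z =>
    haarIntegral_eq hinv F (hζ _)
  have hIc : ∀ F, Continuous (I F) := fun F => by
    rw [(E.isOpenMap_b.isQuotientMap E.b.continuous_p E.b.surjective_p).continuous_iff]
    exact (continuous_haarIntegral hreg hcont F).congr fun z => (hI F z).symm
  have hIadd : ∀ F F' v, I (F + F') v = I F v + I F' v := fun F F' v =>
    integral_add (integrable_haarIntegral hreg F (ζ v)) (integrable_haarIntegral hreg F' (ζ v))
  have hIsmul : ∀ (r : ℝ) F v, I (r • F) v = r * I F v := fun r F v => integral_const_mul _ _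
  have hInonneg : ∀ (F : C_c(Z, ℝ)) v, (∀ z, E.b.p z = v → 0 ≤ F z) → 0 ≤ I F v := fun F v h =>
    integral_nonneg fun g => h _ <|
      (E.b_p_act _ _ ((G.s_inv _).trans g.2)).trans (hζ v)
  have hIk : ∀ v ∈ L, 0 < I k v := by
    intro v hv
    obtain ⟨z, hz, hzv⟩ := hLS hv
    obtain rfl : E.b.p z = v := hzv
    rw [hI k z]
    obtain ⟨f, hf⟩ := E.exists_compactlySupported_orbit k z
    have : (lam (E.a.p z)).IsOpenPosMeasure := (hlam _).2
    have := hreg (E.a.p z)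
    have h1 : 0 < ∫ g, G.restrictFiber f (E.a.p z) g ∂(lam (E.a.p z)) := by
      refine Continuous.integral_pos_of_hasCompactSupport_nonneg_nonzero
        (x := ⟨G.e (E.a.p z), G.r_e _⟩) (G.restrictFiber f (E.a.p z)).continuous
        (G.restrictFiber f (E.a.p z)).hasCompactSupport (fun g => ?_) ?_
      · change 0 ≤ f g.1
        rw [hf g.1 g.2]
        exact hk0 _
      · change f (G.e (E.a.p z)) ≠ 0
        rw [hf _ (G.r_e _), G.inv_e, E.a.e_actT, hk1 _ (interior_subset hz)]
        exact one_ne_zero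
    refine h1.trans_eq (integral_congr_ae (ae_of_all _ fun g => ?_))
    exact hf g.1 g.2
  obtain ⟨δ, hδ, hδL⟩ : ∃ δ > 0, ∀ v ∈ L, δ ≤ I k v := by
    obtain rfl | hne := L.eq_empty_or_nonempty
    · exact ⟨1, one_pos, by simp⟩
    · obtain ⟨v, hv, hmin⟩ := hL'.exists_isMinOn hne (hIc k).continuousOn
      exact ⟨_, hIk v hv, fun v' hv' => hmin hv'⟩
  have hpos : ∀ v, 0 < max (I k v) δ := fun v => lt_max_of_lt_right hδ
  let Λ : H.Obj → C_c(Z, ℝ) →ₗ[ℝ] ℝ := fun v =>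
    { toFun := fun F => I (F * k) v / max (I k v) δ
      map_add' := fun F F' => by rw [add_mul, hIadd, add_div]
      map_smul' := fun r F => by
        rw [smul_mul_assoc, hIsmul, mul_div_assoc, RingHom.id_apply, smul_eq_mul] }
  have hone : ∀ v (F : C_c(Z, ℝ)), (∀ z ∈ tsupport k, F z = 1) →
      Λ v F = I k v / max (I k v) δ := by
    intro v F hF
    have : F * k = k := by
      ext z
      rw [CompactlySupportedContinuousMap.mul_apply]
      by_cases hz : z ∈ tsupport k
      · rw [hF z hz, one_mul]
      · rw [image_eq_zero_of_notMem_tsupport hz, mul_zero]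
    change I (F * k) v / max (I k v) δ = _
    rw [this]
  obtain ⟨ρ, hρ, -, hρ1, -⟩ := IsKernel.exists_of_functional
    (D := fun v : H.Obj => {z : Z | E.b.p z = v}) k.hasCompactSupport.isCompact
    (isClosed_eq (E.b.continuous_p.comp continuous_snd) continuous_fst) Λ
    (fun v F hF => by
      refine div_nonneg (hInonneg _ v fun z hz => ?_) (hpos v).le
      rw [CompactlySupportedContinuousMap.mul_apply]
      by_cases hz' : z ∈ tsupport k
      · exact mul_nonneg (hF z hz' hz) (hk0 z)
      · rw [image_eq_zero_of_notMem_tsupport hz', mul_zero])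
    (fun v F hF => by
      rw [hone v F hF]
      exact div_le_one_of_le₀ (le_max_left _ _) (hpos v).le)
    (fun F => (hIc (F * k)).div ((hIc k).max continuous_const) fun v => (hpos v).ne')
  refine ⟨_, ρ, hρ, fun v hv => hρ1 v fun F hF => ?_⟩
  rw [hone v F hF, max_eq_left (hδL v hv), div_self (hIk v hv).ne']

end Haar

end Bispace

end LCGroupoid

/-! ### Fibre kernels for metrizable spaces -/

theorem exists_continuous_pos_iff_mem {V : Type*} [TopologicalSpace V]
    [TopologicalSpace.MetrizableSpace V] {O : Set V} (hO : IsOpen O) :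
    ∃ g : V → ℝ, Continuous g ∧ (∀ v, 0 ≤ g v) ∧ ∀ v, 0 < g v ↔ v ∈ O := by
  let := TopologicalSpace.metrizableSpaceMetric V
  by_cases h : (Oᶜ).Nonempty
  · refine ⟨fun v => Metric.infDist v Oᶜ, Metric.continuous_infDist_pt _,
      fun v => Metric.infDist_nonneg, fun v => ?_⟩
    rw [← hO.isClosed_compl.notMem_iff_infDist_pos h, notMem_compl_iff]
  · rw [not_nonempty_iff_eq_empty, compl_empty_iff] at h
    exact ⟨fun _ => 1, continuous_const, fun _ => zero_le_one, fun v => by simp [h]⟩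

/-- A finite family of open subsets `U i` of `S` and of continuous weights `w i` on the base, adding
up to `w₀`, such that every set with a non-zero weight at `v` meets the fibre over `v`. The points
`pt i` are representatives of the sets `U i`. With the weights at `v`, they stand for a measure
which is close to the fibre over `v` when the sets are small. -/
structure WeightedFamily {Z V : Type u} [TopologicalSpace Z] [TopologicalSpace V] (p : Z → V)
    (S : Set Z) (w₀ : V → ℝ) where
  ι : Type u
  [fintype : Fintype ι]
  U : ι → Set Z
  pt : ι → Z
  w : ι → V → ℝ
  isOpen : ∀ i, IsOpen (U i)
  subset : ∀ i, U i ⊆ S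
  pt_mem : ∀ i, (U i).Nonempty → pt i ∈ U i
  continuous : ∀ i, Continuous (w i)
  nonneg : ∀ i v, 0 ≤ w i v
  exists_mem : ∀ i v, w i v ≠ 0 → ∃ z ∈ U i, p z = v
  sum : ∀ v, ∑ i, w i v = w₀ v

namespace WeightedFamily

attribute [instance] WeightedFamily.fintype

variable {Z V : Type u} [TopologicalSpace Z] [TopologicalSpace V] {p : Z → V}
  {S : Set Z} {w₀ : V → ℝ}

/-- The sum of the values of `F` at the representatives, with the weights at `v`. -/
def eval (s : WeightedFamily p S w₀) (F : Z → ℝ) (v : V) : ℝ := ∑ i, s.w i v * F (s.pt i)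

/-- `s'` is obtained from `s` by distributing the weight of each set of `s` among subsets. -/
def Refines (s s' : WeightedFamily p S w₀) : Prop :=
  ∃ π : s'.ι → s.ι, (∀ j, s'.U j ⊆ s.U (π j)) ∧
    ∀ (φ : s.ι → ℝ) v, ∑ j, s'.w j v * φ (π j) = ∑ i, s.w i v * φ i

theorem Refines.refl (s : WeightedFamily p S w₀) : s.Refines s :=
  ⟨id, fun _ => Subset.rfl, fun _ _ => rfl⟩

theorem Refines.trans {s s' s'' : WeightedFamily p S w₀} (h : s.Refines s') (h' : s'.Refines s'') :
    s.Refines s'' := by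
  obtain ⟨π, hπ, hs⟩ := h
  obtain ⟨π', hπ', hs'⟩ := h'
  exact ⟨π ∘ π', fun j => (hπ' j).trans (hπ _), fun φ v => (hs' (φ ∘ π) v).trans (hs φ v)⟩

theorem Refines.abs_eval_sub_le {s s' : WeightedFamily p S w₀} (h : s.Refines s') {F : Z → ℝ}
    {ε : ℝ} (hF : ∀ i, ∀ x ∈ s.U i, ∀ y ∈ s.U i, |F x - F y| ≤ ε) (v : V) :
    |s'.eval F v - s.eval F v| ≤ ε * w₀ v := by
  obtain ⟨π, hπ, hs⟩ := h
  rw [eval, eval, ← hs (fun i => F (s.pt i)), ← Finset.sum_sub_distrib, ← s'.sum, Finset.mul_sum]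
  refine (Finset.abs_sum_le_sum_abs _ _).trans (Finset.sum_le_sum fun j _ => ?_)
  rw [← mul_sub, abs_mul, abs_of_nonneg (s'.nonneg j v), mul_comm]
  by_cases hw : s'.w j v = 0
  · simp [hw]
  · obtain ⟨z, hz, -⟩ := s'.exists_mem j v hw
    exact mul_le_mul_of_nonneg_right (hF (π j) _ (hπ j (s'.pt_mem j ⟨z, hz⟩)) _
      (s.pt_mem (π j) ⟨z, hπ j hz⟩)) (s'.nonneg j v)

/-- Small refinements exist: the weight of `U i` is distributed among the intersections of `U i`
with the balls of a finite cover, in proportion to functions which are positive exactly on the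
images of these intersections. -/
theorem exists_refines {Z V : Type u} [MetricSpace Z] [TopologicalSpace V]
    [TopologicalSpace.MetrizableSpace V] {p : Z → V} (hpo : IsOpenMap p) {S : Set Z}
    (hS : IsCompact S) {w₀ : V → ℝ} (s : WeightedFamily p S w₀) {ε : ℝ} (hε : 0 < ε) :
    ∃ s' : WeightedFamily p S w₀, s.Refines s' ∧
      ∀ j, ∀ x ∈ s'.U j, ∀ y ∈ s'.U j, dist x y < ε := by
  classical
  obtain ⟨t, -, ht⟩ := hS.elim_nhds_subcover (fun z => Metric.ball z (ε / 2))
    fun z _ => Metric.ball_mem_nhds z (half_pos hε)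
  have hUo : ∀ q : s.ι × t, IsOpen (s.U q.1 ∩ Metric.ball q.2.1 (ε / 2)) := fun q =>
    (s.isOpen _).inter Metric.isOpen_ball
  choose g hgc hg0 hg using fun q : s.ι × t => exists_continuous_pos_iff_mem (hpo _ (hUo q))
  have hsum0 : ∀ i v, 0 ≤ ∑ b : t, g (i, b) v := fun i v => Finset.sum_nonneg fun b _ => hg0 _ v
  have hsum : ∀ i v, s.w i v ≠ 0 → 0 < ∑ b : t, g (i, b) v := by
    intro i v hw
    obtain ⟨z, hz, rfl⟩ := s.exists_mem i v hw
    obtain ⟨b, hb, hzb⟩ := mem_iUnion₂.mp (ht (s.subset i hz))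
    exact ((hg (i, ⟨b, hb⟩) (p z)).mpr ⟨z, ⟨hz, hzb⟩, rfl⟩).trans_le
      (Finset.single_le_sum (f := fun b : t => g (i, b) (p z)) (fun b _ => hg0 _ _)
        (Finset.mem_univ _))
  have hfrac : ∀ q : s.ι × t, ∀ v, g q v / ∑ b : t, g (q.1, b) v ≤ 1 := fun q v =>
    div_le_one_of_le₀ (Finset.single_le_sum (f := fun b : t => g (q.1, b) v) (fun b _ => hg0 _ _)
      (Finset.mem_univ q.2)) (hsum0 _ v)
  have hdistr : ∀ i v, ∑ b : t, s.w i v * (g (i, b) v / ∑ c : t, g (i, c) v) = s.w i v := by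
    intro i v
    rw [← Finset.mul_sum, ← Finset.sum_div]
    by_cases hw : s.w i v = 0
    · rw [hw, zero_mul]
    · rw [div_self (hsum i v hw).ne', mul_one]
  let s' : WeightedFamily p S w₀ :=
    { ι := s.ι × t
      U := fun q => s.U q.1 ∩ Metric.ball q.2.1 (ε / 2)
      pt := fun q => if h : (s.U q.1 ∩ Metric.ball q.2.1 (ε / 2)).Nonempty then h.choose
        else s.pt q.1
      w := fun q v => s.w q.1 v * (g q v / ∑ b : t, g (q.1, b) v)
      isOpen := hUo
      subset := fun q => inter_subset_left.trans (s.subset q.1)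
      pt_mem := fun q h => by
        rw [dif_pos h]
        exact h.choose_spec
      continuous := fun q => by
        rw [continuous_iff_continuousAt]
        intro v
        by_cases hw : s.w q.1 v = 0
        · -- Where the denominator may vanish, the weight is squeezed between zero and `s.w`.
          have h1 : Tendsto (s.w q.1) (𝓝 v) (𝓝 0) := by
            rw [← hw]
            exact (s.continuous q.1).continuousAt
          rw [ContinuousAt, hw, zero_mul]
          exact squeeze_zero (fun v => mul_nonneg (s.nonneg _ v) (div_nonneg (hg0 q v) (hsum0 _ v)))
            (fun v => mul_le_of_le_one_right (s.nonneg _ v) (hfrac q v)) h1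
        · exact (s.continuous q.1).continuousAt.mul ((hgc q).continuousAt.div
            (continuous_finsetSum _ fun b _ => hgc (q.1, b)).continuousAt (hsum q.1 v hw).ne')
      nonneg := fun q v => mul_nonneg (s.nonneg _ v) (div_nonneg (hg0 q v) (hsum0 _ v))
      exists_mem := fun q v hw => (hg q v).mp <| lt_of_le_of_ne (hg0 q v) fun h => hw <| by
        rw [← h, zero_div, mul_zero]
      sum := fun v => by
        rw [← s.sum, Fintype.sum_prod_type]
        exact Finset.sum_congr rfl fun i _ => hdistr i v }
  refine ⟨s', ⟨Prod.fst, fun q => inter_subset_left, fun φ v => ?_⟩, fun q x hx y hy => ?_⟩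
  · change ∑ q : s.ι × t, s.w q.1 v * (g q v / ∑ b : t, g (q.1, b) v) * φ q.1 = _
    rw [Fintype.sum_prod_type]
    exact Finset.sum_congr rfl fun i _ => by
      rw [← hdistr i v, Finset.sum_mul]
  · calc dist x y ≤ dist x q.2.1 + dist y q.2.1 := dist_triangle_right _ _ _
      _ < ε / 2 + ε / 2 := add_lt_add hx.2 hy.2
      _ = ε := add_halves ε

end WeightedFamily

/-- An open continuous map between metrizable spaces has continuous families of probability measures
on its fibres, over compact sets which lift to the interior of compact sets. The measures are limits
of the finitely supported measures of a sequence of weighted families with finer and finer sets. -/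
theorem exists_isKernel_of_metrizable {Z V : Type u} [TopologicalSpace Z] [LocallyCompactSpace Z]
    [TopologicalSpace.MetrizableSpace Z] [MeasurableSpace Z] [BorelSpace Z] [TopologicalSpace V]
    [LocallyCompactSpace V] [TopologicalSpace.MetrizableSpace V] {p : Z → V} (hp : Continuous p)
    (hpo : IsOpenMap p) {S : Set Z} (hS : IsCompact S) {L : Set V} (hL : IsCompact L)
    (hLS : L ⊆ p '' interior S) :
    ∃ ρ : V → Measure Z, IsKernel (fun v => {z | p z = v}) S ρ ∧ ∀ v ∈ L, ρ v univ = 1 := by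
  let := TopologicalSpace.metrizableSpaceMetric Z
  have hcl : IsClosed {q : V × Z | q.2 ∈ {z | p z = q.1}} :=
    isClosed_eq (hp.comp continuous_snd) continuous_fst
  obtain hZ | hZ := isEmpty_or_nonempty Z
  · refine ⟨fun _ => 0, ⟨hS, hcl, fun _ => by simp, fun _ => by simp, fun f => ?_⟩, fun v hv => ?_⟩
    · simp only [integral_zero_measure]
      exact continuous_const
    · obtain ⟨z, -⟩ := hLS hv
      exact hZ.elim z
  obtain ⟨w₀, hw1, hw0, hwn, hwle⟩ := hL.exists_cutoff (hpo _ isOpen_interior) hLS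
  let s₀ : WeightedFamily p S w₀ :=
    { ι := PUnit
      U := fun _ => interior S
      pt := fun _ => Classical.epsilon fun z => z ∈ interior S
      w := fun _ => w₀
      isOpen := fun _ => isOpen_interior
      subset := fun _ => interior_subset
      pt_mem := fun _ h => Classical.epsilon_spec h
      continuous := fun _ => w₀.continuous
      nonneg := fun _ => hwn
      exists_mem := fun _ v hw => not_imp_comm.mp (hw0 v) hw
      sum := fun v => by simp }
  choose R hR hRd using fun (n : ℕ) (s : WeightedFamily p S w₀) =>
    s.exists_refines hpo hS (Nat.one_div_pos_of_nat (α := ℝ) (n := n))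
  let s : ℕ → WeightedFamily p S w₀ := fun n => Nat.rec s₀ R n
  have hs : ∀ n, (s n).Refines (s (n + 1)) := fun n => hR n (s n)
  have hsle : ∀ n m, n ≤ m → (s n).Refines (s m) := fun n m h => by
    induction m, h using Nat.le_induction with
    | base => exact WeightedFamily.Refines.refl _
    | succ m _ ih => exact ih.trans (hs m)
  have hosc : ∀ (F : C_c(Z, ℝ)) (ε : ℝ), 0 < ε → ∃ N, ∀ n ≥ N, ∀ i, ∀ x ∈ (s n).U i,
      ∀ y ∈ (s n).U i, |F x - F y| ≤ ε := by
    intro F ε hε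
    obtain ⟨δ, hδ, hδF⟩ := Metric.uniformContinuousOn_iff.mp
      (hS.uniformContinuousOn_of_continuous F.continuous.continuousOn) ε hε
    obtain ⟨N, hN⟩ := exists_nat_one_div_lt hδ
    refine ⟨N + 1, fun n hn i x hx y hy => ?_⟩
    obtain ⟨n, rfl⟩ : ∃ m, n = m + 1 := ⟨n - 1, by omega⟩
    have h1 : dist x y < 1 / ((n : ℝ) + 1) := hRd n (s n) i x hx y hy
    have h2 : 1 / ((n : ℝ) + 1) ≤ 1 / ((N : ℝ) + 1) := by
      have : (N : ℝ) ≤ n := by exact_mod_cast Nat.le_of_succ_le_succ hn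
      gcongr
    exact (hδF x ((s (n + 1)).subset i hx) y ((s (n + 1)).subset i hy)
      ((h1.trans_le h2).trans hN)).le
  have hcau : ∀ (F : C_c(Z, ℝ)) (ε : ℝ), 0 < ε → ∃ N, ∀ n ≥ N, ∀ m ≥ n, ∀ v,
      |(s m).eval F v - (s n).eval F v| ≤ ε := by
    intro F ε hε
    obtain ⟨N, hN⟩ := hosc F ε hε
    exact ⟨N, fun n hn m hm v => ((hsle n m hm).abs_eval_sub_le (hN n hn) v).trans
      (mul_le_of_le_one_right hε.le (hwle v))⟩
  have hex : ∀ (F : C_c(Z, ℝ)) (v : V), ∃ l, Tendsto (fun n => (s n).eval F v) atTop (𝓝 l) := by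
    intro F v
    refine cauchySeq_tendsto_of_complete (Metric.cauchySeq_iff'.mpr fun ε hε => ?_)
    obtain ⟨N, hN⟩ := hcau F (ε / 2) (half_pos hε)
    exact ⟨N, fun n hn => (hN N le_rfl n hn v).trans_lt (half_lt_self hε)⟩
  choose l hl using hex
  have hunif : ∀ F : C_c(Z, ℝ), TendstoUniformly (fun n => (s n).eval F) (l F) atTop := by
    intro F
    rw [Metric.tendstoUniformly_iff]
    intro ε hε
    obtain ⟨N, hN⟩ := hcau F (ε / 2) (half_pos hε)
    filter_upwards [eventually_ge_atTop N] with n hn v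
    refine lt_of_le_of_lt (b := ε / 2) ?_ (half_lt_self hε)
    rw [Real.dist_eq]
    refine le_of_tendsto ((hl F v).sub_const _).abs ?_
    filter_upwards [eventually_ge_atTop n] with m hm
    exact hN n hn m hm v
  have hevalc : ∀ n (F : Z → ℝ), Continuous ((s n).eval F) := fun n F =>
    continuous_finsetSum _ fun i _ => ((s n).continuous i).mul continuous_const
  let Λ : V → C_c(Z, ℝ) →ₗ[ℝ] ℝ := fun v =>
    { toFun := fun F => l F v
      map_add' := fun F F' => by
        refine tendsto_nhds_unique (hl (F + F') v) (((hl F v).add (hl F' v)).congr fun n => ?_)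
        simp [WeightedFamily.eval, mul_add, Finset.sum_add_distrib]
      map_smul' := fun r F => by
        refine tendsto_nhds_unique (hl (r • F) v) (((hl F v).const_mul r).congr fun n => ?_)
        simp [WeightedFamily.eval, Finset.mul_sum, mul_left_comm] }
  have hone : ∀ v (F : C_c(Z, ℝ)), (∀ z ∈ S, F z = 1) → Λ v F = w₀ v := by
    intro v F hF
    refine tendsto_nhds_unique (hl F v) (tendsto_const_nhds.congr fun n => ?_)
    rw [WeightedFamily.eval, ← (s n).sum]
    refine Finset.sum_congr rfl fun i _ => ?_
    by_cases hw : (s n).w i v = 0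
    · rw [hw, zero_mul]
    · obtain ⟨z, hz, -⟩ := (s n).exists_mem i v hw
      rw [hF _ ((s n).subset i ((s n).pt_mem i ⟨z, hz⟩)), mul_one]
  obtain ⟨ρ, hρ, -, hρ1, -⟩ := IsKernel.exists_of_functional (D := fun v => {z | p z = v}) hS hcl Λ
    (fun v F hF => by
      -- Representatives are close to points of the fibre, where `F` is nonnegative.
      refine le_of_forall_pos_le_add fun ε hε => ?_
      obtain ⟨N, hN⟩ := hosc F ε hε
      rw [← neg_le_iff_add_nonneg]
      refine ge_of_tendsto (hl F v) ?_
      filter_upwards [eventually_ge_atTop N] with n hn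
      calc -ε ≤ -ε * w₀ v := by nlinarith [hwle v]
        _ = ∑ i, (s n).w i v * (-ε) := by rw [← Finset.sum_mul, (s n).sum, mul_comm]
        _ ≤ (s n).eval F v := Finset.sum_le_sum fun i _ => by
          by_cases hw : (s n).w i v = 0
          · simp [hw]
          · obtain ⟨z, hz, hzv⟩ := (s n).exists_mem i v hw
            have h1 := hF z ((s n).subset i hz) hzv
            have h2 := (abs_le.mp (hN n hn i _ ((s n).pt_mem i ⟨z, hz⟩) z hz)).1
            exact mul_le_mul_of_nonneg_left (by linarith) ((s n).nonneg i v))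
    (fun v F hF => (hone v F hF).trans_le (hwle v))
    (fun F => (hunif F).continuous (Frequently.of_forall fun n => hevalc n F))
  exact ⟨ρ, hρ, fun v hv => hρ1 v fun F hF => (hone v F hF).trans (hw1 v hv)⟩

namespace LCGroupoid

variable {G H : LCGroupoid.{u}}

theorem secondCountableTopology_obj (G : LCGroupoid.{u}) [SecondCountableTopology G.Arrow] :
    SecondCountableTopology G.Obj :=
  (Function.LeftInverse.isEmbedding G.r_e G.continuous_r G.continuous_e
    ).isInducing.secondCountableTopology

namespace Bispace

variable {Z : Type u} [TopologicalSpace Z]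

/-- In the presence of a section, `Z` embeds into `G⁽⁰⁾ × H`. -/
theorem isInducing_section (E : Bispace G H Z) {σ : G.Obj → Z} (hσc : Continuous σ)
    (hσ : ∀ x, E.a.p (σ x) = x) :
    IsInducing fun z => (E.a.p z, E.db (σ (E.a.p z)) z) := by
  have hι : Continuous fun z => (E.a.p z, E.db (σ (E.a.p z)) z) :=
    E.a.continuous_p.prodMk (E.continuousOn_db.comp_continuous
      ((hσc.comp E.a.continuous_p).prodMk continuous_id) fun z => hσ _)
  have hj : ContinuousOn (fun q : G.Obj × H.Arrow => E.b.actT (H.inv q.2) (σ q.1))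
      {q | H.r q.2 = E.b.p (σ q.1)} :=
    E.b.continuousOn_actT.comp (f := fun q : G.Obj × H.Arrow => (H.inv q.2, σ q.1))
      ((H.continuous_inv.comp continuous_snd).prodMk (hσc.comp continuous_fst)).continuousOn
      fun q hq => (H.s_inv _).trans hq
  rw [isInducing_iff_nhds]
  intro z
  refine le_antisymm (map_le_iff_le_comap.mp hι.continuousAt) ?_
  have hT : ∀ z, (E.a.p z, E.db (σ (E.a.p z)) z) ∈
      {q : G.Obj × H.Arrow | H.r q.2 = E.b.p (σ q.1)} := fun z => E.r_db (hσ _)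
  have h1 := (hj _ (hT z)).tendsto.comp (tendsto_nhdsWithin_iff.mpr
    ⟨tendsto_comap (f := fun z => (E.a.p z, E.db (σ (E.a.p z)) z)), Eventually.of_forall hT⟩)
  have h2 : ∀ z, E.b.actT (H.inv (E.db (σ (E.a.p z)) z)) (σ (E.a.p z)) = z := fun z =>
    inv_db_actT (hσ _)
  have h3 : ((fun q : G.Obj × H.Arrow => E.b.actT (H.inv q.2) (σ q.1)) ∘
      fun z => (E.a.p z, E.db (σ (E.a.p z)) z)) = id := funext h2
  rw [h3, h2 z] at h1
  exact h1

/-- If `G` and `H` are second countable, then the section makes `Z` second countable, hence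
metrizable. -/
theorem hasFiberKernels_of_secondCountable [T2Space Z] [LocallyCompactSpace Z] [MeasurableSpace Z]
    [BorelSpace Z] (E : Bispace G H Z) [SecondCountableTopology G.Arrow]
    [SecondCountableTopology H.Arrow] {σ : G.Obj → Z} (hσc : Continuous σ)
    (hσ : ∀ x, E.a.p (σ x) = x) : E.HasFiberKernels H.unitAction := by
  have := G.secondCountableTopology_obj
  have := H.secondCountableTopology_obj
  have := (E.isInducing_section hσc hσ).secondCountableTopology
  have : TopologicalSpace.MetrizableSpace Z :=
    TopologicalSpace.metrizableSpace_of_t3_secondCountable Z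
  have : TopologicalSpace.MetrizableSpace H.Obj :=
    TopologicalSpace.metrizableSpace_of_t3_secondCountable H.Obj
  intro L hL
  obtain ⟨S, hS, hLS⟩ := E.swap.exists_isCompact_image (L := L) hL
  exact ⟨S, exists_isKernel_of_metrizable E.b.continuous_p E.isOpenMap_b hS hL hLS⟩

end Bispace

end LCGroupoid

theorem mainTheorem8 (G H : LCGroupoid.{u}) :
    (LCGroupoid.Equivalent G H → H.AmenableAtInfinity → G.AmenableAtInfinity) ∧
    (∀ (Z : Type u) [TopologicalSpace Z] [T2Space Z] [LocallyCompactSpace Z]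
      (E : LCGroupoid.MoritaEquivalence G H Z),
      (G.HasHaarSystem ∨
        (SecondCountableTopology G.Arrow ∧ SecondCountableTopology H.Arrow)) →
      (∃ σ : G.Obj → Z, Continuous σ ∧ ∀ x, E.left.p (σ x) = x) →
      H.StronglyAmenableAtInfinity → G.StronglyAmenableAtInfinity) := by
  refine ⟨fun h hH => h.amenableAtInfinity hH, fun Z _ _ _ E hG => ?_⟩
  rintro ⟨σ, hσc, hσ⟩ hH
  let : MeasurableSpace Z := borel Z
  have : BorelSpace Z := ⟨rfl⟩
  refine E.toBispace.stronglyAmenableAtInfinity hσc hσ ?_ hH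
  obtain hG | ⟨_, _⟩ := hG
  · exact E.toBispace.hasFiberKernels_of_hasHaarSystem hG
  · exact E.toBispace.hasFiberKernels_of_secondCountable hσc hσ
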